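/- Let $\mathbb T=\mathbb R/2\pi\mathbb Z$, and write $u=\sum_{k\in\mathbb Z}\hat u_k e^{ikx}$ for functions on $\mathbb T$. For $s\ge 0$ let $H^s_0(\mathbb T)$ be the space of real-valued $u\in L^2(\mathbb T)$ with $\hat u_0=0$ and $\|u\|_s:=\|(1-\partial_x^2)^{s/2}u\|_{L^2(\mathbb T)}=\big(2\pi\sum_{k}(1+k^2)^s|\hat u_k|^2\big)^{1/2}<\infty$. Fix a function $a\in C^\infty(\mathbb T,\mathbb R)$ with $a\ge 0$ and $\int_{\mathbb T}a(x)\,dx=1$, and set $$(Gu)(x)=a(x)\Big(u(x)-\int_{\mathbb T}a(y)u(y)\,dy\Big),\qquad \widehat{\mathcal H u}_k=-i\,\mathrm{sgn}(k)\,\hat u_k,\qquad \widehat{Du}_k=|k|\,\hat u_k .$$ Let $s\in(\tfrac12,2]$. Then there exists $\rho>0$ (depending only on $s$ and $a$) such that for every $u_0\in H^s_0(\mathbb T)$ with $\|u_0\|_s<\rho$ there exists $T>0$ such that the Benjamin–Ono equation with localized damping $$u_t+\mathcal H u_{xx}+\Big(\frac{u^2}{2}\Big)_x=-G(D(Gu)),\qquad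 u(0)=u_0,$$ has exactly one solution $u$ in the space $$Z_{s,T}=C([0,T],H^s_0(\mathbb T))\cap L^2(0,T;H^{s+\frac12}_0(\mathbb T)).$$ Here $u\in Z_{s,T}$ is a solution if $u(0)=u_0$ and the equation holds in the sense of distributions: for every $\varphi\in C^\infty(\mathbb T,\mathbb C)$ and every $t\in[0,T]$, with $(f,g)=\int_{\mathbb T}f(x)g(x)\,dx$, $$(u(t),\varphi)=(u_0,\varphi)+\int_0^t\Big[(u(\tau),\mathcal H\varphi_{xx})+\Big(\frac{u(\tau)^2}{2},\varphi_x\Big)-(u(\tau),GDG\varphi)\Big]\,d\tau .$$ -/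

import Mathlib

open MeasureTheory Set Filter Topology
open scoped ENNReal ContDiff

noncomputable section

namespace BenjaminOno

/-- The torus `ℝ / 2πℤ`, carrying the Lebesgue measure `dx` of total mass `2π`. -/
abbrev Torus : Type := AddCircle (2 * Real.pi)

instance factTwoPiPos : Fact (0 < 2 * Real.pi) := ⟨Real.two_pi_pos⟩

/-- Real-valued square integrable functions on the torus. -/
abbrev L2 : Type := Lp ℝ 2 (volume : Measure Torus)

/-- The Fourier coefficient `û_k = (1 / 2π) ∫ u(x) e^{-ikx} dx`. -/
def coeff (f : L2) (k : ℤ) : ℂ := fourierCoeff (fun x : Torus => ((f x : ℝ) : ℂ)) k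

/-- The norm `‖f‖_s = ‖(1 - ∂ₓ²)^{s/2} f‖_{L²}`, i.e. the square root of
`2π ∑_k (1 + k²)^s |f̂_k|²`, with value `∞` if `f` (in `L²`) does not belong to `H^s`. -/
def sobolevNorm (s : ℝ) (f : L2) : ℝ≥0∞ :=
  (ENNReal.ofReal (2 * Real.pi) *
    ∑' k : ℤ, ENNReal.ofReal ((1 + (k : ℝ) ^ 2) ^ s) * ‖coeff f k‖ₑ ^ 2) ^ (1 / 2 : ℝ)

/-- The space `H^s_0` (for `s ≥ 0`): functions of `H^s` whose mean value vanishes. -/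
def H0 (s : ℝ) : Set L2 := {f | sobolevNorm s f < ⊤ ∧ coeff f 0 = 0}

/-- `u ∈ C([0,T], H^s_0)`. -/
def ContinuousInH0 (s T : ℝ) (u : ℝ → L2) : Prop :=
  (∀ t ∈ Icc 0 T, u t ∈ H0 s) ∧
    ∀ t ∈ Icc 0 T, Tendsto (fun r => sobolevNorm s (u r - u t)) (𝓝[Icc 0 T] t) (𝓝 0)

/-- The space `Z_{s,T} = C([0,T], H^s_0) ∩ L²(0,T; H^{s+1/2}_0)`, for `s ≥ 0`.
The curves are considered on `[0,T]` only. The finiteness of the integral forces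
`u t ∈ H^{s+1/2}` for almost every `t`; strong measurability into the separable Hilbert space
`H^{s+1/2}` is automatic, since all Fourier coefficients of `u t` are continuous in `t`. -/
def Z (s T : ℝ) : Set (ℝ → L2) :=
  {u | ContinuousInH0 s T u ∧ ∫⁻ t in Ioo 0 T, sobolevNorm (s + 1 / 2) (u t) ^ 2 < ⊤}

/-- Smooth (`C^∞`) functions on the torus: those with a smooth periodic lift to `ℝ`. -/
def Smooth {E : Type*} [NormedAddCommGroup E] [NormedSpace ℝ E] (f : Torus → E) : Prop :=
  ContDiff ℝ ∞ (fun x : ℝ => f (x : Torus))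

/-- The derivative of a function on the torus. -/
def dx (φ : Torus → ℂ) (x : Torus) : ℂ := deriv (fun h : ℝ => φ (x + (h : Torus))) 0

/-- The Fourier multiplier with symbol `m`, on smooth functions. -/
def multiplier (m : ℤ → ℂ) (φ : Torus → ℂ) (x : Torus) : ℂ :=
  ∑' k : ℤ, m k * fourierCoeff φ k * fourier k x

/-- The Hilbert transform `ℋ`, of symbol `-i sgn k`. -/
def hilbert : (Torus → ℂ) → Torus → ℂ :=
  multiplier fun k => -Complex.I * ((Int.sign k : ℤ) : ℂ)

/-- The operator `D`, of symbol `|k|`. -/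
def absD : (Torus → ℂ) → Torus → ℂ :=
  multiplier fun k => ((|k| : ℤ) : ℂ)

/-- The operator `(G φ)(x) = a(x) (φ(x) - ∫ a(y) φ(y) dy)`. -/
def G (a : Torus → ℝ) (φ : Torus → ℂ) (x : Torus) : ℂ :=
  (a x : ℂ) * (φ x - ∫ y : Torus, (a y : ℂ) * φ y)

/-- The bilinear pairing `∫ f(x) φ(x) dx`. -/
def pairing (f : Torus → ℝ) (φ : Torus → ℂ) : ℂ := ∫ x : Torus, (f x : ℂ) * φ x

/-- `u` solves, on `[0,T]` and in the sense of distributions on the torus,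
`u_t + ℋ u_xx + (u² / 2)_x = - G (D (G u))`, `u(0) = u₀`.
The equation is integrated in time and tested against every smooth function `φ`. For the pairing
`∫ f φ dx` the operators `ℋ` and `∂ₓ` are antisymmetric, while `D` and `G` are symmetric. -/
def IsSolution (a : Torus → ℝ) (T : ℝ) (u₀ : L2) (u : ℝ → L2) : Prop :=
  u 0 = u₀ ∧
  ∀ φ : Torus → ℂ, Smooth φ → ∀ t ∈ Icc 0 T,
    pairing (u t) φ = pairing u₀ φ +
      ∫ τ in (0 : ℝ)..t,
        (pairing (u τ) (hilbert (dx (dx φ)))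
          + pairing (fun x => (u τ x) ^ 2 / 2) (dx φ)
          - pairing (u τ) (G a (absD (G a φ))))

end BenjaminOno

end

noncomputable section

namespace BenjaminOno

open scoped ComplexConjugate NNReal

/-! ### Weights and weighted square norms of sequences -/

/-! Everything is done on Fourier coefficients. By itself the damping controls only `‖D^{1/2} G u‖`,
half a derivative where `a` does not vanish. The theorem holds because dispersion carries this gain
to the whole torus. Let `q` be a primitive of `a² - b`, with `b > 0` the mean of `a²`. Commuting
multiplication by `q` with the dispersive symbol `k|k|` contributes `‖a D^{1/2} u‖² - b ‖D^{1/2}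
u‖²` to `Re (q u, u_t)`, up to terms bounded in `L²` (`dispersive_form_le`). The positive square is
dominated by the damping (`smoothing_le_dampEnergy`). So for a large constant `M` the energy `((q +
M) u, u)`, equivalent to the `L²` norm, dissipates the full `H^{1/2}` norm and tolerates forcing in
`H^{-1/2}` (`exists_isDissipative`).

This gain of half a derivative on each side exactly pays for the derivative in `(u²/2)_x`. Since `s
> 1/2`, product estimates put the nonlinearity in the admissible space with a factor of the `H^s`
norm, and smallness lets the dissipation absorb it. Two inequalities result. `exists_high_energy`
works at level `H^s`; the weight `(1 - ∂²)^{s/2}` commutes with `G D G` up to an `L²`-bounded error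
when `s ≤ 2`. `exists_difference_energy` works in `L²` for differences and uses the equation only
for modes up to `N`, the remaining modes costing `O(N^{1-2s})`. Its integrated form
`exists_stability` gives uniqueness and also the Cauchy property of the Galerkin approximations,
whence `exists_wellposed`.

Strong continuity in `H^s` is dominated convergence over the modes (`tendsto_hs_sub`). On the torus,
a distributional solution is the same as a family of modes solving integral equations
(`IsSolution.coeff_eq`, `isSolution_of_isApprox`). Reality of the solution follows from uniqueness
applied to the conjugate, and the zero mode is conserved because `∫ a = 1`. A competing solution is
not assumed small; a continuity argument (`eq_of_isSolution`) keeps it in the ball where uniqueness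
is known. -/

/-- The weight `(1 + k²)^σ`. -/
def wt (σ : ℝ) (k : ℤ) : ℝ := (1 + (k : ℝ) ^ 2) ^ σ

lemma one_le_base (k : ℤ) : (1 : ℝ) ≤ 1 + (k : ℝ) ^ 2 := by nlinarith [sq_nonneg (k : ℝ)]

lemma wt_pos (σ : ℝ) (k : ℤ) : 0 < wt σ k :=
  Real.rpow_pos_of_pos (by linarith [one_le_base k]) _

lemma wt_nonneg (σ : ℝ) (k : ℤ) : 0 ≤ wt σ k := (wt_pos σ k).le

lemma wt_ne_zero (σ : ℝ) (k : ℤ) : wt σ k ≠ 0 := (wt_pos σ k).ne'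

@[simp] lemma wt_zero (k : ℤ) : wt 0 k = 1 := by simp [wt]

lemma wt_one (k : ℤ) : wt 1 k = 1 + (k : ℝ) ^ 2 := by simp [wt]

@[simp] lemma wt_neg_arg (σ : ℝ) (k : ℤ) : wt σ (-k) = wt σ k := by simp [wt]

lemma wt_sub_comm (σ : ℝ) (k j : ℤ) : wt σ (k - j) = wt σ (j - k) := by
  rw [← wt_neg_arg]; congr 1; ring

lemma wt_mul (σ τ : ℝ) (k : ℤ) : wt σ k * wt τ k = wt (σ + τ) k :=
  (Real.rpow_add (by linarith [one_le_base k]) _ _).symm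

lemma wt_sq (σ : ℝ) (k : ℤ) : wt σ k ^ 2 = wt (2 * σ) k := by
  rw [sq, wt_mul]; congr 1; ring

lemma wt_half_sq (σ : ℝ) (k : ℤ) : wt (σ / 2) k ^ 2 = wt σ k := by
  rw [wt_sq]; congr 1; ring

lemma wt_neg (σ : ℝ) (k : ℤ) : wt (-σ) k = (wt σ k)⁻¹ :=
  Real.rpow_neg (by linarith [one_le_base k]) _

lemma wt_mono {σ τ : ℝ} (h : σ ≤ τ) (k : ℤ) : wt σ k ≤ wt τ k :=
  Real.rpow_le_rpow_of_exponent_le (one_le_base k) h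

lemma one_le_wt {σ : ℝ} (h : 0 ≤ σ) (k : ℤ) : 1 ≤ wt σ k := by
  simpa using wt_mono h k

lemma abs_le_wt (k : ℤ) : |(k : ℝ)| ≤ wt (1 / 2) k := by
  apply abs_le_of_sq_le_sq _ (wt_nonneg _ _)
  rw [wt_sq]; norm_num [wt_one]

lemma wt_half_le (k : ℤ) : wt (1 / 2) k ≤ 1 + |(k : ℝ)| := by
  apply le_of_sq_le_sq _ (by positivity)
  rw [wt_sq]; norm_num [wt_one]
  nlinarith [abs_nonneg (k : ℝ), sq_abs (k : ℝ)]

/-- Peetre's inequality for nonnegative exponents. -/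
lemma wt_add_le {σ : ℝ} (h : 0 ≤ σ) (k j : ℤ) : wt σ k ≤ 2 ^ σ * wt σ (k - j) * wt σ j := by
  unfold wt
  rw [← Real.mul_rpow (by norm_num) (by positivity), ← Real.mul_rpow (by positivity) (by positivity)]
  apply Real.rpow_le_rpow (by positivity) _ h
  push_cast
  -- With `m = k - j`, the difference of the two sides is `1 + (m - j)² + 2 m² j²`.
  nlinarith [sq_nonneg ((k : ℝ) - 2 * j), sq_nonneg (((k : ℝ) - j) * j)]

/-- Peetre's inequality. -/
lemma wt_peetre (σ : ℝ) (k j : ℤ) : wt σ k ≤ 2 ^ |σ| * wt |σ| (k - j) * wt σ j := by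
  rcases le_total 0 σ with h | h
  · rw [abs_of_nonneg h]; exact wt_add_le h k j
  · rw [abs_of_nonpos h]
    -- For a negative exponent, exchange `k` and `j` and take reciprocals.
    have := wt_add_le (neg_nonneg.2 h) j k
    rw [wt_neg, wt_neg σ k, wt_sub_comm] at this
    have h1 := wt_pos σ k
    have h2 := wt_pos σ j
    rw [inv_le_iff_one_le_mul₀ h2] at this
    calc wt σ k = 1 * wt σ k := by ring
      _ ≤ (2 ^ (-σ) * wt (-σ) (k - j) * (wt σ k)⁻¹ * wt σ j) * wt σ k := by gcongr
      _ = _ := by field_simp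

lemma summable_wt {σ : ℝ} (h : 1 / 2 < σ) : Summable (wt (-σ)) := by
  have h1 : Summable fun k : ℤ => 2 ^ σ * |(k : ℝ)| ^ (-(2 * σ)) := by
    apply Summable.mul_left
    exact Real.summable_abs_int_rpow (by linarith)
  refine Summable.of_norm_bounded_eventually (g := fun k : ℤ => 2 ^ σ * |(k : ℝ)| ^ (-(2 * σ))) h1 ?_
  have : ∀ᶠ k : ℤ in cofinite, k ≠ 0 := (finite_singleton (0 : ℤ)).compl_mem_cofinite
  filter_upwards [this] with k hk
  have hk1 : (0 : ℝ) < |(k : ℝ)| := by positivity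
  rw [Real.norm_of_nonneg (wt_nonneg _ _), wt, neg_mul_eq_mul_neg, Real.rpow_mul hk1.le]
  have h2 : |(k : ℝ)| ^ (2 : ℝ) = (k : ℝ) ^ 2 := by
    rw [show (2 : ℝ) = ((2 : ℕ) : ℝ) by norm_num, Real.rpow_natCast, sq_abs]
  rw [h2]
  calc (1 + (k : ℝ) ^ 2) ^ (-σ) ≤ ((k : ℝ) ^ 2) ^ (-σ) :=
        Real.rpow_le_rpow_of_nonpos (by positivity) (by linarith) (by linarith)
    _ ≤ 2 ^ σ * ((k : ℝ) ^ 2) ^ (-σ) :=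
        le_mul_of_one_le_left (by positivity) (Real.one_le_rpow (by norm_num) (by linarith))

/-- The squared norm `∑ (1 + k²)^σ |u_k|²`, with values in `[0, ∞]`. -/
def hs (σ : ℝ) (u : ℤ → ℂ) : ℝ≥0∞ := ∑' k, ENNReal.ofReal (wt σ k) * ‖u k‖ₑ ^ 2

lemma hs_term (σ : ℝ) (k : ℤ) (z : ℂ) :
    ENNReal.ofReal (wt σ k) * ‖z‖ₑ ^ 2 = ENNReal.ofReal (wt σ k * ‖z‖ ^ 2) := by
  rw [ENNReal.ofReal_mul (wt_nonneg _ _), ENNReal.ofReal_pow (norm_nonneg _), ofReal_norm]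

lemma hs_term' (σ : ℝ) (k : ℤ) (z : ℂ) :
    ENNReal.ofReal (wt σ k) * ‖z‖ₑ ^ 2 = (ENNReal.ofReal (wt (σ / 2) k) * ‖z‖ₑ) ^ 2 := by
  rw [mul_pow, ← ENNReal.ofReal_pow (wt_nonneg _ _), wt_half_sq]

lemma hs_mono {σ τ : ℝ} (h : σ ≤ τ) (u : ℤ → ℂ) : hs σ u ≤ hs τ u := by
  unfold hs; gcongr with k; exact wt_mono h k

lemma two_mul_le_sq_add_sq (a b : ℝ≥0∞) : 2 * (a * b) ≤ a ^ 2 + b ^ 2 := by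
  induction a with
  | top => simp
  | coe a =>
    induction b with
    | top => simp
    | coe b =>
      have := two_mul_le_add_sq a b
      rw [mul_assoc] at this
      exact_mod_cast this

lemma add_sq_le_two (a b : ℝ≥0∞) : (a + b) ^ 2 ≤ 2 * (a ^ 2 + b ^ 2) := by
  calc (a + b) ^ 2 = a ^ 2 + b ^ 2 + 2 * (a * b) := by ring
    _ ≤ a ^ 2 + b ^ 2 + (a ^ 2 + b ^ 2) := by gcongr; exact two_mul_le_sq_add_sq a b
    _ = _ := by ring

lemma hs_add_le (σ : ℝ) (u v : ℤ → ℂ) : hs σ (fun k => u k + v k) ≤ 2 * (hs σ u + hs σ v) := by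
  unfold hs
  rw [← ENNReal.tsum_add, ← ENNReal.tsum_mul_left]
  refine ENNReal.tsum_le_tsum fun k => ?_
  calc ENNReal.ofReal (wt σ k) * ‖u k + v k‖ₑ ^ 2
      ≤ ENNReal.ofReal (wt σ k) * (2 * (‖u k‖ₑ ^ 2 + ‖v k‖ₑ ^ 2)) := by
        gcongr; exact (pow_le_pow_left' (enorm_add_le _ _) 2).trans (add_sq_le_two _ _)
    _ = _ := by ring

lemma hs_sub_le (σ : ℝ) (u v : ℤ → ℂ) : hs σ (fun k => u k - v k) ≤ 2 * (hs σ u + hs σ v) := by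
  have := hs_add_le σ u (fun k => -v k)
  simpa [sub_eq_add_neg, hs] using this

/-- Each mode is controlled by the weighted norm. -/
lemma norm_le_of_hs_le {s η : ℝ} (hη : 0 ≤ η) {u : ℤ → ℂ}
    (h : hs s u ≤ ENNReal.ofReal (η ^ 2)) (k : ℤ) : ‖u k‖ ≤ η * wt (-(s / 2)) k := by
  have h1 : ENNReal.ofReal (wt s k * ‖u k‖ ^ 2) ≤ ENNReal.ofReal (η ^ 2) := by
    rw [← hs_term]; exact (ENNReal.le_tsum k).trans h
  rw [ENNReal.ofReal_le_ofReal_iff (by positivity)] at h1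
  rw [wt_neg, ← div_eq_mul_inv, le_div_iff₀ (wt_pos _ _)]
  apply le_of_sq_le_sq _ hη
  rw [mul_pow, wt_half_sq]; linarith

/-! ### Young's inequality -/

/-- Expand the square as a double sum and use `2 x_i x_j ≤ x_i² + x_j²`. Working in `[0, ∞]` avoids
every summability question and every square root. -/
lemma tsum_mul_sq_le (a x : ℤ → ℝ≥0∞) :
    (∑' j, a j * x j) ^ 2 ≤ (∑' j, a j) * ∑' j, a j * x j ^ 2 := by
  have key : 2 * (∑' j, a j * x j) ^ 2 ≤ 2 * ((∑' j, a j) * ∑' j, a j * x j ^ 2) := by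
    calc 2 * (∑' j, a j * x j) ^ 2 = ∑' i, ∑' j, a i * a j * (2 * (x i * x j)) := by
          rw [sq, ← ENNReal.tsum_mul_right, ← ENNReal.tsum_mul_left]
          congr 1; ext i
          rw [← ENNReal.tsum_mul_left, ← ENNReal.tsum_mul_left]
          congr 1; ext j; ring
      _ ≤ ∑' i, ∑' j, a i * a j * (x i ^ 2 + x j ^ 2) := by
          gcongr with i j; exact two_mul_le_sq_add_sq _ _
      _ = ∑' i, ∑' j, (a i * (a j * x j ^ 2) + a j * (a i * x i ^ 2)) := by
          congr 1; ext i; congr 1; ext j; ring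
      _ = _ := by
          simp_rw [ENNReal.tsum_add, ENNReal.tsum_mul_left, ENNReal.tsum_mul_right,
            ENNReal.tsum_mul_left]
          ring
  exact (ENNReal.mul_le_mul_iff_right (by norm_num) (by norm_num)).1 key

lemma tsum_cauchy_schwarz (a x : ℤ → ℝ≥0∞) :
    (∑' j, a j * x j) ^ 2 ≤ (∑' j, a j ^ 2) * ∑' j, x j ^ 2 := by
  have key : 2 * (∑' j, a j * x j) ^ 2 ≤ 2 * ((∑' j, a j ^ 2) * ∑' j, x j ^ 2) := by
    calc 2 * (∑' j, a j * x j) ^ 2 = ∑' i, ∑' j, (2 * ((a i * x j) * (a j * x i))) := by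
          rw [sq, ← ENNReal.tsum_mul_right, ← ENNReal.tsum_mul_left]
          congr 1; ext i
          rw [← ENNReal.tsum_mul_left, ← ENNReal.tsum_mul_left]
          congr 1; ext j; ring
      _ ≤ ∑' i, ∑' j, ((a i * x j) ^ 2 + (a j * x i) ^ 2) := by
          gcongr with i j; exact two_mul_le_sq_add_sq _ _
      _ = _ := by
          simp_rw [ENNReal.tsum_add, mul_pow, ENNReal.tsum_mul_left, ENNReal.tsum_mul_right,
            ENNReal.tsum_mul_left]
          ring
  exact (ENNReal.mul_le_mul_iff_right (by norm_num) (by norm_num)).1 key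

lemma tsum_shift (h : ℤ → ℝ≥0∞) (j : ℤ) : ∑' k, h (k - j) = ∑' k, h k :=
  (Equiv.subRight j).tsum_eq h

lemma tsum_shift' (h : ℤ → ℝ≥0∞) (k : ℤ) : ∑' j, h (k - j) = ∑' j, h j :=
  (Equiv.subLeft k).tsum_eq h

/-- Young's inequality `ℓ¹ * ℓ² ⊂ ℓ²`. -/
lemma young (h x : ℤ → ℝ≥0∞) :
    ∑' k, (∑' j, h (k - j) * x j) ^ 2 ≤ (∑' m, h m) ^ 2 * ∑' j, x j ^ 2 := by
  calc ∑' k, (∑' j, h (k - j) * x j) ^ 2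
      ≤ ∑' k, (∑' m, h m) * ∑' j, h (k - j) * x j ^ 2 := by
        gcongr with k
        rw [← tsum_shift' h k]
        exact tsum_mul_sq_le _ _
    _ = _ := by
        rw [ENNReal.tsum_mul_left, ENNReal.tsum_comm]
        simp_rw [ENNReal.tsum_mul_right, tsum_shift, ENNReal.tsum_mul_left]
        ring

/-- A bound for operators given by matrices decaying off the diagonal. -/
lemma hs_matrix_le {σ τ C : ℝ} (hC : 0 ≤ C) {M : ℤ → ℤ → ℂ}
    (hM : ∀ k j, wt (τ / 2) k * ‖M k j‖ ≤ C * wt (-1) (k - j) * wt (σ / 2) j) (u : ℤ → ℂ) :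
    hs τ (fun k => ∑' j, M k j * u j) ≤ ENNReal.ofReal ((C * ∑' m, wt (-1) m) ^ 2) * hs σ u := by
  have hZ : ∑' m, ENNReal.ofReal (wt (-1) m) = ENNReal.ofReal (∑' m, wt (-1) m) :=
    (ENNReal.ofReal_tsum_of_nonneg (fun m => wt_nonneg _ _) (summable_wt (by norm_num))).symm
  calc hs τ (fun k => ∑' j, M k j * u j)
      ≤ ∑' k, (∑' j, (ENNReal.ofReal C * ENNReal.ofReal (wt (-1) (k - j))) *
          (ENNReal.ofReal (wt (σ / 2) j) * ‖u j‖ₑ)) ^ 2 := by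
        unfold hs
        gcongr with k
        rw [hs_term']
        gcongr
        calc ENNReal.ofReal (wt (τ / 2) k) * ‖∑' j, M k j * u j‖ₑ
            ≤ ENNReal.ofReal (wt (τ / 2) k) * ∑' j, ‖M k j * u j‖ₑ := by
              gcongr; exact enorm_tsum_le_tsum_enorm
          _ = ∑' j, (ENNReal.ofReal (wt (τ / 2) k) * ‖M k j‖ₑ) * ‖u j‖ₑ := by
              rw [← ENNReal.tsum_mul_left]; simp_rw [enorm_mul, mul_assoc]
          _ ≤ _ := by
              refine ENNReal.tsum_le_tsum fun j => ?_
              rw [← mul_assoc]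
              refine mul_le_mul_left ?_ _
              rw [← ofReal_norm, ← ENNReal.ofReal_mul (wt_nonneg _ _), ← ENNReal.ofReal_mul hC,
                ← ENNReal.ofReal_mul (mul_nonneg hC (wt_nonneg _ _))]
              exact ENNReal.ofReal_le_ofReal (hM k j)
    _ ≤ (∑' m, ENNReal.ofReal C * ENNReal.ofReal (wt (-1) m)) ^ 2 *
          ∑' j, (ENNReal.ofReal (wt (σ / 2) j) * ‖u j‖ₑ) ^ 2 :=
        young (fun m => ENNReal.ofReal C * ENNReal.ofReal (wt (-1) m)) _
    _ = _ := by
        simp_rw [← hs_term']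
        rw [ENNReal.tsum_mul_left, hZ, ← ENNReal.ofReal_mul hC, ← ENNReal.ofReal_pow
          (mul_nonneg hC (tsum_nonneg fun m => wt_nonneg _ _))]
        rfl

/-! ### Truncated norms -/

/-- The squared norm of the modes in the finite set `S`. -/
def nf (σ : ℝ) (S : Finset ℤ) (x : ℤ → ℂ) : ℝ := ∑ k ∈ S, wt σ k * ‖x k‖ ^ 2

lemma nf_nonneg (σ : ℝ) (S : Finset ℤ) (x : ℤ → ℂ) : 0 ≤ nf σ S x :=
  Finset.sum_nonneg fun k _ => mul_nonneg (wt_nonneg _ _) (by positivity)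

lemma nf_mono {σ τ : ℝ} (h : σ ≤ τ) (S : Finset ℤ) (x : ℤ → ℂ) : nf σ S x ≤ nf τ S x :=
  Finset.sum_le_sum fun k _ => by gcongr; exact wt_mono h k

lemma ofReal_nf (σ : ℝ) (S : Finset ℤ) (x : ℤ → ℂ) :
    ENNReal.ofReal (nf σ S x) = ∑ k ∈ S, ENNReal.ofReal (wt σ k) * ‖x k‖ₑ ^ 2 := by
  rw [nf, ENNReal.ofReal_sum_of_nonneg fun k _ => mul_nonneg (wt_nonneg _ _) (by positivity)]
  exact Finset.sum_congr rfl fun k _ => (hs_term _ _ _).symm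

lemma ofReal_nf_le_hs (σ : ℝ) (S : Finset ℤ) (x : ℤ → ℂ) :
    ENNReal.ofReal (nf σ S x) ≤ hs σ x := by
  rw [ofReal_nf]; exact ENNReal.sum_le_tsum S

lemma hs_eq_nf (σ : ℝ) {S : Finset ℤ} {x : ℤ → ℂ} (h : ∀ k ∉ S, x k = 0) :
    hs σ x = ENNReal.ofReal (nf σ S x) := by
  rw [ofReal_nf, hs, tsum_eq_sum]
  intro k hk; simp [h k hk]

lemma nf_le_of_hs_le {σ b : ℝ} (hb : 0 ≤ b) {x : ℤ → ℂ} (h : hs σ x ≤ ENNReal.ofReal b)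
    (S : Finset ℤ) : nf σ S x ≤ b :=
  (ENNReal.ofReal_le_ofReal_iff hb).1 ((ofReal_nf_le_hs σ S x).trans h)

lemma summable_of_hs_le {σ b : ℝ} (hb : 0 ≤ b) {x : ℤ → ℂ} (h : hs σ x ≤ ENNReal.ofReal b) :
    Summable (fun k => wt σ k * ‖x k‖ ^ 2) :=
  summable_of_sum_le (fun k => mul_nonneg (wt_nonneg _ _) (by positivity))
    fun S => nf_le_of_hs_le hb h S

lemma tsum_le_of_hs_le {σ b : ℝ} (hb : 0 ≤ b) {x : ℤ → ℂ} (h : hs σ x ≤ ENNReal.ofReal b) :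
    ∑' k, wt σ k * ‖x k‖ ^ 2 ≤ b :=
  Real.tsum_le_of_sum_le (fun k => mul_nonneg (wt_nonneg _ _) (by positivity))
    fun S => nf_le_of_hs_le hb h S

/-- The total mass of the weight `(1 + k²)⁻¹`. -/
def wtMass : ℝ := ∑' m, wt (-1) m

lemma wtMass_nonneg : 0 ≤ wtMass := tsum_nonneg fun _ => wt_nonneg _ _

/-- Only modes in `S` enter, but the output is measured over all of `ℤ`: the matrices used below do
not preserve the truncation. -/
lemma hs_sum_matrix_le {σ τ C : ℝ} (hC : 0 ≤ C) {M : ℤ → ℤ → ℂ}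
    (hM : ∀ k j, wt (τ / 2) k * ‖M k j‖ ≤ C * wt (-1) (k - j) * wt (σ / 2) j)
    (S : Finset ℤ) (x : ℤ → ℂ) :
    hs τ (fun k => ∑ j ∈ S, M k j * x j) ≤ ENNReal.ofReal ((C * wtMass) ^ 2 * nf σ S x) := by
  have h := hs_matrix_le hC hM (fun j => if j ∈ S then x j else 0)
  rw [hs_eq_nf σ (S := S) (by simp +contextual)] at h
  have h1 : nf σ S (fun j => if j ∈ S then x j else 0) = nf σ S x :=
    Finset.sum_congr rfl fun k hk => by simp [hk]
  have h2 : ∀ k, ∑' j, M k j * (if j ∈ S then x j else 0) = ∑ j ∈ S, M k j * x j := by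
    intro k
    rw [tsum_eq_sum (s := S) (by simp +contextual)]
    exact Finset.sum_congr rfl fun k hk => by simp [hk]
  simp_rw [h2, h1] at h
  rwa [← ENNReal.ofReal_mul (by positivity)] at h

/-! ### The damping matrix -/

/-- Algebraic decay of a sequence. -/
def Decay (A : ℤ → ℂ) : Prop := ∃ C, 0 ≤ C ∧ ∀ k, ‖A k‖ ≤ C * wt (-4) k

/-- The matrix of `G` in the Fourier basis, if `A` are the Fourier coefficients of `a`. -/
def gmat (A : ℤ → ℂ) (k j : ℤ) : ℂ := A (k - j) - 2 * Real.pi * A k * A (-j)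

/-- The matrix of `G D G` in the Fourier basis. -/
def dampMat (A : ℤ → ℂ) (k j : ℤ) : ℂ := ∑' l : ℤ, gmat A k l * (|(l : ℝ)| : ℝ) * gmat A l j

/-- The operator `G D G` on sequences. -/
def damp (A : ℤ → ℂ) (u : ℤ → ℂ) (k : ℤ) : ℂ := ∑' j, dampMat A k j * u j

/-- Peetre's inequality read backwards. It makes off-diagonal decay survive composition of matrices,
once one extra power has been set aside for summing over the intermediate index. -/
lemma wt_neg_mul_le {r : ℝ} (hr : 0 ≤ r) (k l j : ℤ) :
    wt (-r) (k - l) * wt (-r) (l - j) ≤ 2 ^ r * wt (-r) (k - j) := by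
  have h := wt_add_le hr (k - j) (l - j)
  rw [show k - j - (l - j) = k - l by ring] at h
  rw [wt_neg, wt_neg, wt_neg, ← mul_inv, ← div_eq_mul_inv, inv_le_comm₀, inv_div]
  · rw [div_le_iff₀ (by positivity)]; linarith
  · exact mul_pos (wt_pos _ _) (wt_pos _ _)
  · exact div_pos (by positivity) (wt_pos _ _)

/-- The rank-one part `A k * A (-j)` decays in `k` and in `j` separately, hence in `k - j`, by
passing through the intermediate index `0`. -/
lemma gmat_bound {A : ℤ → ℂ} (hA : Decay A) :
    ∃ C, 0 ≤ C ∧ ∀ k j, ‖gmat A k j‖ ≤ C * wt (-4) (k - j) := by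
  obtain ⟨C, hC, h⟩ := hA
  refine ⟨C + 2 * Real.pi * C ^ 2 * 2 ^ (4 : ℝ), by positivity, fun k j => ?_⟩
  have h1 := wt_neg_mul_le (r := 4) (by norm_num) k 0 j
  simp only [sub_zero, zero_sub] at h1
  calc ‖gmat A k j‖ ≤ ‖A (k - j)‖ + 2 * Real.pi * (‖A k‖ * ‖A (-j)‖) := by
        refine (norm_sub_le _ _).trans (le_of_eq ?_)
        simp [abs_of_pos Real.pi_pos]; ring
    _ ≤ C * wt (-4) (k - j) + 2 * Real.pi * ((C * wt (-4) k) * (C * wt (-4) (-j))) := by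
        have := wt_nonneg (-4) k
        gcongr
        · exact h _
        · exact h _
        · exact h _
    _ = C * wt (-4) (k - j) + 2 * Real.pi * C ^ 2 * (wt (-4) k * wt (-4) (-j)) := by ring
    _ ≤ C * wt (-4) (k - j) + 2 * Real.pi * C ^ 2 * (2 ^ (4 : ℝ) * wt (-4) (k - j)) := by gcongr
    _ = _ := by ring

lemma gmat_conj {A : ℤ → ℂ} (hA : ∀ k, A (-k) = conj (A k)) (k j : ℤ) :
    conj (gmat A k j) = gmat A j k := by
  simp only [gmat, map_sub, map_mul, Complex.conj_ofReal, ← hA, neg_sub, neg_neg, Complex.conj_ofNat]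
  ring

/-- Of the four powers of decay in `k - l`, one is kept for the sum over `l`. The factor `|l|` is
moved onto `j` by Peetre's inequality, at the cost of half a power in `l - j`. -/
lemma dampMat_term_le {A : ℤ → ℂ} {C : ℝ} (hC : 0 ≤ C)
    (hg : ∀ k j, ‖gmat A k j‖ ≤ C * wt (-4) (k - j)) (k l j : ℤ) :
    ‖gmat A k l * (|(l : ℝ)| : ℝ) * gmat A l j‖ ≤
      C ^ 2 * (2 ^ (1 / 2 : ℝ) * 2 ^ (3 : ℝ)) * wt (-3) (k - j) * wt (1 / 2) j * wt (-1) (k - l) := by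
  have h1 := wt_neg_mul_le (r := 3) (by norm_num) k l j
  have h2 := wt_add_le (σ := 1 / 2) (by norm_num) l j
  have e1 : wt (-4) (k - l) = wt (-3) (k - l) * wt (-1) (k - l) := by rw [wt_mul]; norm_num
  have e2 : wt (-4) (l - j) * wt (1 / 2) (l - j) ≤ wt (-3) (l - j) := by
    rw [wt_mul]; exact wt_mono (by norm_num) _
  have := wt_nonneg (-4) (k - l)
  have := wt_nonneg (-4) (l - j)
  have := wt_nonneg (1 / 2) (l - j)
  have := wt_nonneg (1 / 2) j
  have := wt_nonneg (-3) (k - l)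
  have := wt_nonneg (-1) (k - l)
  calc ‖gmat A k l * (|(l : ℝ)| : ℝ) * gmat A l j‖ = ‖gmat A k l‖ * |(l : ℝ)| * ‖gmat A l j‖ := by
        simp
    _ ≤ (C * wt (-4) (k - l)) * (2 ^ (1 / 2 : ℝ) * wt (1 / 2) (l - j) * wt (1 / 2) j) *
          (C * wt (-4) (l - j)) := by
        gcongr
        · exact hg _ _
        · exact (abs_le_wt l).trans h2
        · exact hg _ _
    _ = C ^ 2 * 2 ^ (1 / 2 : ℝ) * wt (1 / 2) j * wt (-1) (k - l) *
          (wt (-3) (k - l) * (wt (-4) (l - j) * wt (1 / 2) (l - j))) := by rw [e1]; ring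
    _ ≤ C ^ 2 * 2 ^ (1 / 2 : ℝ) * wt (1 / 2) j * wt (-1) (k - l) *
          (2 ^ (3 : ℝ) * wt (-3) (k - j)) := by
        refine mul_le_mul_of_nonneg_left ?_ (by positivity)
        exact (mul_le_mul_of_nonneg_left e2 (wt_nonneg _ _)).trans h1
    _ = _ := by ring

lemma summable_wt_sub (k : ℤ) : Summable fun l => wt (-1) (k - l) :=
  (Equiv.subLeft k).summable_iff.2 (summable_wt (by norm_num))

lemma tsum_wt_sub (k : ℤ) : ∑' l, wt (-1) (k - l) = wtMass :=
  (Equiv.subLeft k).tsum_eq _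

lemma summable_dampMat {A : ℤ → ℂ} (hA : Decay A) (k j : ℤ) :
    Summable fun l : ℤ => gmat A k l * (|(l : ℝ)| : ℝ) * gmat A l j := by
  obtain ⟨C, hC, hg⟩ := gmat_bound hA
  exact Summable.of_norm_bounded ((summable_wt_sub k).mul_left _)
    fun l => dampMat_term_le hC hg k l j

lemma dampMat_bound {A : ℤ → ℂ} (hA : Decay A) :
    ∃ C, 0 ≤ C ∧ ∀ k j, ‖dampMat A k j‖ ≤ C * wt (-3) (k - j) * wt (1 / 2) j := by
  obtain ⟨C, hC, hg⟩ := gmat_bound hA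
  refine ⟨C ^ 2 * (2 ^ (1 / 2 : ℝ) * 2 ^ (3 : ℝ)) * wtMass,
    mul_nonneg (by positivity) wtMass_nonneg, fun k j => ?_⟩
  have := tsum_of_norm_bounded ((summable_wt_sub k).mul_left _).hasSum
    fun l => dampMat_term_le hC hg k l j
  rw [tsum_mul_left, tsum_wt_sub] at this
  refine this.trans (le_of_eq ?_); ring

/-- `G D G` loses one derivative. -/
lemma hs_damp_le {A : ℤ → ℂ} (hA : Decay A) {σ : ℝ} (h0 : 0 ≤ σ) (h2 : σ ≤ 2) :
    ∃ C : ℝ, 0 ≤ C ∧ ∀ u, hs (σ - 1 / 2) (damp A u) ≤ ENNReal.ofReal C * hs (σ + 1 / 2) u := by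
  obtain ⟨C, hC, hN⟩ := dampMat_bound hA
  -- Peetre's inequality with exponent `e` moves the output weight from `k` to `j`. The range of `σ`
  -- gives `|e| ≤ 1`, which three powers of decay can afford.
  set e := (σ - 1 / 2) / 2 with he
  have he1 : |e| ≤ 1 := abs_le.2 ⟨by linarith, by linarith⟩
  refine ⟨_, sq_nonneg _, fun u => hs_matrix_le (C := 2 ^ |e| * C) (by positivity) ?_ u⟩
  intro k j
  have h1 := wt_peetre e k j
  have h3 : wt |e| (k - j) * wt (-3) (k - j) ≤ wt (-1) (k - j) := by
    rw [wt_mul]; exact wt_mono (by linarith) _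
  have h4 : wt e j * wt (1 / 2) j = wt ((σ + 1 / 2) / 2) j := by
    rw [wt_mul]; congr 1; rw [he]; ring
  have := wt_nonneg |e| (k - j)
  have := wt_nonneg e j
  have := wt_nonneg ((σ + 1 / 2) / 2) j
  calc wt e k * ‖dampMat A k j‖
      ≤ (2 ^ |e| * wt |e| (k - j) * wt e j) * (C * wt (-3) (k - j) * wt (1 / 2) j) := by
        gcongr; exact hN k j
    _ = 2 ^ |e| * C * (wt |e| (k - j) * wt (-3) (k - j)) * (wt e j * wt (1 / 2) j) := by ring
    _ ≤ _ := by rw [h4]; gcongr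

/-- The commutator of `(1 - ∂²)^{s/2}` with an operator of order one. -/
lemma abs_wt_div_sub_one_le {s : ℝ} (h0 : 0 ≤ s) (h2 : s ≤ 2) (k j : ℤ) :
    |wt (s / 2) k / wt (s / 2) j - 1| ≤ 3 * wt 1 (k - j) * wt (-(1 / 2)) j := by
  have hj := wt_pos 1 j
  have hk := wt_pos 1 k
  set ρ := wt 1 k / wt 1 j with hρ
  have hρ0 : 0 < ρ := div_pos hk hj
  have e1 : wt (s / 2) k / wt (s / 2) j = ρ ^ (s / 2) := by
    rw [hρ, Real.div_rpow hk.le hj.le]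
    simp only [wt, Real.rpow_one]
  -- Here `s ≤ 2` enters: a power with exponent in `[0, 1]` brings `ρ` closer to `1`.
  have h1 : |ρ ^ (s / 2) - 1| ≤ |ρ - 1| := by
    rcases le_total 1 ρ with h | h
    · have a1 := Real.one_le_rpow h (by linarith : 0 ≤ s / 2)
      have a2 := Real.rpow_le_rpow_of_exponent_le h (by linarith : s / 2 ≤ 1)
      rw [Real.rpow_one] at a2
      rw [abs_of_nonneg (by linarith), abs_of_nonneg (by linarith)]; linarith
    · have a1 := Real.rpow_le_one hρ0.le h (by linarith : 0 ≤ s / 2)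
      have a2 := Real.rpow_le_rpow_of_exponent_ge hρ0 h (by linarith : s / 2 ≤ 1)
      rw [Real.rpow_one] at a2
      rw [abs_of_nonpos (by linarith), abs_of_nonpos (by linarith)]; linarith
  rw [e1]
  refine h1.trans ?_
  have e2 : ρ - 1 = ((k : ℝ) ^ 2 - (j : ℝ) ^ 2) * wt (-1) j := by
    rw [wt_neg, hρ]; field_simp; simp only [wt_one]; ring
  have e3 : wt (-1) j * wt (1 / 2) j = wt (-(1 / 2)) j := by rw [wt_mul]; norm_num
  rw [e2, abs_mul, abs_of_pos (wt_pos _ _), ← e3]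
  -- Since `k² - j² = (k - j)² + 2 (k - j) j`, the difference grows only linearly in `j`; this is
  -- the derivative gained by the commutator.
  have h3 : |(k : ℝ) ^ 2 - (j : ℝ) ^ 2| ≤ 3 * wt 1 (k - j) * wt (1 / 2) j := by
    have b1 := abs_le_wt j
    have b2 := one_le_wt (σ := 1 / 2) (by norm_num) j
    rw [wt_one]; push_cast
    have : (k : ℝ) ^ 2 - (j : ℝ) ^ 2 = (k - j) * (k - j) + 2 * ((k - j) * j) := by ring
    rw [this]
    have t : |((k : ℝ) - j) * (k - j) + 2 * ((k - j) * j)| ≤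
        ((k : ℝ) - j) ^ 2 + 2 * (|(k : ℝ) - j| * |(j : ℝ)|) := by
      refine (abs_add_le _ _).trans ?_
      rw [abs_mul 2, abs_mul, abs_mul, abs_mul_abs_self]; norm_num; nlinarith
    have t2 : 2 * |(k : ℝ) - j| ≤ 1 + ((k : ℝ) - j) ^ 2 := by
      nlinarith [sq_nonneg (|(k : ℝ) - j| - 1), sq_abs ((k : ℝ) - j)]
    nlinarith [abs_nonneg ((k : ℝ) - j), abs_nonneg (j : ℝ), sq_nonneg ((k : ℝ) - j),
      mul_le_mul_of_nonneg_left b1 (abs_nonneg ((k : ℝ) - j))]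
  calc |(k : ℝ) ^ 2 - (j : ℝ) ^ 2| * wt (-1) j ≤ (3 * wt 1 (k - j) * wt (1 / 2) j) * wt (-1) j := by
        gcongr; exact wt_nonneg _ _
    _ = _ := by ring

/-! ### The multiplier of the energy method -/

/-- The autocorrelation of `A`; for Fourier coefficients of `a`, those of `a²`. -/
def autocorr (A : ℤ → ℂ) (m : ℤ) : ℂ := ∑' l, A (l + m) * conj (A l)

/-- The Fourier coefficients of a primitive of `-(a² - mean)`, up to normalisation. -/
def prim (A : ℤ → ℂ) (m : ℤ) : ℂ := -Complex.I * autocorr A m / m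

lemma autocorr_term_le {A : ℤ → ℂ} {C : ℝ} (hC : 0 ≤ C) (hA : ∀ k, ‖A k‖ ≤ C * wt (-4) k)
    (m l : ℤ) : ‖A (l + m) * conj (A l)‖ ≤ C ^ 2 * 2 ^ (3 : ℝ) * wt (-3) m * wt (-1) l := by
  have h1 := wt_neg_mul_le (r := 3) (by norm_num) m (-l) 0
  simp only [sub_zero, sub_neg_eq_add, wt_neg_arg] at h1
  have e1 : wt (-4) l = wt (-3) l * wt (-1) l := by rw [wt_mul]; norm_num
  have e2 : wt (-4) (l + m) ≤ wt (-3) (m + l) := by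
    rw [add_comm]; exact wt_mono (by norm_num) _
  have := wt_nonneg (-4) l
  have := wt_nonneg (-4) (l + m)
  have := wt_nonneg (-1) l
  calc ‖A (l + m) * conj (A l)‖ = ‖A (l + m)‖ * ‖A l‖ := by simp
    _ ≤ (C * wt (-4) (l + m)) * (C * wt (-4) l) := by
        gcongr
        · exact hA _
        · exact hA _
    _ ≤ (C * wt (-3) (m + l)) * (C * wt (-4) l) := by gcongr
    _ = C ^ 2 * wt (-1) l * (wt (-3) (m + l) * wt (-3) l) := by rw [e1]; ring
    _ ≤ C ^ 2 * wt (-1) l * (2 ^ (3 : ℝ) * wt (-3) m) := by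
        refine mul_le_mul_of_nonneg_left h1 (by positivity)
    _ = _ := by ring

lemma summable_wt_neg_one : Summable (wt (-1)) := summable_wt (by norm_num)

lemma summable_autocorr {A : ℤ → ℂ} (hA : Decay A) (m : ℤ) :
    Summable fun l => A (l + m) * conj (A l) := by
  obtain ⟨C, hC, h⟩ := hA
  exact Summable.of_norm_bounded (summable_wt_neg_one.mul_left _) fun l => autocorr_term_le hC h m l

lemma autocorr_bound {A : ℤ → ℂ} (hA : Decay A) :
    ∃ C, 0 ≤ C ∧ ∀ m, ‖autocorr A m‖ ≤ C * wt (-3) m := by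
  obtain ⟨C, hC, h⟩ := hA
  refine ⟨C ^ 2 * 2 ^ (3 : ℝ) * wtMass, mul_nonneg (by positivity) wtMass_nonneg, fun m => ?_⟩
  have := tsum_of_norm_bounded (summable_wt_neg_one.mul_left _).hasSum
    fun l => autocorr_term_le hC h m l
  rw [tsum_mul_left] at this
  refine this.trans (le_of_eq ?_); unfold wtMass; ring

lemma autocorr_conj (A : ℤ → ℂ) (m : ℤ) : autocorr A (-m) = conj (autocorr A m) := by
  unfold autocorr
  rw [Complex.conj_tsum, ← (Equiv.addRight m).tsum_eq]
  congr 1; ext l; simp [mul_comm]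

lemma autocorr_shift {A : ℤ → ℂ} (hA : Decay A) (k j : ℤ) :
    HasSum (fun l => A (l - j) * conj (A (l - k))) (autocorr A (k - j)) := by
  have := (Equiv.subRight k).hasSum_iff.2 (summable_autocorr hA (k - j)).hasSum
  convert this using 2 with l
  · simp
  · rfl

/-- This `b = ∑ |A l|²` is the mean of `a²` and will be the rate of dissipation; one nonzero mode is
enough for its positivity. -/
lemma autocorr_zero {A : ℤ → ℂ} (hA : Decay A) (h0 : A 0 ≠ 0) :
    ∃ b : ℝ, 0 < b ∧ autocorr A 0 = b := by
  have h : ∀ l, A (l + 0) * conj (A l) = ((‖A l‖ ^ 2 : ℝ) : ℂ) := by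
    intro l; rw [add_zero, Complex.mul_conj, Complex.normSq_eq_norm_sq]
  have hs : Summable fun l => ‖A l‖ ^ 2 := by
    have := summable_autocorr hA 0
    simp_rw [h] at this
    exact_mod_cast this
  refine ⟨∑' l, ‖A l‖ ^ 2, ?_, ?_⟩
  · exact hs.tsum_pos (fun l => by positivity) 0 (by positivity)
  · unfold autocorr; simp_rw [h]; rw [Complex.ofReal_tsum]

lemma prim_conj (A : ℤ → ℂ) (m : ℤ) : prim A (-m) = conj (prim A m) := by
  simp [prim, autocorr_conj]

lemma prim_bound {A : ℤ → ℂ} (hA : Decay A) :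
    ∃ C, 0 ≤ C ∧ ∀ m, ‖prim A m‖ ≤ C * wt (-3) m := by
  obtain ⟨C, hC, h⟩ := autocorr_bound hA
  refine ⟨C, hC, fun m => ?_⟩
  rcases eq_or_ne m 0 with rfl | hm
  · simpa [prim] using mul_nonneg hC (wt_nonneg _ _)
  · refine le_trans ?_ (h m)
    simp only [prim, norm_div, norm_mul, norm_neg, Complex.norm_I, one_mul]
    apply div_le_self (norm_nonneg _)
    rw [Complex.norm_intCast]
    exact_mod_cast Int.one_le_abs hm

/-- The relation breaks exactly at `m = 0`, where division by zero makes `prim` vanish while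
`autocorr` has the value `b`. This missing mode is the source of the dissipation on the whole torus.
-/
lemma I_mul_prim {A : ℤ → ℂ} {m : ℤ} (hm : m ≠ 0) : Complex.I * m * prim A m = autocorr A m := by
  have : (m : ℂ) ≠ 0 := by exact_mod_cast hm
  unfold prim
  field_simp
  simp

/-! ### Bilinear bounds -/

lemma sum_wt_sub_le (S : Finset ℤ) (k : ℤ) : ∑ j ∈ S, wt (-1) (k - j) ≤ wtMass := by
  rw [← tsum_wt_sub k]
  exact (summable_wt_sub k).sum_le_tsum S fun _ _ => wt_nonneg _ _

/-- Schur's test: rows and columns of the kernel have mass at most `wtMass`, and `2 |x_j| |x_k| ≤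
|x_j|² + |x_k|²`. -/
lemma norm_form_le {C : ℝ} (hC : 0 ≤ C) {e : ℤ → ℤ → ℂ}
    (he : ∀ k j, ‖e k j‖ ≤ C * wt (-1) (k - j)) (S : Finset ℤ) (x : ℤ → ℂ) :
    ‖∑ k ∈ S, ∑ j ∈ S, e k j * x j * conj (x k)‖ ≤ C * wtMass * nf 0 S x := by
  have h1 : ∑ k ∈ S, ∑ j ∈ S, wt (-1) (k - j) * ‖x k‖ ^ 2 ≤ wtMass * nf 0 S x := by
    simp_rw [nf, wt_zero, one_mul, ← Finset.sum_mul, Finset.mul_sum]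
    gcongr with k; exact sum_wt_sub_le S k
  have h2 : ∑ k ∈ S, ∑ j ∈ S, wt (-1) (k - j) * ‖x j‖ ^ 2 ≤ wtMass * nf 0 S x := by
    rw [Finset.sum_comm]
    simp_rw [wt_sub_comm (-1)]
    exact h1
  calc ‖∑ k ∈ S, ∑ j ∈ S, e k j * x j * conj (x k)‖
      ≤ ∑ k ∈ S, ∑ j ∈ S, C * ((wt (-1) (k - j) * ‖x k‖ ^ 2 + wt (-1) (k - j) * ‖x j‖ ^ 2) / 2) := by
        refine (norm_sum_le _ _).trans (Finset.sum_le_sum fun k _ => ?_)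
        refine (norm_sum_le _ _).trans (Finset.sum_le_sum fun j _ => ?_)
        rw [norm_mul, norm_mul, RCLike.norm_conj]
        have := wt_nonneg (-1) (k - j)
        calc ‖e k j‖ * ‖x j‖ * ‖x k‖ ≤ C * wt (-1) (k - j) * ‖x j‖ * ‖x k‖ := by
              gcongr; exact he k j
          _ = C * (wt (-1) (k - j) * (2 * ‖x j‖ * ‖x k‖) / 2) := by ring
          _ ≤ C * (wt (-1) (k - j) * (‖x j‖ ^ 2 + ‖x k‖ ^ 2) / 2) := by
              gcongr; exact two_mul_le_add_sq _ _
          _ = _ := by ring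
    _ = C * ((∑ k ∈ S, ∑ j ∈ S, wt (-1) (k - j) * ‖x k‖ ^ 2 +
          ∑ k ∈ S, ∑ j ∈ S, wt (-1) (k - j) * ‖x j‖ ^ 2) / 2) := by
        simp_rw [← Finset.sum_add_distrib, Finset.sum_div, Finset.mul_sum]
    _ ≤ C * ((wtMass * nf 0 S x + wtMass * nf 0 S x) / 2) := by gcongr
    _ = _ := by ring

/-- Matrices with off-diagonal decay are bounded in all weighted spaces of moderate order. -/
lemma weight_matrix_le {C : ℝ} (hC : 0 ≤ C) {M : ℤ → ℤ → ℂ}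
    (hM : ∀ k j, ‖M k j‖ ≤ C * wt (-3) (k - j)) {σ : ℝ} (hσ : |σ / 2| ≤ 2) (k j : ℤ) :
    wt (σ / 2) k * ‖M k j‖ ≤ (2 ^ |σ / 2| * C) * wt (-1) (k - j) * wt (σ / 2) j := by
  have h1 := wt_peetre (σ / 2) k j
  have h3 : wt |σ / 2| (k - j) * wt (-3) (k - j) ≤ wt (-1) (k - j) := by
    rw [wt_mul]; exact wt_mono (by linarith) _
  have := wt_nonneg (σ / 2) j
  have := wt_nonneg |σ / 2| (k - j)
  calc wt (σ / 2) k * ‖M k j‖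
      ≤ (2 ^ |σ / 2| * wt |σ / 2| (k - j) * wt (σ / 2) j) * (C * wt (-3) (k - j)) := by
        gcongr; exact hM k j
    _ = (2 ^ |σ / 2| * C) * (wt |σ / 2| (k - j) * wt (-3) (k - j)) * wt (σ / 2) j := by ring
    _ ≤ _ := by gcongr

/-! ### The dispersive term -/

/-- The symbol of `-i` times the dispersive operator. -/
def disp (k : ℤ) : ℝ := (k : ℝ) * |(k : ℝ)|

lemma sq_sqrt_sub_sqrt_le {a b : ℝ} (ha : 0 ≤ a) (hb : 0 ≤ b) :
    (√a - √b) ^ 2 ≤ |a - b| := by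
  have h1 := Real.sq_sqrt ha
  have h2 := Real.sq_sqrt hb
  have h3 := Real.sqrt_nonneg a
  have h4 := Real.sqrt_nonneg b
  rcases le_total a b with h | h
  · have := Real.sqrt_le_sqrt h
    rw [abs_of_nonpos (by linarith)]; nlinarith
  · have := Real.sqrt_le_sqrt h
    rw [abs_of_nonneg (by linarith)]; nlinarith

/-- The difference quotient of `k|k|` is close to `|k| + |j|`. Replacing half of that by the
geometric mean costs `(√|k| - √|j|)² / 2`, at most `|k - j| / 2`. The product form `√|k| √|j|` is
what allows the leading part to be recognised as a square. -/
lemma disp_sub_le (k j : ℤ) :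
    |(disp k - disp j) / 2 - (k - j) * (√|(k : ℝ)| * √|(j : ℝ)|)| ≤ ((k : ℝ) - j) ^ 2 := by
  have hk := Real.sq_sqrt (abs_nonneg (k : ℝ))
  have hj := Real.sq_sqrt (abs_nonneg (j : ℝ))
  have h1 : (√|(k : ℝ)| - √|(j : ℝ)|) ^ 2 ≤ |(k : ℝ) - j| :=
    (sq_sqrt_sub_sqrt_le (abs_nonneg _) (abs_nonneg _)).trans (abs_abs_sub_abs_le _ _)
  have h2 : |(disp k - disp j) - ((k : ℝ) - j) * (|(k : ℝ)| + |(j : ℝ)|)| ≤ ((k : ℝ) - j) ^ 2 := by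
    unfold disp
    rcases le_total 0 (k : ℝ) with h | h <;> rcases le_total 0 (j : ℝ) with h' | h' <;>
    simp only [abs_of_nonneg, abs_of_nonpos, h, h'] <;> rw [abs_le] <;> constructor <;> nlinarith
  have e : (disp k - disp j) / 2 - (k - j) * (√|(k : ℝ)| * √|(j : ℝ)|) =
      ((disp k - disp j) - ((k : ℝ) - j) * (|(k : ℝ)| + |(j : ℝ)|)) / 2 +
        ((k : ℝ) - j) * (√|(k : ℝ)| - √|(j : ℝ)|) ^ 2 / 2 := by
    linear_combination (-((k : ℝ) - j) / 2) * (hk + hj)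
  rw [e]
  refine (abs_add_le _ _).trans ?_
  rw [abs_div, abs_div, abs_mul, abs_of_nonneg (sq_nonneg (√|(k : ℝ)| - √|(j : ℝ)|)), abs_two]
  have h3 : |(k : ℝ) - j| * (√|(k : ℝ)| - √|(j : ℝ)|) ^ 2 ≤ |(k : ℝ) - j| * |(k : ℝ) - j| := by gcongr
  rw [abs_mul_abs_self] at h3
  linarith

/-- Conjugation exchanges `k` and `j` since `q` is Hermitian, so the real part sees only the
commutator of `q` with the symbol `θ`. -/
lemma re_antisymm {q : ℤ → ℂ} (hq : ∀ m, q (-m) = conj (q m)) (θ : ℤ → ℝ) (S : Finset ℤ)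
    (x : ℤ → ℂ) :
    (∑ k ∈ S, ∑ j ∈ S, Complex.I * θ k * q (k - j) * x j * conj (x k)).re =
      (∑ k ∈ S, ∑ j ∈ S,
        Complex.I * ((θ k - θ j) / 2 : ℝ) * q (k - j) * x j * conj (x k)).re := by
  set T := ∑ k ∈ S, ∑ j ∈ S, Complex.I * θ k * q (k - j) * x j * conj (x k) with hT
  have h : conj T = ∑ k ∈ S, ∑ j ∈ S, -(Complex.I * θ j * q (k - j) * x j * conj (x k)) := by
    rw [Finset.sum_comm, hT]
    simp only [map_sum, map_mul, Complex.conj_I, Complex.conj_ofReal, Complex.conj_conj, ← hq,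
      neg_sub]
    refine Finset.sum_congr rfl fun k _ => Finset.sum_congr rfl fun j _ => ?_
    ring
  have h2 : (T.re : ℂ) = ∑ k ∈ S, ∑ j ∈ S,
        Complex.I * ((θ k - θ j) / 2 : ℝ) * q (k - j) * x j * conj (x k) := by
    rw [Complex.re_eq_add_conj, h, hT, ← Finset.sum_add_distrib, Finset.sum_div]
    refine Finset.sum_congr rfl fun k _ => ?_
    rw [← Finset.sum_add_distrib, Finset.sum_div]
    refine Finset.sum_congr rfl fun j _ => ?_
    push_cast; ring
  rw [← h2, Complex.ofReal_re]

/-- Parseval for the product `a y`: expand the square and sum over `l` first. -/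
lemma hasSum_sq_norm_conv {A : ℤ → ℂ} (hA : Decay A) (S : Finset ℤ) (y : ℤ → ℂ) :
    HasSum (fun l => ‖∑ j ∈ S, A (l - j) * y j‖ ^ 2)
      (∑ k ∈ S, ∑ j ∈ S, autocorr A (k - j) * y j * conj (y k)).re := by
  have h : HasSum (fun l => ∑ k ∈ S, ∑ j ∈ S, (A (l - j) * conj (A (l - k))) * (y j * conj (y k)))
      (∑ k ∈ S, ∑ j ∈ S, autocorr A (k - j) * (y j * conj (y k))) :=
    hasSum_sum fun k _ => hasSum_sum fun j _ => (autocorr_shift hA k j).mul_right _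
  have h2 := Complex.hasSum_re h
  convert h2 using 2 with l
  · have : (((‖∑ j ∈ S, A (l - j) * y j‖ ^ 2 : ℝ)) : ℂ) = ∑ k ∈ S, ∑ j ∈ S, (A (l - j) * conj (A (l - k))) * (y j * conj (y k)) := by
      rw [← Complex.normSq_eq_norm_sq, ← Complex.mul_conj, map_sum, Finset.sum_mul_sum,
        Finset.sum_comm]
      refine Finset.sum_congr rfl fun k _ => Finset.sum_congr rfl fun j _ => ?_
      simp only [map_mul]; ring
    rw [← this, Complex.ofReal_re]
  · simp_rw [mul_assoc]

/-- By antisymmetrisation and `disp_sub_le` the form has leading kernel `i (k - j) q_{k-j} √|k|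
√|j|`, where `q` is `prim A`. That is the kernel of `a²` between two copies of `D^{1/2}`, with the
diagonal `b |k|` removed. -/
lemma dispersive_form_le {A : ℤ → ℂ} (hA : Decay A) {b : ℝ} (hb : autocorr A 0 = b) :
    ∃ C, 0 ≤ C ∧ ∀ (S : Finset ℤ) (x : ℤ → ℂ),
      (∑ k ∈ S, (∑ j ∈ S, prim A (k - j) * x j) * conj (-Complex.I * disp k * x k)).re ≤
        ∑' l, ‖∑ j ∈ S, A (l - j) * ((√|(j : ℝ)| : ℝ) * x j)‖ ^ 2
          - b * ∑ k ∈ S, |(k : ℝ)| * ‖x k‖ ^ 2 + C * nf 0 S x := by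
  obtain ⟨C, hC, hq⟩ := prim_bound hA
  refine ⟨C * wtMass, mul_nonneg hC wtMass_nonneg, fun S x => ?_⟩
  rw [(hasSum_sq_norm_conv hA S _).tsum_eq]
  have e1 : ∑ k ∈ S, (∑ j ∈ S, prim A (k - j) * x j) * conj (-Complex.I * disp k * x k) =
      ∑ k ∈ S, ∑ j ∈ S, Complex.I * disp k * prim A (k - j) * x j * conj (x k) := by
    refine Finset.sum_congr rfl fun k _ => ?_
    rw [Finset.sum_mul]
    refine Finset.sum_congr rfl fun j _ => ?_
    simp; ring
  rw [e1, re_antisymm (prim_conj A)]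
  have e2 : ((b * ∑ k ∈ S, |(k : ℝ)| * ‖x k‖ ^ 2 : ℝ) : ℂ) = ∑ k ∈ S, ∑ j ∈ S,
      (if k = j then (b * |(k : ℝ)| : ℝ) else 0 : ℂ) * x j * conj (x k) := by
    push_cast
    rw [Finset.mul_sum]
    refine Finset.sum_congr rfl fun k hk => ?_
    rw [Finset.sum_eq_single k]
    · rw [if_pos rfl, mul_assoc _ (x k), Complex.mul_conj, Complex.normSq_eq_norm_sq]
      push_cast; ring
    · intro j _ hj; simp [hj.symm]
    · intro h; exact absurd hk h
  -- The error kernel. It vanishes on the diagonal because `autocorr A 0 = b`; off the diagonal it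
  -- is `prim A (k - j)` times a quantity of size at most `(k - j)²`, which the decay of `prim`
  -- absorbs.
  set e : ℤ → ℤ → ℂ := fun k j => Complex.I * ((disp k - disp j) / 2 : ℝ) * prim A (k - j)
      - autocorr A (k - j) * ((√|(k : ℝ)| : ℝ) * (√|(j : ℝ)| : ℝ))
      + (if k = j then (b * |(k : ℝ)| : ℝ) else 0 : ℂ) with he
  have he1 : ∀ k j, ‖e k j‖ ≤ C * wt (-1) (k - j) := by
    intro k j
    rcases eq_or_ne k j with rfl | hkj
    · have : e k k = 0 := by
        simp only [he, sub_self, hb]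
        rw [← Complex.ofReal_mul, Real.mul_self_sqrt (abs_nonneg _)]
        push_cast; simp
      rw [this, norm_zero]; exact mul_nonneg hC (wt_nonneg _ _)
    · have : e k j = Complex.I * prim A (k - j) *
          ((disp k - disp j) / 2 - (k - j) * (√|(k : ℝ)| * √|(j : ℝ)|) : ℝ) := by
        simp only [he, hkj, if_false, ← I_mul_prim (sub_ne_zero.2 hkj)]
        push_cast; ring
      rw [this, norm_mul, norm_mul, Complex.norm_I, one_mul, Complex.norm_real, Real.norm_eq_abs]
      have h3 : ((k : ℝ) - j) ^ 2 ≤ wt 1 (k - j) := by rw [wt_one]; push_cast; linarith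
      have := wt_nonneg (-3) (k - j)
      calc ‖prim A (k - j)‖ * _ ≤ (C * wt (-3) (k - j)) * wt 1 (k - j) := by
            gcongr
            · exact hq _
            · exact (disp_sub_le k j).trans h3
        _ = C * wt (-2) (k - j) := by rw [mul_assoc, wt_mul]; norm_num
        _ ≤ _ := by gcongr; exact wt_mono (by norm_num) _
  have e3 := norm_form_le hC he1 S x
  have e4 : ∑ k ∈ S, ∑ j ∈ S, e k j * x j * conj (x k) =
      ∑ k ∈ S, ∑ j ∈ S, Complex.I * ((disp k - disp j) / 2 : ℝ) * prim A (k - j) * x j * conj (x k)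
      - ∑ k ∈ S, ∑ j ∈ S, autocorr A (k - j) * ((√|(j : ℝ)| : ℝ) * x j) *
          conj ((√|(k : ℝ)| : ℝ) * x k)
      + ((b * ∑ k ∈ S, |(k : ℝ)| * ‖x k‖ ^ 2 : ℝ) : ℂ) := by
    rw [e2, ← Finset.sum_sub_distrib, ← Finset.sum_add_distrib]
    refine Finset.sum_congr rfl fun k _ => ?_
    rw [← Finset.sum_sub_distrib, ← Finset.sum_add_distrib]
    refine Finset.sum_congr rfl fun j _ => ?_
    simp only [he, map_mul, Complex.conj_ofReal]; ring
  have e5 := (Complex.re_le_norm _).trans e3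
  rw [e4, Complex.add_re, Complex.sub_re, Complex.ofReal_re] at e5
  linarith

/-! ### The damping term -/

/-- The image of the modes of `x` in `S` under `G`. -/
def gsum (A : ℤ → ℂ) (S : Finset ℤ) (x : ℤ → ℂ) (l : ℤ) : ℂ := ∑ j ∈ S, gmat A l j * x j

/-- The matrix of `G` is Hermitian, so the outer `G` can be moved onto `y`. -/
lemma hasSum_damp_form {A : ℤ → ℂ} (hA : Decay A) (hc : ∀ k, A (-k) = conj (A k))
    (S : Finset ℤ) (x y : ℤ → ℂ) :
    HasSum (fun l : ℤ => (|(l : ℝ)| : ℝ) * (gsum A S y l * conj (gsum A S x l)))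
      (∑ k ∈ S, y k * conj (∑ j ∈ S, dampMat A k j * x j)) := by
  have h1 : ∀ k j, HasSum (fun l : ℤ => gmat A l k * (|(l : ℝ)| : ℝ) * conj (gmat A l j))
      (conj (dampMat A k j)) := by
    intro k j
    have := Complex.hasSum_conj'.2 (summable_dampMat hA k j).hasSum
    convert this using 2 with l
    · rw [map_mul, map_mul, gmat_conj hc, gmat_conj hc, Complex.conj_ofReal]
    · rfl
  have h2 : HasSum (fun l => ∑ k ∈ S, ∑ j ∈ S,
      (gmat A l k * (|(l : ℝ)| : ℝ) * conj (gmat A l j)) * (y k * conj (x j)))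
      (∑ k ∈ S, ∑ j ∈ S, conj (dampMat A k j) * (y k * conj (x j))) :=
    hasSum_sum fun k _ => hasSum_sum fun j _ => (h1 k j).mul_right _
  convert h2 using 2 with l k hk
  · unfold gsum
    rw [map_sum, Finset.sum_mul_sum, Finset.mul_sum]
    refine Finset.sum_congr rfl fun k _ => ?_
    rw [Finset.mul_sum]
    refine Finset.sum_congr rfl fun j _ => ?_
    simp only [map_mul]; ring
  · rw [map_sum, Finset.mul_sum]
    refine Finset.sum_congr rfl fun j _ => ?_
    simp only [map_mul]; ring

/-- The squared norm of `D^{1/2} G x`. -/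
def dampEnergy (A : ℤ → ℂ) (S : Finset ℤ) (x : ℤ → ℂ) : ℝ :=
  ∑' l : ℤ, |(l : ℝ)| * ‖gsum A S x l‖ ^ 2

lemma hasSum_dampEnergy {A : ℤ → ℂ} (hA : Decay A) (hc : ∀ k, A (-k) = conj (A k))
    (S : Finset ℤ) (x : ℤ → ℂ) :
    HasSum (fun l : ℤ => |(l : ℝ)| * ‖gsum A S x l‖ ^ 2) (dampEnergy A S x) ∧
      (∑ k ∈ S, x k * conj (∑ j ∈ S, dampMat A k j * x j)).re = dampEnergy A S x := by
  have h := Complex.hasSum_re (hasSum_damp_form hA hc S x x)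
  have e : ∀ l : ℤ, ((|(l : ℝ)| : ℝ) * (gsum A S x l * conj (gsum A S x l)) : ℂ).re =
      |(l : ℝ)| * ‖gsum A S x l‖ ^ 2 := by
    intro l
    rw [Complex.mul_conj, Complex.normSq_eq_norm_sq, ← Complex.ofReal_mul, Complex.ofReal_re]
  simp_rw [e] at h
  exact ⟨h.summable.hasSum, h.tsum_eq.symm⟩

lemma dampEnergy_nonneg (A : ℤ → ℂ) (S : Finset ℤ) (x : ℤ → ℂ) : 0 ≤ dampEnergy A S x :=
  tsum_nonneg fun l => by positivity

/-- Weighted Cauchy–Schwarz for the damping paired with `z = q x`. The part with small `δ` will be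
absorbed by the gained half derivative, the other part by the large constant in the multiplier. -/
lemma damp_cross_le {A : ℤ → ℂ} (hA : Decay A) (hc : ∀ k, A (-k) = conj (A k)) {δ : ℝ} (hδ : 0 < δ)
    (S : Finset ℤ) (x z : ℤ → ℂ) :
    -(∑ k ∈ S, z k * conj (∑ j ∈ S, dampMat A k j * x j)).re ≤
      δ * dampEnergy A S z + (4 * δ)⁻¹ * dampEnergy A S x := by
  have h := (Complex.hasSum_re (hasSum_damp_form hA hc S x z)).neg
  refine hasSum_le (fun l => ?_) h
    (((hasSum_dampEnergy hA hc S z).1.mul_left δ).add ((hasSum_dampEnergy hA hc S x).1.mul_left _))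
  rw [Complex.re_ofReal_mul, ← mul_neg]
  have h1 : -(gsum A S z l * conj (gsum A S x l)).re ≤ ‖gsum A S z l‖ * ‖gsum A S x l‖ := by
    refine (neg_le_abs _).trans ((Complex.abs_re_le_norm _).trans ?_)
    rw [norm_mul, RCLike.norm_conj]
  have h2 : ‖gsum A S z l‖ * ‖gsum A S x l‖ ≤
      δ * ‖gsum A S z l‖ ^ 2 + (4 * δ)⁻¹ * ‖gsum A S x l‖ ^ 2 := by
    have : δ * ‖gsum A S z l‖ ^ 2 + (4 * δ)⁻¹ * ‖gsum A S x l‖ ^ 2 -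
        ‖gsum A S z l‖ * ‖gsum A S x l‖ =
        δ * (‖gsum A S z l‖ - (2 * δ)⁻¹ * ‖gsum A S x l‖) ^ 2 := by field_simp; ring
    have : 0 ≤ δ * (‖gsum A S z l‖ - (2 * δ)⁻¹ * ‖gsum A S x l‖) ^ 2 := by positivity
    linarith
  calc |(l : ℝ)| * -(gsum A S z l * conj (gsum A S x l)).re
      ≤ |(l : ℝ)| * (δ * ‖gsum A S z l‖ ^ 2 + (4 * δ)⁻¹ * ‖gsum A S x l‖ ^ 2) := by
        gcongr; exact h1.trans h2
    _ = _ := by ring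

lemma dampEnergy_le {A : ℤ → ℂ} (hA : Decay A) :
    ∃ C, 0 ≤ C ∧ ∀ (S : Finset ℤ) (x : ℤ → ℂ), dampEnergy A S x ≤ C * nf (1 / 2) S x := by
  obtain ⟨C, hC, hg⟩ := gmat_bound hA
  have hg' : ∀ k j, ‖gmat A k j‖ ≤ C * wt (-3) (k - j) := fun k j =>
    (hg k j).trans (by gcongr; exact wt_mono (by norm_num) _)
  have hM := weight_matrix_le hC hg' (σ := 1 / 2) (by rw [abs_of_pos] <;> norm_num)
  refine ⟨(2 ^ |(1 : ℝ) / 2 / 2| * C * wtMass) ^ 2, sq_nonneg _, fun S x => ?_⟩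
  have h := hs_sum_matrix_le (by positivity) hM S x
  have hb : 0 ≤ (2 ^ |(1 : ℝ) / 2 / 2| * C * wtMass) ^ 2 * nf (1 / 2) S x :=
    mul_nonneg (sq_nonneg _) (nf_nonneg _ _ _)
  refine le_trans ?_ (tsum_le_of_hs_le hb h)
  have hsum := summable_of_hs_le hb h
  have hle : ∀ l : ℤ, |(l : ℝ)| * ‖gsum A S x l‖ ^ 2 ≤ wt (1 / 2) l * ‖gsum A S x l‖ ^ 2 :=
    fun l => by gcongr; exact abs_le_wt l
  exact Summable.tsum_le_tsum hle (Summable.of_nonneg_of_le (fun l => by positivity) hle hsum) hsum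

/-- These are the entries of `a D^{1/2} - D^{1/2} G`: the commutator of `G` with `D^{1/2}`, plus the
rank-one part of `G` put back. Both have order zero. -/
lemma gmat_commutator_bound {A : ℤ → ℂ} (hA : Decay A) :
    ∃ C, 0 ≤ C ∧ ∀ l j : ℤ, ‖gmat A l j * ((√|(j : ℝ)| - √|(l : ℝ)| : ℝ) : ℂ) +
      2 * Real.pi * A l * A (-j) * (√|(j : ℝ)| : ℝ)‖ ≤ C * wt (-3) (l - j) := by
  obtain ⟨C, hC, hg⟩ := gmat_bound hA
  obtain ⟨C', hC', hA'⟩ := hA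
  refine ⟨C + 2 * Real.pi * C' ^ 2 * 2 ^ (3 : ℝ), by positivity, fun l j => ?_⟩
  have a1 : abs (√|(j : ℝ)| - √|(l : ℝ)|) ≤ wt 1 (l - j) := by
    apply abs_le_of_sq_le_sq _ (wt_nonneg _ _)
    refine (sq_sqrt_sub_sqrt_le (abs_nonneg _) (abs_nonneg _)).trans ?_
    refine (abs_abs_sub_abs_le _ _).trans ?_
    have := abs_le_wt (l - j)
    push_cast at this
    rw [abs_sub_comm]
    refine this.trans ?_
    rw [wt_sq]; exact wt_mono (by norm_num) _
  have a2 : √|(j : ℝ)| ≤ wt 1 j := by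
    rw [Real.sqrt_le_left (wt_nonneg _ _), wt_sq]
    exact (abs_le_wt j).trans (wt_mono (by norm_num) _)
  have a3 := wt_neg_mul_le (r := 3) (by norm_num) l 0 j
  simp only [sub_zero, zero_sub, wt_neg_arg] at a3
  have := wt_nonneg (-4) l
  have := wt_nonneg (-4) j
  have := wt_nonneg (-4) (l - j)
  have := wt_nonneg (-3) j
  calc _ ≤ ‖gmat A l j‖ * abs (√|(j : ℝ)| - √|(l : ℝ)|) +
        2 * Real.pi * (‖A l‖ * (‖A (-j)‖ * √|(j : ℝ)|)) := by
        refine (norm_add_le _ _).trans (le_of_eq ?_)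
        rw [norm_mul, Complex.norm_real, Real.norm_eq_abs]
        congr 1
        simp only [norm_mul, Complex.norm_real, Real.norm_eq_abs, Complex.norm_ofNat,
          abs_of_pos Real.pi_pos, abs_of_nonneg (Real.sqrt_nonneg _)]
        ring
    _ ≤ (C * wt (-4) (l - j)) * wt 1 (l - j) +
          2 * Real.pi * ((C' * wt (-4) l) * ((C' * wt (-4) (-j)) * wt 1 j)) := by
        have := wt_nonneg (-4) (-j)
        gcongr
        · exact hg _ _
        · exact hA' _
        · exact hA' _
    _ = C * (wt (-4) (l - j) * wt 1 (l - j)) +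
          2 * Real.pi * C' ^ 2 * (wt (-4) l * (wt (-4) j * wt 1 j)) := by
        rw [wt_neg_arg]; ring
    _ = C * wt (-3) (l - j) + 2 * Real.pi * C' ^ 2 * (wt (-4) l * wt (-3) j) := by
        rw [wt_mul, wt_mul]; norm_num
    _ ≤ C * wt (-3) (l - j) + 2 * Real.pi * C' ^ 2 * (2 ^ (3 : ℝ) * wt (-3) (l - j)) := by
        refine add_le_add le_rfl (mul_le_mul_of_nonneg_left (le_trans ?_ a3) (by positivity))
        gcongr
        exact wt_mono (by norm_num) _
    _ = _ := by ring

/-- The local smoothing energy is controlled by the damping. -/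
lemma smoothing_le_dampEnergy {A : ℤ → ℂ} (hA : Decay A) (hc : ∀ k, A (-k) = conj (A k)) :
    ∃ C, 0 ≤ C ∧ ∀ (S : Finset ℤ) (x : ℤ → ℂ),
      ∑' l, ‖∑ j ∈ S, A (l - j) * ((√|(j : ℝ)| : ℝ) * x j)‖ ^ 2 ≤
        2 * dampEnergy A S x + C * nf 0 S x := by
  obtain ⟨C, hC, he⟩ := gmat_commutator_bound hA
  have hM := weight_matrix_le hC he (σ := 0) (by norm_num)
  refine ⟨2 * (2 ^ |(0 : ℝ) / 2| * C * wtMass) ^ 2, mul_nonneg zero_le_two (sq_nonneg _), fun S x => ?_⟩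
  have h := hs_sum_matrix_le (by positivity) hM S x
  have hb : 0 ≤ (2 ^ |(0 : ℝ) / 2| * C * wtMass) ^ 2 * nf 0 S x :=
    mul_nonneg (sq_nonneg _) (nf_nonneg _ _ _)
  have hle := tsum_le_of_hs_le hb h
  have hsum := summable_of_hs_le hb h
  simp only [wt_zero, one_mul] at hle hsum
  rw [mul_assoc 2]
  refine le_trans ?_ (add_le_add le_rfl (mul_le_mul_of_nonneg_left hle zero_le_two))
  refine hasSum_le (fun l => ?_) (hasSum_sq_norm_conv hA S _).summable.hasSum
    (((hasSum_dampEnergy hA hc S x).1.mul_left 2).add (hsum.hasSum.mul_left 2))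
  set E : ℂ := ∑ j ∈ S, (gmat A l j * ((√|(j : ℝ)| - √|(l : ℝ)| : ℝ) : ℂ) +
      2 * Real.pi * A l * A (-j) * (√|(j : ℝ)| : ℝ)) * x j with hE
  have e1 : ∑ j ∈ S, A (l - j) * ((√|(j : ℝ)| : ℝ) * x j) =
      (√|(l : ℝ)| : ℝ) * gsum A S x l + E := by
    rw [gsum, Finset.mul_sum, hE, ← Finset.sum_add_distrib]
    refine Finset.sum_congr rfl fun j _ => ?_
    simp only [gmat]; push_cast; ring
  rw [e1]
  have e2 : ‖(√|(l : ℝ)| : ℝ) * gsum A S x l‖ ^ 2 = |(l : ℝ)| * ‖gsum A S x l‖ ^ 2 := by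
    rw [norm_mul, mul_pow, Complex.norm_real, Real.norm_eq_abs, sq_abs, Real.sq_sqrt (abs_nonneg _)]
  rw [← e2, ← mul_add]
  refine (pow_le_pow_left₀ (norm_nonneg _) (norm_add_le _ _) 2).trans ?_
  nlinarith [sq_nonneg (‖((√|(l : ℝ)| : ℝ) : ℂ) * gsum A S x l‖ - ‖E‖)]

/-! ### The dissipation inequality -/

/-- The action of the convolution multiplier `p` on the modes in `S`. -/
def psum (p : ℤ → ℂ) (S : Finset ℤ) (x : ℤ → ℂ) (k : ℤ) : ℂ := ∑ j ∈ S, p (k - j) * x j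

/-- The quadratic form `(p x, x)`. -/
def energy (p : ℤ → ℂ) (S : Finset ℤ) (x : ℤ → ℂ) : ℝ := (∑ k ∈ S, psum p S x k * conj (x k)).re

/-- A modified energy, equivalent to the `L²` norm, which dissipates half a derivative along the
damped linear flow. -/
structure IsDissipative (A p : ℤ → ℂ) (c C : ℝ) : Prop where
  c_pos : 0 < c
  C_nonneg : 0 ≤ C
  herm : ∀ m, p (-m) = conj (p m)
  lower : ∀ (S : Finset ℤ) (x : ℤ → ℂ), nf 0 S x ≤ energy p S x
  upper : ∀ (S : Finset ℤ) (x : ℤ → ℂ), energy p S x ≤ C * nf 0 S x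
  dissipation : ∀ (S : Finset ℤ) (x r : ℤ → ℂ),
    2 * (∑ k ∈ S, psum p S x k *
      conj (-Complex.I * disp k * x k - ∑ j ∈ S, dampMat A k j * x j + r k)).re ≤
      -c * nf (1 / 2) S x + C * nf 0 S x + C * nf (-(1 / 2)) S r

lemma pairing_le {ε : ℝ} (hε : 0 < ε) (S : Finset ℤ) (y r : ℤ → ℂ) :
    2 * (∑ k ∈ S, y k * conj (r k)).re ≤ ε * nf (1 / 2) S y + ε⁻¹ * nf (-(1 / 2)) S r := by
  rw [Complex.re_sum, nf, nf, Finset.mul_sum, Finset.mul_sum, Finset.mul_sum,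
    ← Finset.sum_add_distrib]
  refine Finset.sum_le_sum fun k _ => ?_
  have h1 : (y k * conj (r k)).re ≤ ‖y k‖ * ‖r k‖ := by
    refine (Complex.re_le_norm _).trans ?_
    rw [norm_mul, RCLike.norm_conj]
  have hw := wt_pos (1 / 2) k
  rw [wt_neg]
  set w := wt (1 / 2) k
  have h2 : ε * (w * ‖y k‖ ^ 2) + ε⁻¹ * (w⁻¹ * ‖r k‖ ^ 2) - 2 * (‖y k‖ * ‖r k‖) =
      ε * w * (‖y k‖ - ε⁻¹ * w⁻¹ * ‖r k‖) ^ 2 := by field_simp; ring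
  have h3 : 0 ≤ ε * w * (‖y k‖ - ε⁻¹ * w⁻¹ * ‖r k‖) ^ 2 := by positivity
  linarith

lemma nf_half_le (S : Finset ℤ) (x : ℤ → ℂ) :
    nf (1 / 2) S x ≤ nf 0 S x + ∑ k ∈ S, |(k : ℝ)| * ‖x k‖ ^ 2 := by
  rw [nf, nf, ← Finset.sum_add_distrib]
  refine Finset.sum_le_sum fun k _ => ?_
  rw [wt_zero, ← add_mul]
  gcongr; exact wt_half_le k

lemma nf_psum_le {p : ℤ → ℂ} {C : ℝ} (hC : 0 ≤ C) (hp : ∀ m, ‖p m‖ ≤ C * wt (-3) m) :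
    ∃ C', 0 ≤ C' ∧ ∀ (S : Finset ℤ) (x : ℤ → ℂ),
      nf (1 / 2) S (psum p S x) ≤ C' * nf (1 / 2) S x := by
  have hM := weight_matrix_le hC (M := fun k j => p (k - j)) (fun k j => hp (k - j)) (σ := 1 / 2)
    (by rw [abs_of_pos] <;> norm_num)
  refine ⟨(2 ^ |(1 : ℝ) / 2 / 2| * C * wtMass) ^ 2, sq_nonneg _, fun S x => ?_⟩
  exact nf_le_of_hs_le (mul_nonneg (sq_nonneg _) (nf_nonneg _ _ _))
    (hs_sum_matrix_le (by positivity) hM S x) S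

/-- The multiplier is `prim A` plus a large constant `M`. The first summand turns dispersion into
dissipation at rate `b`, except for a term localised by `a`; the second brings in enough damping to
cancel that term. -/
theorem exists_isDissipative {A : ℤ → ℂ} (hA : Decay A) (hc : ∀ k, A (-k) = conj (A k))
    (h0 : A 0 ≠ 0) : ∃ p c C, IsDissipative A p c C := by
  obtain ⟨b, hb, hb0⟩ := autocorr_zero hA h0
  obtain ⟨C₁, hC₁, h₁⟩ := dispersive_form_le hA hb0
  obtain ⟨C₂, hC₂, h₂⟩ := smoothing_le_dampEnergy hA hc
  obtain ⟨C₃, hC₃, h₃⟩ := dampEnergy_le hA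
  obtain ⟨Cq, hCq, hq⟩ := prim_bound hA
  obtain ⟨C₄, hC₄, h₄⟩ := nf_psum_le hCq hq
  -- Chosen so that the damping energy of `q x`, bounded by `C₃ * C₄` times the `H^{1/2}` norm,
  -- takes at most a quarter of `b`.
  set δ : ℝ := b / (4 * (C₃ * C₄ + 1)) with hδ
  have hδ0 : 0 < δ := by positivity
  have hδ1 : δ * (C₃ * C₄) ≤ b / 4 := by
    rw [hδ, div_mul_eq_mul_div, div_le_div_iff₀ (by positivity) (by norm_num)]; nlinarith
  -- The terms pay, in order, for the local smoothing energy, for the cross term, for the constant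
  -- `1` in the lower bound of the energy, and for the indefinite form of `prim A`.
  set M : ℝ := 2 + (4 * δ)⁻¹ + 1 + Cq * wtMass with hM
  have hW := wtMass_nonneg
  have hM0 : 0 < M := by positivity
  set p : ℤ → ℂ := fun m => prim A m + if m = 0 then (M : ℂ) else 0 with hp
  have hps : ∀ (S : Finset ℤ) (x : ℤ → ℂ), ∀ k ∈ S,
      psum p S x k = psum (prim A) S x k + M * x k := by
    intro S x k hk
    simp only [psum, hp, add_mul, Finset.sum_add_distrib]
    congr 1
    rw [Finset.sum_eq_single k]
    · simp
    · intro j _ hj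
      rw [if_neg (sub_ne_zero.2 hj.symm), zero_mul]
    · intro h; exact absurd hk h
  have hen : ∀ (S : Finset ℤ) (x : ℤ → ℂ),
      energy p S x = (∑ k ∈ S, psum (prim A) S x k * conj (x k)).re + M * nf 0 S x := by
    intro S x
    have : ∑ k ∈ S, psum p S x k * conj (x k) =
        ∑ k ∈ S, psum (prim A) S x k * conj (x k) + ((M * nf 0 S x : ℝ) : ℂ) := by
      rw [nf]
      push_cast
      rw [Finset.mul_sum, ← Finset.sum_add_distrib]
      refine Finset.sum_congr rfl fun k hk => ?_
      rw [hps S x k hk, add_mul, mul_assoc (M : ℂ), Complex.mul_conj, Complex.normSq_eq_norm_sq]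
      simp
    rw [energy, this, Complex.add_re, Complex.ofReal_re]
  have hqf : ∀ (S : Finset ℤ) (x : ℤ → ℂ),
      |(∑ k ∈ S, psum (prim A) S x k * conj (x k)).re| ≤ Cq * wtMass * nf 0 S x := by
    intro S x
    refine (Complex.abs_re_le_norm _).trans ?_
    have := norm_form_le hCq (e := fun k j => prim A (k - j)) (fun k j =>
      (hq _).trans (by gcongr; exact wt_mono (by norm_num) _)) S x
    simpa only [psum, Finset.sum_mul] using this
  have hpb : ∀ m, ‖p m‖ ≤ (Cq + M) * wt (-3) m := by
    intro m
    refine (norm_add_le _ _).trans ?_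
    rw [add_mul]
    gcongr
    · exact hq m
    · split_ifs with h
      · subst h; simp [wt, abs_of_pos hM0]
      · simpa using mul_nonneg hM0.le (wt_nonneg _ _)
  obtain ⟨C₅, hC₅, h₅⟩ := nf_psum_le (by positivity) hpb
  -- Leaves at most `b / 2` of the dissipation to the forcing `r`.
  set ε : ℝ := b / (2 * (C₅ + 1)) with hε
  have hε0 : 0 < ε := by positivity
  have hε1 : ε * C₅ ≤ b / 2 := by
    rw [hε, div_mul_eq_mul_div, div_le_div_iff₀ (by positivity) (by norm_num)]; nlinarith
  set CC : ℝ := (M + Cq * wtMass) + 2 * (b + C₁ + C₂) + ε⁻¹ with hCC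
  refine ⟨p, b, CC, ⟨hb, by positivity, ?_, ?_, ?_, ?_⟩⟩
  · intro m
    simp only [hp, neg_eq_zero, map_add, prim_conj]
    congr 1
    split_ifs <;> simp
  · intro S x
    have h6 := neg_le_of_abs_le (hqf S x)
    rw [hen]
    have := nf_nonneg 0 S x
    have : 0 ≤ (4 * δ)⁻¹ := by positivity
    nlinarith
  · intro S x
    have h6 := le_of_abs_le (hqf S x)
    rw [hen]
    have := nf_nonneg 0 S x
    have : 0 ≤ 2 * (b + C₁ + C₂) + ε⁻¹ := by positivity
    nlinarith
  · intro S x r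
    have n0 := nf_nonneg 0 S x
    have nh := nf_nonneg (1 / 2) S x
    have nr := nf_nonneg (-(1 / 2)) S r
    set z := psum (prim A) S x with hz
    set Kx : ℤ → ℂ := fun k => ∑ j ∈ S, dampMat A k j * x j with hKx
    -- The constant `M` meets the dispersion only in `i M k|k| |x_k|²`, which has no real part.
    have split : (∑ k ∈ S, psum p S x k * conj (-Complex.I * disp k * x k - Kx k + r k)).re =
        (∑ k ∈ S, z k * conj (-Complex.I * disp k * x k)).re
          - (∑ k ∈ S, z k * conj (Kx k)).re - M * (∑ k ∈ S, x k * conj (Kx k)).re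
          + (∑ k ∈ S, psum p S x k * conj (r k)).re := by
      simp only [Complex.re_sum]
      rw [Finset.mul_sum, ← Finset.sum_sub_distrib, ← Finset.sum_sub_distrib,
        ← Finset.sum_add_distrib]
      refine Finset.sum_congr rfl fun k hk => ?_
      rw [map_add, mul_add, Complex.add_re]
      congr 1
      rw [hps S x k hk, ← Complex.re_ofReal_mul, ← Complex.sub_re, ← Complex.sub_re]
      have e : (z k + M * x k) * conj (-Complex.I * disp k * x k - Kx k) =
          (z k * conj (-Complex.I * disp k * x k) - z k * conj (Kx k) - M * (x k * conj (Kx k)))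
          + (M * disp k * (x k * conj (x k)) : ℂ) * Complex.I := by
        simp only [map_sub, map_mul, map_neg, Complex.conj_I, Complex.conj_ofReal]; ring
      rw [e, Complex.add_re, Complex.mul_conj]
      simp only [← Complex.ofReal_mul, Complex.mul_I_re, Complex.ofReal_im]
      simp
    have d1 := h₁ S x
    have d2 := h₂ S x
    have d3 := damp_cross_le hA hc hδ0 S x z
    have d4 := (h₃ S z).trans (mul_le_mul_of_nonneg_left (h₄ S x) hC₃)
    have d5 := (hasSum_dampEnergy hA hc S x).2
    have d6 := pairing_le hε0 S (psum p S x) r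
    have d7 := h₅ S x
    have d8 := nf_half_le S x
    have d9 := dampEnergy_nonneg A S x
    change 2 * (∑ k ∈ S, psum p S x k * conj (-Complex.I * disp k * x k - Kx k + r k)).re ≤ _
    rw [split]
    change (∑ k ∈ S, z k * conj (-Complex.I * disp k * x k)).re ≤ _ at d1
    change -(∑ k ∈ S, z k * conj (Kx k)).re ≤ _ at d3
    change (∑ k ∈ S, x k * conj (Kx k)).re = _ at d5
    rw [d5]
    have f1 : δ * dampEnergy A S z ≤ b / 4 * nf (1 / 2) S x := by
      calc δ * dampEnergy A S z ≤ δ * (C₃ * (C₄ * nf (1 / 2) S x)) := by gcongr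
        _ = δ * (C₃ * C₄) * nf (1 / 2) S x := by ring
        _ ≤ _ := by gcongr
    have f2 : ε * nf (1 / 2) S (psum p S x) ≤ b / 2 * nf (1 / 2) S x := by
      calc ε * nf (1 / 2) S (psum p S x) ≤ ε * (C₅ * nf (1 / 2) S x) := by gcongr
        _ = ε * C₅ * nf (1 / 2) S x := by ring
        _ ≤ _ := by gcongr
    have f3 : (2 + (4 * δ)⁻¹) * dampEnergy A S x ≤ M * dampEnergy A S x := by
      gcongr; rw [hM]; have : 0 ≤ Cq * wtMass := by positivity
      linarith
    have f4 : b * nf (1 / 2) S x ≤ b * (nf 0 S x + ∑ k ∈ S, |(k : ℝ)| * ‖x k‖ ^ 2) := by gcongr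
    have f5 : 0 ≤ (M + Cq * wtMass + ε⁻¹) * nf 0 S x := by positivity
    have f6 : 0 ≤ (M + Cq * wtMass + 2 * (b + C₁ + C₂)) * nf (-(1 / 2)) S r := by positivity
    rw [hCC]
    -- The coefficient of the `H^{1/2}` norm is `2 (-b + b/4) + b/2 = -b`.
    nlinarith

/-! ### Products -/

/-- Convolution of sequences. -/
def conv (z w : ℤ → ℂ) (k : ℤ) : ℂ := ∑' j, z (k - j) * w j

/-- The right-hand side of the equation, for the `k`-th Fourier coefficient. -/
def rhs (A : ℤ → ℂ) (u : ℤ → ℂ) (k : ℤ) : ℂ :=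
  -Complex.I * disp k * u k - damp A u k - Complex.I * k / 2 * conv u u k

/-- Split the output weight into a piece on `w` alone and a piece shared by `z` and `w`, then apply
Young's inequality twice, with `z` and then the weighted `w` in `ℓ¹`. -/
lemma hs_conv_le {τ σ₁ σ₂ γ C : ℝ} (hC : 0 ≤ C)
    (h : ∀ k j, wt (τ / 2) k ≤ C * (wt (σ₁ / 2) j + wt (σ₂ / 2) (k - j) * wt γ j))
    (z w : ℤ → ℂ) :
    hs τ (conv z w) ≤ ENNReal.ofReal (2 * C ^ 2) * ((∑' j, ‖z j‖ₑ) ^ 2 * hs σ₁ w +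
      hs σ₂ z * (∑' j, ENNReal.ofReal (wt γ j) * ‖w j‖ₑ) ^ 2) := by
  set h₁ : ℤ → ℝ≥0∞ := fun j => ‖z j‖ₑ
  set x₁ : ℤ → ℝ≥0∞ := fun j => ENNReal.ofReal (wt (σ₁ / 2) j) * ‖w j‖ₑ
  set h₂ : ℤ → ℝ≥0∞ := fun j => ENNReal.ofReal (wt γ j) * ‖w j‖ₑ
  set x₂ : ℤ → ℝ≥0∞ := fun j => ENNReal.ofReal (wt (σ₂ / 2) j) * ‖z j‖ₑ
  have key : ∀ k, ENNReal.ofReal (wt (τ / 2) k) * ‖conv z w k‖ₑ ≤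
      ENNReal.ofReal C * (∑' j, h₁ (k - j) * x₁ j + ∑' j, h₂ (k - j) * x₂ j) := by
    intro k
    have e : ∑' j, h₂ (k - j) * x₂ j = ∑' j, h₂ j * x₂ (k - j) := by
      rw [← (Equiv.subLeft k).tsum_eq]; simp
    rw [e, ← ENNReal.tsum_add, ← ENNReal.tsum_mul_left]
    calc ENNReal.ofReal (wt (τ / 2) k) * ‖conv z w k‖ₑ
        ≤ ENNReal.ofReal (wt (τ / 2) k) * ∑' j, ‖z (k - j) * w j‖ₑ := by
          gcongr; exact enorm_tsum_le_tsum_enorm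
      _ = ∑' j, ENNReal.ofReal (wt (τ / 2) k) * (‖z (k - j)‖ₑ * ‖w j‖ₑ) := by
          rw [← ENNReal.tsum_mul_left]; simp_rw [enorm_mul]
      _ ≤ _ := by
          refine ENNReal.tsum_le_tsum fun j => ?_
          have a1 := wt_nonneg (σ₁ / 2) j
          have a2 := wt_nonneg (σ₂ / 2) (k - j)
          have a3 := wt_nonneg γ j
          calc ENNReal.ofReal (wt (τ / 2) k) * (‖z (k - j)‖ₑ * ‖w j‖ₑ)
              ≤ ENNReal.ofReal (C * (wt (σ₁ / 2) j + wt (σ₂ / 2) (k - j) * wt γ j)) *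
                (‖z (k - j)‖ₑ * ‖w j‖ₑ) := by gcongr; exact h k j
            _ = _ := by
                rw [ENNReal.ofReal_mul hC, ENNReal.ofReal_add a1 (by positivity),
                  ENNReal.ofReal_mul a2]
                simp only [h₁, x₁, h₂, x₂]; ring
  calc hs τ (conv z w)
      ≤ ∑' k, (ENNReal.ofReal C * (∑' j, h₁ (k - j) * x₁ j + ∑' j, h₂ (k - j) * x₂ j)) ^ 2 := by
        unfold hs
        refine ENNReal.tsum_le_tsum fun k => ?_
        rw [hs_term']
        exact pow_le_pow_left' (key k) 2
    _ ≤ ∑' k, ENNReal.ofReal (2 * C ^ 2) *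
          ((∑' j, h₁ (k - j) * x₁ j) ^ 2 + (∑' j, h₂ (k - j) * x₂ j) ^ 2) := by
        refine ENNReal.tsum_le_tsum fun k => ?_
        rw [mul_pow, ENNReal.ofReal_mul zero_le_two, ENNReal.ofReal_pow hC]
        calc _ ≤ ENNReal.ofReal C ^ 2 * (2 *
                ((∑' j, h₁ (k - j) * x₁ j) ^ 2 + (∑' j, h₂ (k - j) * x₂ j) ^ 2)) := by
              gcongr; exact add_sq_le_two _ _
          _ = _ := by rw [ENNReal.ofReal_ofNat]; ring
    _ ≤ ENNReal.ofReal (2 * C ^ 2) * ((∑' j, h₁ j) ^ 2 * ∑' j, x₁ j ^ 2 +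
          (∑' j, h₂ j) ^ 2 * ∑' j, x₂ j ^ 2) := by
        rw [ENNReal.tsum_mul_left, ENNReal.tsum_add]
        gcongr
        · exact young _ _
        · exact young _ _
    _ = _ := by
        unfold hs
        simp_rw [hs_term']
        rw [mul_comm ((∑' j, h₂ j) ^ 2)]

/-- Cauchy–Schwarz; the hypothesis is exactly summability of the weight `wt (2γ - σ)`. For `γ = 0`
it is the embedding of `H^σ`, `σ > 1/2`, into absolutely convergent Fourier series. -/
lemma sq_l1_le {σ γ : ℝ} (h : 2 * γ - σ < -(1 / 2)) (w : ℤ → ℂ) :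
    (∑' j, ENNReal.ofReal (wt γ j) * ‖w j‖ₑ) ^ 2 ≤
      ENNReal.ofReal (∑' j, wt (2 * γ - σ) j) * hs σ w := by
  have h1 := tsum_cauchy_schwarz (fun j => ENNReal.ofReal (wt (γ - σ / 2) j))
    (fun j => ENNReal.ofReal (wt (σ / 2) j) * ‖w j‖ₑ)
  have hs1 : Summable (wt (2 * γ - σ)) := by
    have := summable_wt (σ := -(2 * γ - σ)) (by linarith)
    rwa [neg_neg] at this
  rw [ENNReal.ofReal_tsum_of_nonneg (fun j => wt_nonneg _ _) hs1]
  unfold hs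
  simp_rw [hs_term']
  convert h1 using 3 with j
  · ext j
    rw [← mul_assoc, ← ENNReal.ofReal_mul (wt_nonneg _ _), wt_mul]; congr 3; ring
  · ext j
    rw [← ENNReal.ofReal_pow (wt_nonneg _ _), wt_sq]; congr 2; ring

/-- The larger of `|k - j|` and `|j|` is at least `|k| / 2`, whence the base `4`. -/
lemma wt_le_max {e : ℝ} (he : 0 ≤ e) (k j : ℤ) :
    ((j : ℝ) ^ 2 ≤ ((k - j : ℤ) : ℝ) ^ 2 → wt e k ≤ 4 ^ e * wt e (k - j)) ∧
      (((k - j : ℤ) : ℝ) ^ 2 ≤ (j : ℝ) ^ 2 → wt e k ≤ 4 ^ e * wt e j) := by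
  unfold wt
  constructor <;> intro h <;> rw [← Real.mul_rpow (by norm_num) (by positivity)] <;>
    refine Real.rpow_le_rpow (by positivity) ?_ he <;> push_cast at h ⊢ <;>
    nlinarith [sq_nonneg ((k : ℝ) - 2 * j), sq_nonneg ((k : ℝ) - j)]

/-- The product maps `H^s × H^{1/2}` to `H^{1/2}` if `s > 1/2`. -/
lemma exists_hs_half_conv_le {s : ℝ} (hs1 : 1 / 2 < s) :
    ∃ C, 0 ≤ C ∧ ∀ z w, hs (1 / 2) (conv z w) ≤ ENNReal.ofReal C * (hs s z * hs (1 / 2) w) := by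
  set Z := ∑' j, wt (-s) j with hZ
  have hZ0 : 0 ≤ Z := tsum_nonneg fun j => wt_nonneg _ _
  refine ⟨2 * (4 ^ (1 / 4 : ℝ)) ^ 2 * (2 * Z), by positivity, fun z w => ?_⟩
  -- Where `k - j` dominates, `z` has more regularity than the output requires. The surplus `s/2 -
  -- 1/4` is traded for a negative weight on the smaller frequency `j`, which makes `w` summable.
  have h : ∀ k j, wt (1 / 2 / 2) k ≤
      4 ^ (1 / 4 : ℝ) * (wt (1 / 2 / 2) j + wt (s / 2) (k - j) * wt (1 / 4 - s / 2) j) := by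
    intro k j
    have b1 := wt_nonneg (1 / 4) j
    have b2 := mul_nonneg (wt_nonneg (s / 2) (k - j)) (wt_nonneg (1 / 4 - s / 2) j)
    rw [show (1 / 2 / 2 : ℝ) = 1 / 4 by norm_num]
    obtain ⟨m1, m2⟩ := wt_le_max (e := 1 / 4) (by norm_num) k j
    rcases le_total ((j : ℝ) ^ 2) (((k - j : ℤ) : ℝ) ^ 2) with hjk | hjk
    · refine (m1 hjk).trans (mul_le_mul_of_nonneg_left ?_ (by positivity))
      have e1 : wt (1 / 4) (k - j) = wt (s / 2) (k - j) * wt (1 / 4 - s / 2) (k - j) := by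
        rw [wt_mul]; congr 1; ring
      have e2 : wt (1 / 4 - s / 2) (k - j) ≤ wt (1 / 4 - s / 2) j :=
        Real.rpow_le_rpow_of_nonpos (by positivity) (by linarith) (by linarith)
      rw [e1]
      have := mul_le_mul_of_nonneg_left e2 (wt_nonneg (s / 2) (k - j))
      linarith
    · refine (m2 hjk).trans (mul_le_mul_of_nonneg_left ?_ (by positivity))
      linarith
  refine (hs_conv_le (by positivity) h z w).trans ?_
  have h1 := sq_l1_le (σ := s) (γ := 0) (by linarith) z
  have h2 := sq_l1_le (σ := 1 / 2) (γ := 1 / 4 - s / 2) (by linarith) w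
  rw [show 2 * (0 : ℝ) - s = -s by ring] at h1
  rw [show 2 * (1 / 4 - s / 2) - 1 / 2 = -s by ring] at h2
  simp only [wt_zero, ENNReal.ofReal_one, one_mul] at h1
  calc _ ≤ ENNReal.ofReal (2 * (4 ^ (1 / 4 : ℝ)) ^ 2) *
        ((ENNReal.ofReal Z * hs s z) * hs (1 / 2) w +
          hs s z * (ENNReal.ofReal Z * hs (1 / 2) w)) := by gcongr
    _ = _ := by
        rw [ENNReal.ofReal_mul (q := 2 * Z) (by positivity), ENNReal.ofReal_mul (q := Z) zero_le_two,
          ENNReal.ofReal_ofNat]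
        ring

/-- A tame estimate: only one factor carries the high norm. The low norm then acts as the small
coefficient that the dissipation can absorb. -/
lemma exists_hs_conv_self_le {s : ℝ} (hs1 : 1 / 2 < s) :
    ∃ C, 0 ≤ C ∧ ∀ u, hs (s + 1 / 2) (conv u u) ≤
      ENNReal.ofReal C * (hs s u * hs (s + 1 / 2) u) := by
  set Z := ∑' j, wt (-s) j with hZ
  have hZ0 : 0 ≤ Z := tsum_nonneg fun j => wt_nonneg _ _
  set e := (s + 1 / 2) / 2 with he
  refine ⟨2 * (4 ^ e) ^ 2 * (2 * Z), by positivity, fun u => ?_⟩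
  have h : ∀ k j, wt ((s + 1 / 2) / 2) k ≤
      4 ^ e * (wt ((s + 1 / 2) / 2) j + wt ((s + 1 / 2) / 2) (k - j) * wt 0 j) := by
    intro k j
    rw [← he, wt_zero, mul_one]
    have b1 := wt_nonneg e j
    have b2 := wt_nonneg e (k - j)
    obtain ⟨m1, m2⟩ := wt_le_max (e := e) (by rw [he]; linarith) k j
    rcases le_total ((j : ℝ) ^ 2) (((k - j : ℤ) : ℝ) ^ 2) with hjk | hjk
    · exact (m1 hjk).trans (mul_le_mul_of_nonneg_left (by linarith) (by positivity))
    · exact (m2 hjk).trans (mul_le_mul_of_nonneg_left (by linarith) (by positivity))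
  refine (hs_conv_le (by positivity) h u u).trans ?_
  have h1 := sq_l1_le (σ := s) (γ := 0) (by linarith) u
  rw [show 2 * (0 : ℝ) - s = -s by ring] at h1
  simp only [wt_zero, ENNReal.ofReal_one, one_mul] at h1 ⊢
  calc _ ≤ ENNReal.ofReal (2 * (4 ^ e) ^ 2) *
        ((ENNReal.ofReal Z * hs s u) * hs (s + 1 / 2) u +
          hs (s + 1 / 2) u * (ENNReal.ofReal Z * hs s u)) := by gcongr
    _ = _ := by
        rw [ENNReal.ofReal_mul (q := 2 * Z) (by positivity), ENNReal.ofReal_mul (q := Z) zero_le_two,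
          ENNReal.ofReal_ofNat]
        ring

lemma hs_deriv_le (σ : ℝ) (f : ℤ → ℂ) :
    hs (σ - 1) (fun k => Complex.I * k / 2 * f k) ≤ hs σ f := by
  unfold hs
  refine ENNReal.tsum_le_tsum fun k => ?_
  rw [hs_term, hs_term]
  apply ENNReal.ofReal_le_ofReal
  have e : wt σ k = wt (σ - 1) k * wt 1 k := by rw [wt_mul]; congr 1; ring
  have hw := wt_pos (σ - 1) k
  rw [e, wt_one, mul_assoc]
  gcongr
  rw [norm_mul, mul_pow]
  gcongr
  simp only [norm_div, norm_mul, Complex.norm_I, one_mul, Complex.norm_intCast,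
    RCLike.norm_ofNat, div_pow, sq_abs]
  nlinarith [sq_nonneg (k : ℝ)]

lemma damp_eq_sum (A : ℤ → ℂ) {S : Finset ℤ} {x : ℤ → ℂ} (hx : ∀ k ∉ S, x k = 0) (k : ℤ) :
    damp A x k = ∑ j ∈ S, dampMat A k j * x j := by
  rw [damp, tsum_eq_sum (s := S)]
  intro j hj; simp [hx j hj]

/-! ### Energy inequalities -/

/-- The commutator of `(1 - ∂²)^{s/2}` with the damping, conjugated to act on `L²`. -/
lemma exists_commutator_le {A : ℤ → ℂ} (hA : Decay A) {s : ℝ} (h0 : 0 ≤ s) (h2 : s ≤ 2) :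
    ∃ C, 0 ≤ C ∧ ∀ (S : Finset ℤ) (x : ℤ → ℂ),
      nf 0 S (fun k => ∑ j ∈ S,
        (((wt (s / 2) k / wt (s / 2) j - 1 : ℝ) : ℂ) * dampMat A k j) * x j) ≤ C * nf 0 S x := by
  obtain ⟨C, hC, hN⟩ := dampMat_bound hA
  refine ⟨(3 * C * wtMass) ^ 2, sq_nonneg _, fun S x => ?_⟩
  refine nf_le_of_hs_le (mul_nonneg (sq_nonneg _) (nf_nonneg _ _ _))
    (hs_sum_matrix_le (by positivity) (fun k j => ?_) S x) S
  have h1 := abs_wt_div_sub_one_le h0 h2 k j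
  have := wt_nonneg 1 (k - j)
  have := wt_nonneg (-(1 / 2)) j
  have e1 : wt (-(1 / 2)) j * wt (1 / 2) j = 1 := by rw [wt_mul]; simp
  rw [zero_div, wt_zero, wt_zero, one_mul, mul_one, norm_mul, Complex.norm_real, Real.norm_eq_abs]
  calc _ ≤ (3 * wt 1 (k - j) * wt (-(1 / 2)) j) * (C * wt (-3) (k - j) * wt (1 / 2) j) := by
        gcongr; exact hN k j
    _ = 3 * C * (wt 1 (k - j) * wt (-3) (k - j)) * (wt (-(1 / 2)) j * wt (1 / 2) j) := by ring
    _ = 3 * C * wt (-2) (k - j) := by rw [e1, wt_mul, mul_one]; norm_num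
    _ ≤ _ := by gcongr; exact wt_mono (by norm_num) _

lemma nf_add_le (σ : ℝ) (S : Finset ℤ) (x y : ℤ → ℂ) :
    nf σ S (fun k => x k + y k) ≤ 2 * (nf σ S x + nf σ S y) := by
  unfold nf
  rw [← Finset.sum_add_distrib, Finset.mul_sum]
  refine Finset.sum_le_sum fun k _ => ?_
  have hw := wt_nonneg σ k
  have := pow_le_pow_left₀ (norm_nonneg _) (norm_add_le (x k) (y k)) 2
  have h2 : ‖x k + y k‖ ^ 2 ≤ 2 * (‖x k‖ ^ 2 + ‖y k‖ ^ 2) := by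
    nlinarith [sq_nonneg (‖x k‖ - ‖y k‖)]
  calc _ ≤ wt σ k * (2 * (‖x k‖ ^ 2 + ‖y k‖ ^ 2)) := by gcongr
    _ = _ := by ring

lemma nf_neg (σ : ℝ) (S : Finset ℤ) (x : ℤ → ℂ) : nf σ S (fun k => -x k) = nf σ S x := by
  simp [nf]

lemma nf_shift (σ τ : ℝ) (S : Finset ℤ) (u : ℤ → ℂ) :
    nf σ S (fun k => (wt (τ / 2) k : ℂ) * u k) = nf (σ + τ) S u := by
  unfold nf
  refine Finset.sum_congr rfl fun k _ => ?_
  rw [norm_mul, mul_pow, Complex.norm_real, Real.norm_of_nonneg (wt_nonneg _ _), wt_half_sq,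
    ← mul_assoc, wt_mul]

/-- The energy inequality in `H^s` for small data. -/
theorem exists_high_energy {A p : ℤ → ℂ} {c C : ℝ} (hA : Decay A) (hp : IsDissipative A p c C)
    {s : ℝ} (hs1 : 1 / 2 < s) (hs2 : s ≤ 2) :
    ∃ κ C' : ℝ, 0 < κ ∧ 0 ≤ C' ∧ ∀ (S : Finset ℤ) (u : ℤ → ℂ), (∀ k ∉ S, u k = 0) →
      nf s S u ≤ κ →
      2 * (∑ k ∈ S, psum p S (fun j => (wt (s / 2) j : ℂ) * u j) k *
        conj ((wt (s / 2) k : ℂ) * rhs A u k)).re ≤ -(c / 2) * nf (s + 1 / 2) S u + C' * nf s S u := by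
  obtain ⟨C₁, hC₁, h₁⟩ := exists_commutator_le hA (by linarith : 0 ≤ s) hs2
  obtain ⟨C₂, hC₂, h₂⟩ := exists_hs_conv_self_le hs1
  have hc := hp.c_pos
  have hC := hp.C_nonneg
  -- Below this threshold the nonlinear contribution `2 C C₂ * nf s * nf (s + 1/2)` consumes at most
  -- half of the dissipation `c`.
  refine ⟨c / (4 * C * C₂ + 1), C + C * (2 * C₁), by positivity, by positivity,
    fun S u hu hκ => ?_⟩
  set x : ℤ → ℂ := fun j => (wt (s / 2) j : ℂ) * u j with hx
  set r₁ : ℤ → ℂ := fun k => ∑ j ∈ S,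
        (((wt (s / 2) k / wt (s / 2) j - 1 : ℝ) : ℂ) * dampMat A k j) * x j with hr₁
  set r₂ : ℤ → ℂ := fun k => (wt (s / 2) k : ℂ) * (Complex.I * k / 2 * conv u u k) with hr₂
  have e0 : nf 0 S x = nf s S u := by rw [hx, nf_shift, zero_add]
  have e1 : nf (1 / 2) S x = nf (s + 1 / 2) S u := by rw [hx, nf_shift, add_comm]
  have hd := hp.dissipation S x (fun k => -(r₁ k + r₂ k))
  -- The dispersion is diagonal and commutes with the weight, the damping leaves the commutator
  -- `r₁`, and the whole nonlinearity is treated as forcing `r₂`.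
  have eq : ∀ k, (wt (s / 2) k : ℂ) * rhs A u k =
      -Complex.I * disp k * x k - ∑ j ∈ S, dampMat A k j * x j + -(r₁ k + r₂ k) := by
    intro k
    have e2 : (wt (s / 2) k : ℂ) * damp A u k = ∑ j ∈ S, dampMat A k j * x j + r₁ k := by
      rw [damp_eq_sum A hu, hr₁, Finset.mul_sum, ← Finset.sum_add_distrib]
      refine Finset.sum_congr rfl fun j _ => ?_
      have : (wt (s / 2) j : ℂ) ≠ 0 := by exact_mod_cast wt_ne_zero _ _
      simp only [hx]; push_cast; field_simp; ring
    rw [rhs, mul_sub, mul_sub, e2]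
    simp only [hx, hr₂]; ring
  simp_rw [eq]
  have b1 : nf (-(1 / 2)) S r₁ ≤ C₁ * nf s S u := by
    rw [← e0]; exact (nf_mono (by norm_num) S r₁).trans (h₁ S x)
  have b2 : nf (-(1 / 2)) S r₂ ≤ C₂ * (nf s S u * nf (s + 1 / 2) S u) := by
    have n0 := nf_nonneg s S u
    have n1 := nf_nonneg (s + 1 / 2) S u
    rw [hr₂, nf_shift]
    refine nf_le_of_hs_le (by positivity) ?_ S
    have := hs_deriv_le (s + 1 / 2) (conv u u)
    rw [show s + 1 / 2 - 1 = -(1 / 2) + s by ring] at this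
    refine this.trans ((h₂ u).trans ?_)
    rw [hs_eq_nf s hu, hs_eq_nf (s + 1 / 2) hu, ← ENNReal.ofReal_mul n0, ← ENNReal.ofReal_mul hC₂]
  have b3 : nf (-(1 / 2)) S (fun k => -(r₁ k + r₂ k)) ≤
      2 * (C₁ * nf s S u + C₂ * (nf s S u * nf (s + 1 / 2) S u)) := by
    rw [nf_neg (-(1 / 2)) S (fun k => r₁ k + r₂ k)]
    exact (nf_add_le _ _ _ _).trans (by gcongr)
  rw [e0, e1] at hd
  refine hd.trans ?_
  have n0 := nf_nonneg s S u
  have n1 := nf_nonneg (s + 1 / 2) S u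
  have b4 : (4 * C * C₂ + 1) * nf s S u ≤ c := by
    rw [le_div_iff₀ (by positivity)] at hκ; linarith
  have b5 : 4 * C * C₂ * nf s S u * nf (s + 1 / 2) S u ≤ c * nf (s + 1 / 2) S u := by
    gcongr; linarith
  have b6 := mul_le_mul_of_nonneg_left b3 hC
  linarith

lemma norm_mul_sub_le {s η : ℝ} (hη : 0 ≤ η) {u v : ℤ → ℂ}
    (hu : hs s u ≤ ENNReal.ofReal (η ^ 2)) (hv : hs s v ≤ ENNReal.ofReal (η ^ 2)) (k j : ℤ) :
    ‖u (k - j) * v j‖ ≤ η ^ 2 * (wt (-s) (k - j) + wt (-s) j) := by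
  have a1 := norm_le_of_hs_le hη hu (k - j)
  have a2 := norm_le_of_hs_le hη hv j
  have b1 := wt_nonneg (-(s / 2)) (k - j)
  have b2 := wt_nonneg (-(s / 2)) j
  have c1 : wt (-(s / 2)) (k - j) ^ 2 = wt (-s) (k - j) := by rw [wt_sq]; congr 1; ring
  have c2 : wt (-(s / 2)) j ^ 2 = wt (-s) j := by rw [wt_sq]; congr 1; ring
  rw [norm_mul, ← c1, ← c2]
  calc ‖u (k - j)‖ * ‖v j‖ ≤ (η * wt (-(s / 2)) (k - j)) * (η * wt (-(s / 2)) j) := by gcongr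
    _ = η ^ 2 * (wt (-(s / 2)) (k - j) * wt (-(s / 2)) j) := by ring
    _ ≤ _ := by
        gcongr
        nlinarith [sq_nonneg (wt (-(s / 2)) (k - j) - wt (-(s / 2)) j)]

lemma summable_conv_bound {s : ℝ} (hs1 : 1 / 2 < s) (η : ℝ) (k : ℤ) :
    Summable fun j => η ^ 2 * (wt (-s) (k - j) + wt (-s) j) :=
  (((Equiv.subLeft k).summable_iff.2 (summable_wt hs1)).add (summable_wt hs1)).mul_left _

lemma summable_conv {s η : ℝ} (hs1 : 1 / 2 < s) (hη : 0 ≤ η) {u v : ℤ → ℂ}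
    (hu : hs s u ≤ ENNReal.ofReal (η ^ 2)) (hv : hs s v ≤ ENNReal.ofReal (η ^ 2)) (k : ℤ) :
    Summable fun j => u (k - j) * v j :=
  Summable.of_norm_bounded (summable_conv_bound hs1 η k) (norm_mul_sub_le hη hu hv k)

lemma conv_sub_conv {s η : ℝ} (hs1 : 1 / 2 < s) (hη : 0 ≤ η) {u v : ℤ → ℂ}
    (hu : hs s u ≤ ENNReal.ofReal (η ^ 2)) (hv : hs s v ≤ ENNReal.ofReal (η ^ 2)) (k : ℤ) :
    conv u u k - conv v v k = conv (fun j => u j + v j) (fun j => u j - v j) k := by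
  have e : conv u v k = conv v u k := by
    unfold conv
    rw [← (Equiv.subLeft k).tsum_eq]
    simp [mul_comm]
  have h : conv (fun j => u j + v j) (fun j => u j - v j) k =
      (conv u u k + conv v u k) - (conv u v k + conv v v k) := by
    unfold conv
    rw [← (summable_conv hs1 hη hu hu k).tsum_add (summable_conv hs1 hη hv hu k),
      ← (summable_conv hs1 hη hu hv k).tsum_add (summable_conv hs1 hη hv hv k),
      ← ((summable_conv hs1 hη hu hu k).add (summable_conv hs1 hη hv hu k)).tsum_sub
        ((summable_conv hs1 hη hu hv k).add (summable_conv hs1 hη hv hv k))]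
    congr 1; ext j; ring
  rw [h, e]; ring

/-- Moving the growth from `j` to the fixed index `k` gives a summable majorant that depends on `u`
only through its bound `η`; dominated convergence will use it. -/
lemma norm_damp_term_le {s η C : ℝ} (hs1 : 1 / 2 < s) (hη : 0 ≤ η) (hC : 0 ≤ C) {A u : ℤ → ℂ}
    (hN : ∀ k j, ‖dampMat A k j‖ ≤ C * wt (-3) (k - j) * wt (1 / 2) j)
    (hu : hs s u ≤ ENNReal.ofReal (η ^ 2)) (k j : ℤ) :
    ‖dampMat A k j * u j‖ ≤ C * η * 2 ^ (1 / 2 : ℝ) * wt (1 / 2) k * wt (-1) (k - j) := by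
  have a1 := norm_le_of_hs_le hη hu j
  have a2 : wt (-(s / 2)) j ≤ 1 := by simpa using wt_mono (by linarith : -(s / 2) ≤ 0) j
  have a3 := wt_add_le (σ := 1 / 2) (by norm_num) j k
  rw [wt_sub_comm] at a3
  have b1 := wt_nonneg (-3) (k - j)
  have b2 := wt_nonneg (1 / 2) j
  have b3 := wt_nonneg (1 / 2) k
  rw [norm_mul]
  calc ‖dampMat A k j‖ * ‖u j‖ ≤ (C * wt (-3) (k - j) * wt (1 / 2) j) * (η * 1) := by
        gcongr
        · exact hN k j
        · exact a1.trans (by gcongr)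
    _ ≤ (C * wt (-3) (k - j) * (2 ^ (1 / 2 : ℝ) * wt (1 / 2) (k - j) * wt (1 / 2) k)) * (η * 1) := by
        gcongr
    _ = C * η * 2 ^ (1 / 2 : ℝ) * wt (1 / 2) k * (wt (-3) (k - j) * wt (1 / 2) (k - j)) := by ring
    _ ≤ _ := by
        rw [wt_mul]
        refine mul_le_mul_of_nonneg_left (wt_mono (by norm_num) _) (by positivity)

lemma summable_damp {A : ℤ → ℂ} (hA : Decay A) {s η : ℝ} (hs1 : 1 / 2 < s) (hη : 0 ≤ η)
    {u : ℤ → ℂ} (hu : hs s u ≤ ENNReal.ofReal (η ^ 2)) (k : ℤ) :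
    Summable fun j => dampMat A k j * u j := by
  obtain ⟨C, hC, hN⟩ := dampMat_bound hA
  exact Summable.of_norm_bounded ((summable_wt_sub k).mul_left _)
    (norm_damp_term_le hs1 hη hC hN hu k)

/-- The modes of absolute value at most `N`. -/
def modes (N : ℕ) : Finset ℤ := Finset.Icc (-(N : ℤ)) N

lemma sq_lt_of_notMem_modes {N : ℕ} {k : ℤ} (hk : k ∉ modes N) : (N : ℝ) ^ 2 ≤ (k : ℝ) ^ 2 := by
  rw [modes, Finset.mem_Icc, ← abs_le, not_le] at hk
  rw [← sq_abs (k : ℝ)]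
  have : (N : ℝ) ≤ |(k : ℝ)| := by exact_mod_cast hk.le
  gcongr

lemma hs_tail_le {s : ℝ} (hs1 : 1 / 2 < s) (N : ℕ) (w : ℤ → ℂ) :
    hs (1 / 2) (fun k => if k ∈ modes N then 0 else w k) ≤
      ENNReal.ofReal (wt (1 / 2 - s) N) * hs s w := by
  unfold hs
  rw [← ENNReal.tsum_mul_left]
  refine ENNReal.tsum_le_tsum fun k => ?_
  dsimp only
  split_ifs with h
  · simp
  · rw [← mul_assoc, ← ENNReal.ofReal_mul (wt_nonneg _ _)]
    gcongr
    have e : wt (1 / 2) k = wt (1 / 2 - s) k * wt s k := by rw [wt_mul]; congr 1; ring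
    rw [e]
    gcongr
    · exact wt_nonneg _ _
    · have := sq_lt_of_notMem_modes h
      exact Real.rpow_le_rpow_of_nonpos (by positivity) (by push_cast; linarith) (by linarith)

/-- The energy inequality in `L²` for the difference of two approximate solutions. -/
theorem exists_difference_energy {A p : ℤ → ℂ} {c C : ℝ} (hA : Decay A)
    (hp : IsDissipative A p c C) {s : ℝ} (hs1 : 1 / 2 < s) :
    ∃ κ C' : ℝ, 0 < κ ∧ 0 ≤ C' ∧ ∀ (u v : ℤ → ℂ), hs s u ≤ ENNReal.ofReal (κ ^ 2) →
      hs s v ≤ ENNReal.ofReal (κ ^ 2) → ∀ N : ℕ,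
      2 * (∑ k ∈ modes N, psum p (modes N) (fun j => u j - v j) k *
        conj (rhs A u k - rhs A v k)).re ≤
          C' * nf 0 (modes N) (fun j => u j - v j) + C' * wt (1 / 2 - s) N := by
  obtain ⟨C₁, hC₁, h₁⟩ := hs_damp_le hA (le_refl (0 : ℝ)) zero_le_two
  obtain ⟨C₂, hC₂, h₂⟩ := exists_hs_half_conv_le hs1
  have hc := hp.c_pos
  have hC := hp.C_nonneg
  -- A bound for the squared norms. The `16` collects `2` from the sum of two forcings, `4` from the
  -- squared norm of `u + v`, and `2` from separating the tail.
  set κ₂ : ℝ := c / (16 * C * C₂ + 1) with hκ₂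
  have hκ₂0 : 0 < κ₂ := by positivity
  refine ⟨√κ₂, C + 2 * C * (C₁ + 8 * C₂ * κ₂) * (4 * κ₂), by positivity, by positivity,
    fun u v hu hv N => ?_⟩
  have hu' := hu
  have hv' := hv
  rw [Real.sq_sqrt hκ₂0.le] at hu' hv'
  set S := modes N with hS
  set w : ℤ → ℂ := fun j => u j - v j with hw
  -- No equation is known for these modes, so they enter as an error: small in `H^{1/2}` because `w`
  -- is bounded in `H^s` with `s > 1/2`.
  set t : ℤ → ℂ := fun k => if k ∈ S then 0 else w k with ht
  set wS : ℤ → ℂ := fun k => if k ∈ S then w k else 0 with hwS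
  have hwsum : w = fun k => wS k + t k := by
    ext k; simp only [hwS, ht]; split_ifs <;> simp
  have hws4 : hs s w ≤ ENNReal.ofReal (4 * κ₂) := by
    refine (hs_sub_le s u v).trans ?_
    calc 2 * (hs s u + hs s v) ≤ 2 * (ENNReal.ofReal κ₂ + ENNReal.ofReal κ₂) := by gcongr
      _ = _ := by
        rw [← two_mul, ← mul_assoc, ENNReal.ofReal_mul (by norm_num)]; norm_num
  have hadd4 : hs s (fun j => u j + v j) ≤ ENNReal.ofReal (4 * κ₂) := by
    refine (hs_add_le s u v).trans ?_
    calc 2 * (hs s u + hs s v) ≤ 2 * (ENNReal.ofReal κ₂ + ENNReal.ofReal κ₂) := by gcongr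
      _ = _ := by
        rw [← two_mul, ← mul_assoc, ENNReal.ofReal_mul (by norm_num)]; norm_num
  have htail : hs (1 / 2) t ≤ ENNReal.ofReal (wt (1 / 2 - s) N * (4 * κ₂)) := by
    rw [ENNReal.ofReal_mul (wt_nonneg _ _)]
    exact (hs_tail_le hs1 N w).trans (by gcongr)
  set τ := wt (1 / 2 - s) N * (4 * κ₂) with hτ
  have hτ0 : 0 ≤ τ := mul_nonneg (wt_nonneg _ _) (by positivity)
  have ewS : hs (1 / 2) wS = ENNReal.ofReal (nf (1 / 2) S w) := by
    rw [hs_eq_nf (S := S) (1 / 2) (by simp +contextual [hwS])]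
    congr 1
    exact Finset.sum_congr rfl fun k hk => by simp [hwS, hk]
  have n1 := nf_nonneg (1 / 2) S w
  have n0 := nf_nonneg 0 S w
  have hwhalf : hs (1 / 2) w ≤ ENNReal.ofReal (2 * (nf (1 / 2) S w + τ)) := by
    rw [hwsum]
    refine (hs_add_le _ _ _).trans ?_
    rw [ENNReal.ofReal_mul zero_le_two, ENNReal.ofReal_ofNat, ENNReal.ofReal_add]
    · rw [← hwsum, ewS]; gcongr
    · rw [← hwsum]; exact n1
    · exact hτ0
  set r₁ : ℤ → ℂ := damp A t with hr₁
  set r₂ : ℤ → ℂ := fun k => Complex.I * k / 2 * conv (fun j => u j + v j) w k with hr₂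
  have b1 : nf (-(1 / 2)) S r₁ ≤ C₁ * τ := by
    refine nf_le_of_hs_le (by positivity) ?_ S
    have := h₁ t
    rw [zero_sub, zero_add] at this
    rw [ENNReal.ofReal_mul hC₁]
    exact this.trans (by gcongr)
  have b2 : nf (-(1 / 2)) S r₂ ≤ C₂ * ((4 * κ₂) * (2 * (nf (1 / 2) S w + τ))) := by
    refine nf_le_of_hs_le (by positivity) ?_ S
    have := hs_deriv_le (1 / 2) (conv (fun j => u j + v j) w)
    rw [show (1 / 2 : ℝ) - 1 = -(1 / 2) by norm_num] at this
    rw [ENNReal.ofReal_mul hC₂, ENNReal.ofReal_mul (by positivity)]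
    exact this.trans ((h₂ _ _).trans (by gcongr))
  -- The damping is cut at `S`, its coupling to the tail becoming `r₁`. The quadratic term `u² - v²
  -- = (u + v)(u - v)` is kept whole in `r₂`.
  have eq : ∀ k, rhs A u k - rhs A v k =
      -Complex.I * disp k * w k - ∑ j ∈ S, dampMat A k j * w j + -(r₁ k + r₂ k) := by
    intro k
    have e1 : damp A u k - damp A v k = ∑ j ∈ S, dampMat A k j * w j + r₁ k := by
      have sw : Summable fun j => dampMat A k j * w j := by
        refine ((summable_damp hA hs1 (Real.sqrt_nonneg _) hu k).sub
          (summable_damp hA hs1 (Real.sqrt_nonneg _) hv k)).congr fun j => ?_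
        simp only [hw]; ring
      have e2 : damp A u k - damp A v k = ∑' j, dampMat A k j * w j := by
        unfold damp
        rw [← (summable_damp hA hs1 (Real.sqrt_nonneg _) hu k).tsum_sub
          (summable_damp hA hs1 (Real.sqrt_nonneg _) hv k)]
        congr 1; ext j; simp only [hw]; ring
      have e3 : ∑ j ∈ S, dampMat A k j * w j = ∑' j, dampMat A k j * wS j := by
        rw [tsum_eq_sum (s := S) (by simp +contextual [hwS])]
        exact Finset.sum_congr rfl fun j hj => by simp [hwS, hj]
      have e4 : ∀ j, dampMat A k j * t j = dampMat A k j * w j - dampMat A k j * wS j := by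
        intro j; rw [congrFun hwsum j]; ring
      have sS : Summable fun j => dampMat A k j * wS j :=
        summable_of_ne_finset_zero (s := S) (by simp +contextual [hwS])
      rw [e2, e3, hr₁, damp]
      simp_rw [e4]
      rw [sw.tsum_sub sS]; ring
    have e5 : conv u u k - conv v v k = conv (fun j => u j + v j) w k :=
      conv_sub_conv hs1 (Real.sqrt_nonneg _) hu hv k
    have e6 : w k = u k - v k := rfl
    simp only [rhs, hr₂]
    linear_combination -e1 - Complex.I * k / 2 * e5 + Complex.I * disp k * e6
  simp_rw [eq]
  have hd := hp.dissipation S w (fun k => -(r₁ k + r₂ k))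
  refine hd.trans ?_
  have b3 : nf (-(1 / 2)) S (fun k => -(r₁ k + r₂ k)) ≤
      2 * (C₁ * τ + C₂ * ((4 * κ₂) * (2 * (nf (1 / 2) S w + τ)))) := by
    rw [nf_neg (-(1 / 2)) S (fun k => r₁ k + r₂ k)]
    exact (nf_add_le _ _ _ _).trans (by gcongr)
  have b4 : (16 * C * C₂) * κ₂ ≤ c := by
    rw [hκ₂, mul_div_assoc', div_le_iff₀ (by positivity)]; nlinarith
  have b5 : (16 * C * C₂) * κ₂ * nf (1 / 2) S w ≤ c * nf (1 / 2) S w := by gcongr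
  have b6 := mul_le_mul_of_nonneg_left b3 hC
  have b7 : 0 ≤ 2 * C * (C₁ + 8 * C₂ * κ₂) * (4 * κ₂) * nf 0 S w := by positivity
  have b8 : 0 ≤ C * wt (1 / 2 - s) N := mul_nonneg hC (wt_nonneg _ _)
  rw [hτ] at b6
  nlinarith

/-! ### Differential inequalities -/

lemma gronwall_of_hasDerivWithinAt {f f' : ℝ → ℝ} {C D T : ℝ} (hC : 0 ≤ C) (hD : 0 ≤ D)
    (hf : ∀ t ∈ Icc 0 T, HasDerivWithinAt f (f' t) (Icc 0 T) t)
    (hle : ∀ t ∈ Icc 0 T, f' t ≤ C * f t + D) {t : ℝ} (ht : t ∈ Icc 0 T) :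
    f t ≤ (f 0 + D * t) * Real.exp (C * t) := by
  have hg : ∀ t ∈ Icc 0 T, HasDerivWithinAt (fun t => f t * Real.exp (-(C * t)) - D * t)
      ((f' t - C * f t) * Real.exp (-(C * t)) - D) (Icc 0 T) t := by
    intro t ht
    have h1 : HasDerivAt (fun t : ℝ => Real.exp (-(C * t))) (Real.exp (-(C * t)) * (-C)) t := by
      have := ((hasDerivAt_id t).const_mul C).neg.exp
      simpa using this
    have h2 : HasDerivAt (fun t : ℝ => D * t) D t := by
      simpa using (hasDerivAt_id t).const_mul D
    refine (((hf t ht).mul h1.hasDerivWithinAt).sub h2.hasDerivWithinAt).congr_deriv ?_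
    ring
  have hanti : AntitoneOn (fun t => f t * Real.exp (-(C * t)) - D * t) (Icc 0 T) := by
    refine antitoneOn_of_hasDerivWithinAt_nonpos (convex_Icc 0 T)
      (fun t ht => (hg t ht).continuousWithinAt)
      (fun t ht => (hg t (interior_subset ht)).mono interior_subset) fun t ht => ?_
    have ht' : t ∈ Icc 0 T := interior_subset ht
    have h1 : Real.exp (-(C * t)) ≤ 1 := by
      rw [Real.exp_le_one_iff]; have := mul_nonneg hC ht'.1; linarith
    have h2 := Real.exp_pos (-(C * t))
    have h3 : (f' t - C * f t) * Real.exp (-(C * t)) ≤ D * Real.exp (-(C * t)) := by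
      gcongr; linarith [hle t ht']
    have h4 : D * Real.exp (-(C * t)) ≤ D * 1 := by gcongr
    linarith
  have h0 : (0 : ℝ) ∈ Icc 0 T := ⟨le_rfl, ht.1.trans ht.2⟩
  have := hanti h0 ht ht.1
  simp only [mul_zero, neg_zero, Real.exp_zero, mul_one, sub_zero] at this
  have h5 : Real.exp (-(C * t)) * Real.exp (C * t) = 1 := by rw [← Real.exp_add]; simp
  have h6 := Real.exp_pos (C * t)
  calc f t = (f t * Real.exp (-(C * t))) * Real.exp (C * t) := by rw [mul_assoc, h5, mul_one]
    _ ≤ _ := by gcongr; linarith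

/-- Hermitian symmetry makes the two terms of the product rule conjugate, hence equal in real part.
-/
lemma hasDerivWithinAt_energy {p : ℤ → ℂ} (hp : ∀ m, p (-m) = conj (p m)) {S : Finset ℤ}
    {x : ℝ → ℤ → ℂ} {x' : ℤ → ℂ} {I : Set ℝ} {t : ℝ}
    (hx : ∀ k ∈ S, HasDerivWithinAt (fun r => x r k) (x' k) I t) :
    HasDerivWithinAt (fun r => energy p S (x r))
      (2 * (∑ k ∈ S, psum p S (x t) k * conj (x' k)).re) I t := by
  have h1 : ∀ k ∈ S, HasDerivWithinAt (fun r => psum p S (x r) k) (psum p S x' k) I t := by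
    intro k _
    exact HasDerivWithinAt.fun_sum fun j hj => (hx j hj).const_mul _
  have h2 : HasDerivWithinAt (fun r => ∑ k ∈ S, psum p S (x r) k * conj (x r k))
      (∑ k ∈ S, (psum p S x' k * conj (x t k) + psum p S (x t) k * conj (x' k))) I t :=
    HasDerivWithinAt.fun_sum fun k hk => (h1 k hk).mul (hx k hk).star
  have h3 := Complex.reCLM.hasFDerivAt.comp_hasDerivWithinAt t h2
  refine h3.congr_deriv ?_
  have e : ∑ k ∈ S, psum p S x' k * conj (x t k) =
      conj (∑ k ∈ S, psum p S (x t) k * conj (x' k)) := by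
    simp only [psum, Finset.sum_mul, map_sum, map_mul, Complex.conj_conj]
    rw [Finset.sum_comm]
    refine Finset.sum_congr rfl fun k _ => Finset.sum_congr rfl fun j _ => ?_
    rw [← hp, neg_sub]; ring
  rw [Finset.sum_add_distrib, e, map_add, Complex.reCLM_apply, Complex.reCLM_apply,
    Complex.conj_re, two_mul]

/-! ### Approximate solutions and their stability -/

/-- A curve of small sequences whose modes up to `N` solve the equation. -/
structure IsApprox (A : ℤ → ℂ) (s κ T : ℝ) (N : ℕ) (u : ℝ → ℤ → ℂ) : Prop where
  small : ∀ t ∈ Icc 0 T, hs s (u t) ≤ ENNReal.ofReal (κ ^ 2)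
  deriv : ∀ k ∈ modes N, ∀ t ∈ Icc 0 T,
    HasDerivWithinAt (fun r => u r k) (rhs A (u t) k) (Icc 0 T) t

lemma modes_mono {N M : ℕ} (h : N ≤ M) : modes N ⊆ modes M := by
  intro k hk
  simp only [modes, Finset.mem_Icc] at hk ⊢
  omega

lemma IsApprox.mono {A : ℤ → ℂ} {s κ T : ℝ} {N M : ℕ} {u : ℝ → ℤ → ℂ} (h : IsApprox A s κ T M u)
    (hNM : N ≤ M) : IsApprox A s κ T N u :=
  ⟨h.small, fun k hk => h.deriv k (modes_mono hNM hk)⟩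

/-- It serves twice: two exact solutions and `N → ∞` give uniqueness, while two Galerkin
approximations of different size give convergence. The bound tends to zero like `N^{1-2s}`. -/
theorem exists_stability {A p : ℤ → ℂ} {c C : ℝ} (hA : Decay A)
    (hp : IsDissipative A p c C) {s : ℝ} (hs1 : 1 / 2 < s) :
    ∃ κ C' : ℝ, 0 < κ ∧ 0 ≤ C' ∧ ∀ (T : ℝ) (N : ℕ) (u v : ℝ → ℤ → ℂ),
      IsApprox A s κ T N u → IsApprox A s κ T N v → (∀ k ∈ modes N, u 0 k = v 0 k) →
      ∀ t ∈ Icc 0 T, nf 0 (modes N) (fun k => u t k - v t k) ≤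
        C' * wt (1 / 2 - s) N * T * Real.exp (C' * T) := by
  obtain ⟨κ, C', hκ, hC', h⟩ := exists_difference_energy hA hp hs1
  refine ⟨κ, C', hκ, hC', fun T N u v hu hv h0 t ht => ?_⟩
  have hT : 0 ≤ T := ht.1.trans ht.2
  have hw := wt_nonneg (1 / 2 - s) N
  have h1 : ∀ t ∈ Icc 0 T, HasDerivWithinAt
      (fun r => energy p (modes N) (fun k => u r k - v r k)) _ (Icc 0 T) t := fun t ht =>
    hasDerivWithinAt_energy hp.herm fun k hk => (hu.deriv k hk t ht).sub (hv.deriv k hk t ht)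
  have h2 := gronwall_of_hasDerivWithinAt hC' (D := C' * wt (1 / 2 - s) N) (by positivity) h1
    (fun t ht => (h (u t) (v t) (hu.small t ht) (hv.small t ht) N).trans (by
      gcongr; exact hp.lower _ _)) ht
  have h3 : energy p (modes N) (fun k => u 0 k - v 0 k) = 0 := by
    unfold energy
    rw [Finset.sum_eq_zero]
    · simp
    · intro k hk; simp [h0 k hk]
  rw [h3, zero_add] at h2
  refine (hp.lower _ _).trans (h2.trans ?_)
  gcongr
  · exact ht.2
  · exact ht.2

/-! ### Galerkin approximation -/

/-- Extension by zero of a finite family of modes. -/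
def extend (N : ℕ) (x : modes N → ℂ) (k : ℤ) : ℂ := if h : k ∈ modes N then x ⟨k, h⟩ else 0

lemma extend_of_notMem {N : ℕ} (x : modes N → ℂ) : ∀ k ∉ modes N, extend N x k = 0 :=
  fun _ hk => dif_neg hk

lemma extend_of_mem {N : ℕ} (x : modes N → ℂ) {k : ℤ} (hk : k ∈ modes N) :
    extend N x k = x ⟨k, hk⟩ := dif_pos hk

lemma contDiff_extend (N : ℕ) (k : ℤ) : ContDiff ℝ 1 (fun x : modes N → ℂ => extend N x k) := by
  unfold extend
  split_ifs with h
  · exact contDiff_apply ℝ ℂ _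
  · exact contDiff_const

lemma contDiff_rhs_extend (A : ℤ → ℂ) (N : ℕ) (k : ℤ) :
    ContDiff ℝ 1 (fun x : modes N → ℂ => rhs A (extend N x) k) := by
  have h1 : ∀ x : modes N → ℂ, rhs A (extend N x) k =
      -Complex.I * disp k * extend N x k - ∑ j ∈ modes N, dampMat A k j * extend N x j -
        Complex.I * k / 2 * ∑ j ∈ modes N, extend N x (k - j) * extend N x j := by
    intro x
    rw [rhs, damp_eq_sum A (extend_of_notMem x), conv, tsum_eq_sum (s := modes N)]
    intro j hj; simp [extend_of_notMem x j hj]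
  simp_rw [h1]
  have h2 := contDiff_extend N
  refine ((contDiff_const.mul (h2 k)).sub
    (ContDiff.sum fun j _ => contDiff_const.mul (h2 j))).sub
    (contDiff_const.mul (ContDiff.sum fun j _ => (h2 _).mul (h2 j)))

/-- The truncated vector field, cut off outside a ball of `H^s`. -/
def galerkinField (A : ℤ → ℂ) (s κ : ℝ) (N : ℕ) (x : modes N → ℂ) (k : modes N) : ℂ :=
  (Real.smoothTransition (2 - nf s (modes N) (extend N x) / κ) : ℂ) * rhs A (extend N x) k

lemma contDiff_galerkinField (A : ℤ → ℂ) (s κ : ℝ) (N : ℕ) :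
    ContDiff ℝ 1 (galerkinField A s κ N) := by
  rw [contDiff_pi]
  intro k
  refine ContDiff.mul ?_ (contDiff_rhs_extend A N k)
  refine Complex.ofRealCLM.contDiff.comp ?_
  refine Real.smoothTransition.contDiff.comp (contDiff_const.sub (ContDiff.div_const ?_ _))
  exact ContDiff.sum fun j _ => contDiff_const.mul ((contDiff_extend N j).norm_sq ℝ)

lemma norm_sq_le_nf {s : ℝ} (hs0 : 0 ≤ s) {N : ℕ} (x : modes N → ℂ) :
    ‖x‖ ^ 2 ≤ nf s (modes N) (extend N x) := by
  have h : ‖x‖ ≤ √(nf s (modes N) (extend N x)) := by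
    rw [pi_norm_le_iff_of_nonneg (Real.sqrt_nonneg _)]
    intro k
    apply Real.le_sqrt_of_sq_le
    have h1 := Finset.single_le_sum (s := modes N)
      (f := fun k => wt s k * ‖extend N x k‖ ^ 2)
      (fun k _ => mul_nonneg (wt_nonneg _ _) (by positivity)) k.2
    refine le_trans ?_ h1
    rw [extend_of_mem x k.2]
    exact le_mul_of_one_le_left (by positivity) (one_le_wt hs0 _)
  calc ‖x‖ ^ 2 ≤ √(nf s (modes N) (extend N x)) ^ 2 := by gcongr
    _ = _ := Real.sq_sqrt (nf_nonneg _ _ _)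

lemma galerkinField_eq_zero (A : ℤ → ℂ) {s κ : ℝ} (hκ : 0 < κ) {N : ℕ} {x : modes N → ℂ}
    (h : 2 * κ ≤ nf s (modes N) (extend N x)) : galerkinField A s κ N x = 0 := by
  ext k
  have : 2 - nf s (modes N) (extend N x) / κ ≤ 0 := by
    rw [sub_nonpos, le_div_iff₀ hκ]; exact h
  simp [galerkinField, Real.smoothTransition.zero_of_nonpos this]

lemma exists_norm_galerkinField_le (A : ℤ → ℂ) {s κ : ℝ} (hs0 : 0 ≤ s) (hκ : 0 < κ) (N : ℕ) :
    ∃ L : ℝ, 0 ≤ L ∧ ∀ x, ‖galerkinField A s κ N x‖ ≤ L := by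
  obtain ⟨L, hL⟩ := (isCompact_closedBall (0 : modes N → ℂ) (√(2 * κ))).exists_bound_of_continuousOn
    (contDiff_galerkinField A s κ N).continuous.continuousOn
  refine ⟨max L 0, le_max_right _ _, fun x => ?_⟩
  by_cases hx : ‖x‖ ≤ √(2 * κ)
  · exact (hL x (by simpa using hx)).trans (le_max_left _ _)
  · rw [galerkinField_eq_zero A hκ, norm_zero]
    · exact le_max_right _ _
    · refine le_trans ?_ (norm_sq_le_nf hs0 x)
      exact (Real.lt_sq_of_sqrt_lt (not_le.1 hx)).le

/-- Global solutions of the cut off Galerkin system. -/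
lemma exists_galerkin_flow (A : ℤ → ℂ) {s κ : ℝ} (hs0 : 0 ≤ s) (hκ : 0 < κ) (N : ℕ)
    (x₀ : modes N → ℂ) : ∃ x : ℝ → modes N → ℂ, x 0 = x₀ ∧
      ∀ t ∈ Icc (0 : ℝ) 1, HasDerivWithinAt x (galerkinField A s κ N (x t)) (Icc 0 1) t := by
  obtain ⟨L, hL0, hL⟩ := exists_norm_galerkinField_le A hs0 hκ N
  have hlip : ∃ K, LipschitzOnWith K (galerkinField A s κ N) (Metric.closedBall x₀ L) :=
    ((contDiff_galerkinField A s κ N).contDiffOn).exists_lipschitzOnWith one_ne_zero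
      (convex_closedBall _ _) (isCompact_closedBall _ _)
  obtain ⟨K, hK⟩ := hlip
  have h0 : (0 : ℝ) ∈ Icc (0 : ℝ) 1 := ⟨le_rfl, zero_le_one⟩
  -- The cut off field is bounded by `L`, so a ball of radius `L` cannot be left before time `1` and
  -- a single Picard–Lindelöf step suffices.
  have hP : IsPicardLindelof (fun _ => galerkinField A s κ N) (⟨0, h0⟩ : Icc (0 : ℝ) 1) x₀
      ⟨L, hL0⟩ 0 ⟨L, hL0⟩ K := by
    refine ⟨fun t _ => hK, fun x _ => continuousOn_const, fun t _ x _ => hL x, ?_⟩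
    simp
  exact hP.exists_eq_forall_mem_Icc_hasDerivWithinAt₀

/-- The Galerkin approximations, with bounds uniform in the number of modes. -/
theorem exists_galerkin {A p : ℤ → ℂ} {c C : ℝ} (hA : Decay A) (hp : IsDissipative A p c C)
    {s : ℝ} (hs1 : 1 / 2 < s) (hs2 : s ≤ 2) :
    ∃ κ₀ : ℝ, 0 < κ₀ ∧ ∀ κ, 0 < κ → κ ≤ κ₀ → ∃ ρ B : ℝ, 0 < ρ ∧ 0 ≤ B ∧
      ∀ (u₀ : ℤ → ℂ), hs s u₀ ≤ ENNReal.ofReal (ρ ^ 2) → ∀ N : ℕ, ∃ u : ℝ → ℤ → ℂ,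
        IsApprox A s κ 1 N u ∧ (∀ k ∈ modes N, u 0 k = u₀ k) ∧
        (∀ t, ∀ k ∉ modes N, u t k = 0) ∧
        ∫ t in (0 : ℝ)..1, nf (s + 1 / 2) (modes N) (u t) ≤ B := by
  obtain ⟨κ₁, C', hκ₁, hC', h⟩ := exists_high_energy hA hp hs1 hs2
  have hc := hp.c_pos
  have hC := hp.C_nonneg
  have hs0 : 0 ≤ s := by linarith
  -- Ensures `2 κ² ≤ κ₁`, so the energy inequality holds wherever the cutoff is nonzero.
  refine ⟨√(κ₁ / 2), by positivity, fun κ hκ hκ₀ => ?_⟩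
  have hκ2 : 2 * κ ^ 2 ≤ κ₁ := by
    have := pow_le_pow_left₀ hκ.le hκ₀ 2
    rw [Real.sq_sqrt (by positivity)] at this; linarith
  have hexp := Real.exp_pos C'
  -- The growth of the energy on `[0, 1]`, including its equivalence constant, must keep the squared
  -- norm below `κ²`.
  set ρ : ℝ := κ / √(C * Real.exp C' + 1) with hρ
  have hρ0 : 0 < ρ := by positivity
  have hρ1 : C * ρ ^ 2 * Real.exp C' ≤ κ ^ 2 := by
    rw [hρ, div_pow, Real.sq_sqrt (by positivity), mul_div_assoc', div_mul_eq_mul_div,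
      div_le_iff₀ (by positivity)]
    nlinarith [sq_nonneg κ]
  refine ⟨ρ, 2 / c * (C * ρ ^ 2 + C' * κ ^ 2), hρ0, by positivity, fun u₀ hu₀ N => ?_⟩
  have hκ20 : 0 < κ ^ 2 := by positivity
  obtain ⟨x, hx0, hx⟩ := exists_galerkin_flow A hs0 hκ20 N (fun k => u₀ k)
  set u : ℝ → ℤ → ℂ := fun t => extend N (x t) with hu
  have hsupp : ∀ t, ∀ k ∉ (modes N), u t k = 0 := fun t => extend_of_notMem (x t)
  -- Equal to `1` while the squared norm is at most `κ²`, and to `0` once it reaches `2 κ²`.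
  set χ : ℝ → ℝ := fun t => Real.smoothTransition (2 - nf s (modes N) (u t) / κ ^ 2) with hχ
  have hder : ∀ k ∈ (modes N), ∀ t ∈ Icc (0 : ℝ) 1,
      HasDerivWithinAt (fun r => u r k) ((χ t : ℂ) * rhs A (u t) k) (Icc 0 1) t := by
    intro k hk t ht
    have := hasDerivWithinAt_pi.1 (hx t ht) ⟨k, hk⟩
    simp only [hu, extend_of_mem _ hk]
    exact this
  set E : ℝ → ℝ := fun t => energy p (modes N) (fun j => (wt (s / 2) j : ℂ) * u t j) with hE
  set W : ℝ → ℝ := fun t => 2 * (∑ k ∈ (modes N), psum p (modes N) (fun j => (wt (s / 2) j : ℂ) * u t j) k *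
        conj ((wt (s / 2) k : ℂ) * rhs A (u t) k)).re with hW
  have hEder : ∀ t ∈ Icc (0 : ℝ) 1, HasDerivWithinAt E (χ t * W t) (Icc 0 1) t := by
    intro t ht
    have := hasDerivWithinAt_energy hp.herm (S := modes N) (I := Icc 0 1) (t := t)
      (x := fun t j => (wt (s / 2) j : ℂ) * u t j)
      (fun k hk => (hder k hk t ht).const_mul (wt (s / 2) k : ℂ))
    refine this.congr_deriv ?_
    simp only [hW]
    rw [mul_left_comm, ← Complex.re_ofReal_mul (χ t), Finset.mul_sum]
    refine congrArg (fun z : ℂ => 2 * z.re) (Finset.sum_congr rfl fun k _ => ?_)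
    simp only [map_mul, Complex.conj_ofReal]; ring
  have hlow : ∀ t, nf s (modes N) (u t) ≤ E t := by
    intro t
    have := hp.lower (modes N) (fun j => (wt (s / 2) j : ℂ) * u t j)
    rwa [nf_shift, zero_add] at this
  have hupp : ∀ t, E t ≤ C * nf s (modes N) (u t) := by
    intro t
    have := hp.upper (modes N) (fun j => (wt (s / 2) j : ℂ) * u t j)
    rwa [nf_shift, zero_add] at this
  have hWle : ∀ t, nf s (modes N) (u t) ≤ 2 * κ ^ 2 →
      W t ≤ -(c / 2) * nf (s + 1 / 2) (modes N) (u t) + C' * nf s (modes N) (u t) :=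
    fun t ht => h (modes N) (u t) (hsupp t) (ht.trans hκ2)
  have hinit : nf s (modes N) (u 0) ≤ ρ ^ 2 := by
    have : nf s (modes N) (u 0) = nf s (modes N) u₀ :=
      Finset.sum_congr rfl fun k hk => by simp only [hu, hx0, extend_of_mem _ hk]
    rw [this]
    exact nf_le_of_hs_le (by positivity) hu₀ (modes N)
  have hE0 : E 0 ≤ C * ρ ^ 2 := (hupp 0).trans (by gcongr)
  have hbound : ∀ t ∈ Icc (0 : ℝ) 1, nf s (modes N) (u t) ≤ κ ^ 2 := by
    intro t ht
    have hg := gronwall_of_hasDerivWithinAt hC' le_rfl hEder (fun t _ => ?_) ht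
    · rw [zero_mul, add_zero] at hg
      calc nf s (modes N) (u t) ≤ E t := hlow t
        _ ≤ E 0 * Real.exp (C' * t) := hg
        _ ≤ (C * ρ ^ 2) * Real.exp (C' * 1) := by
            gcongr
            exact ht.2
        _ ≤ κ ^ 2 := by rw [mul_one]; exact hρ1
    · rw [add_zero]
      have n0 := nf_nonneg s (modes N) (u t)
      have n1 := nf_nonneg (s + 1 / 2) (modes N) (u t)
      have hCE : C' * nf s (modes N) (u t) ≤ C' * E t := by gcongr; exact hlow t
      rcases le_total (nf s (modes N) (u t)) (2 * κ ^ 2) with h1 | h1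
      · have hχ0 : 0 ≤ χ t := Real.smoothTransition.nonneg _
        have hχ1 : χ t ≤ 1 := Real.smoothTransition.le_one _
        have h2 : W t ≤ C' * nf s (modes N) (u t) := by
          have := hWle t h1
          have : 0 ≤ c / 2 * nf (s + 1 / 2) (modes N) (u t) := by positivity
          linarith
        calc χ t * W t ≤ χ t * (C' * nf s (modes N) (u t)) := by gcongr
          _ ≤ 1 * (C' * nf s (modes N) (u t)) := by gcongr
          _ ≤ _ := by rw [one_mul]; exact hCE
      · have : χ t = 0 := by
          apply Real.smoothTransition.zero_of_nonpos
          rw [sub_nonpos, le_div_iff₀ hκ20]; exact h1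
        rw [this, zero_mul]
        exact le_trans (by positivity) hCE
  -- By the a priori bound the cutoff is never active, so the true Galerkin system is solved.
  have hχ1 : ∀ t ∈ Icc (0 : ℝ) 1, χ t = 1 := by
    intro t ht
    apply Real.smoothTransition.one_of_one_le
    have : nf s (modes N) (u t) / κ ^ 2 ≤ 1 := by rw [div_le_one hκ20]; exact hbound t ht
    linarith
  refine ⟨u, ⟨fun t ht => ?_, fun k hk t ht => ?_⟩, fun k hk => ?_, hsupp, ?_⟩
  · rw [hs_eq_nf s (hsupp t)]
    exact ENNReal.ofReal_le_ofReal (hbound t ht)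
  · have := hder k hk t ht
    rwa [hχ1 t ht, Complex.ofReal_one, one_mul] at this
  · simp only [hu, hx0, extend_of_mem _ hk]
  · have hcont : ContinuousOn (fun t => nf (s + 1 / 2) (modes N) (u t)) (Icc 0 1) := by
      refine continuousOn_finsetSum _ fun k hk => ?_
      refine continuousOn_const.mul (ContinuousOn.pow (ContinuousOn.norm ?_) 2)
      exact fun t ht => (hder k hk t ht).continuousWithinAt
    -- Integrating the energy inequality and keeping its dissipative term bounds the `L² H^{s+1/2}`
    -- norm uniformly in `N`.
    have hsub := intervalIntegral.sub_le_integral_of_hasDeriv_right_of_le (a := 0) (b := 1)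
      (g := E) (g' := fun t => χ t * W t)
      (φ := fun t => -(c / 2) * nf (s + 1 / 2) (modes N) (u t) + C' * κ ^ 2) zero_le_one
      (fun t ht => (hEder t ht).continuousWithinAt)
      (fun t ht => (hEder t ⟨ht.1.le, ht.2.le⟩).mono_of_mem_nhdsWithin
        (Icc_mem_nhdsGT_of_mem ⟨ht.1.le, ht.2⟩))
      ((continuousOn_const.mul hcont).add continuousOn_const).integrableOn_Icc
      (fun t ht => by
        have ht' : t ∈ Icc (0 : ℝ) 1 := ⟨ht.1.le, ht.2.le⟩
        have hb := hbound t ht'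
        have := hWle t (by linarith)
        rw [hχ1 t ht', one_mul]
        have : C' * nf s (modes N) (u t) ≤ C' * κ ^ 2 := by gcongr
        linarith)
    have hii : IntervalIntegrable (fun t => nf (s + 1 / 2) (modes N) (u t)) volume 0 1 :=
      ContinuousOn.intervalIntegrable (by rwa [uIcc_of_le zero_le_one])
    rw [intervalIntegral.integral_add (hii.const_mul _) intervalIntegrable_const,
      intervalIntegral.integral_const_mul, intervalIntegral.integral_const, sub_zero, one_smul]
      at hsub
    have hE1 : 0 ≤ E 1 := (nf_nonneg _ _ _).trans (hlow 1)
    rw [div_mul_eq_mul_div, le_div_iff₀ hc]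
    linarith

/-! ### Continuity of the right-hand side -/

lemma tendsto_damp {ι : Type*} {l : Filter ι} {A : ℤ → ℂ} (hA : Decay A) {s κ : ℝ}
    (hs1 : 1 / 2 < s) (hκ : 0 ≤ κ) {u : ι → ℤ → ℂ} {v : ℤ → ℂ}
    (hu : ∀ᶠ n in l, hs s (u n) ≤ ENNReal.ofReal (κ ^ 2))
    (h : ∀ k, Tendsto (fun n => u n k) l (𝓝 (v k))) (k : ℤ) :
    Tendsto (fun n => damp A (u n) k) l (𝓝 (damp A v k)) := by
  obtain ⟨C, hC, hN⟩ := dampMat_bound hA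
  exact tendsto_tsum_of_dominated_convergence ((summable_wt_sub k).mul_left _)
    (fun j => (h j).const_mul _) (hu.mono fun n hn => norm_damp_term_le hs1 hκ hC hN hn k)

lemma tendsto_conv {ι : Type*} {l : Filter ι} {s κ : ℝ}
    (hs1 : 1 / 2 < s) (hκ : 0 ≤ κ) {u : ι → ℤ → ℂ} {v : ℤ → ℂ}
    (hu : ∀ᶠ n in l, hs s (u n) ≤ ENNReal.ofReal (κ ^ 2))
    (h : ∀ k, Tendsto (fun n => u n k) l (𝓝 (v k))) (k : ℤ) :
    Tendsto (fun n => conv (u n) (u n) k) l (𝓝 (conv v v k)) :=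
  tendsto_tsum_of_dominated_convergence (summable_conv_bound hs1 κ k)
    (fun j => (h _).mul (h j)) (hu.mono fun _ hn => norm_mul_sub_le hκ hn hn k)

lemma tendsto_rhs {ι : Type*} {l : Filter ι} {A : ℤ → ℂ} (hA : Decay A) {s κ : ℝ}
    (hs1 : 1 / 2 < s) (hκ : 0 ≤ κ) {u : ι → ℤ → ℂ} {v : ℤ → ℂ}
    (hu : ∀ᶠ n in l, hs s (u n) ≤ ENNReal.ofReal (κ ^ 2))
    (h : ∀ k, Tendsto (fun n => u n k) l (𝓝 (v k))) (k : ℤ) :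
    Tendsto (fun n => rhs A (u n) k) l (𝓝 (rhs A v k)) :=
  (((h k).const_mul _).sub (tendsto_damp hA hs1 hκ hu h k)).sub
    ((tendsto_conv hs1 hκ hu h k).const_mul _)

/-- Gives each mode a Lipschitz constant independent of `N`, and the majorants needed for limits
under the time integral and for sums against smooth test functions. -/
lemma exists_norm_rhs_le {A : ℤ → ℂ} (hA : Decay A) {s κ : ℝ} (hs1 : 1 / 2 < s) (hκ : 0 ≤ κ) :
    ∃ R, 0 ≤ R ∧ ∀ u, hs s u ≤ ENNReal.ofReal (κ ^ 2) → ∀ k, ‖rhs A u k‖ ≤ R * wt 1 k := by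
  obtain ⟨C, hC, hN⟩ := dampMat_bound hA
  set Z := ∑' j, wt (-s) j with hZ
  have hZ0 : 0 ≤ Z := tsum_nonneg fun j => wt_nonneg _ _
  have hM := wtMass_nonneg
  refine ⟨κ + C * κ * 2 ^ (1 / 2 : ℝ) * wtMass + κ ^ 2 * (Z + Z), by positivity, fun u hu k => ?_⟩
  have w1 : wt (1 / 2) k ≤ wt 1 k := wt_mono (by norm_num) k
  have w0 := wt_nonneg 1 k
  have a1 : ‖-Complex.I * disp k * u k‖ ≤ κ * wt 1 k := by
    have h1 : |disp k| ≤ wt 1 k := by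
      rw [disp, abs_mul, abs_abs, ← sq, sq_abs, wt_one]; linarith
    have h2 : ‖u k‖ ≤ κ := by
      refine (norm_le_of_hs_le hκ hu k).trans ?_
      have : wt (-(s / 2)) k ≤ 1 := by simpa using wt_mono (by linarith : -(s / 2) ≤ 0) k
      nlinarith
    rw [norm_mul, norm_mul, norm_neg, Complex.norm_I, one_mul, Complex.norm_real,
      Real.norm_eq_abs, mul_comm]
    gcongr
  have a2 : ‖damp A u k‖ ≤ C * κ * 2 ^ (1 / 2 : ℝ) * wtMass * wt 1 k := by
    have := tsum_of_norm_bounded ((summable_wt_sub k).mul_left _).hasSum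
      (norm_damp_term_le hs1 hκ hC hN hu k)
    rw [tsum_mul_left, tsum_wt_sub] at this
    calc ‖damp A u k‖ ≤ C * κ * 2 ^ (1 / 2 : ℝ) * wt (1 / 2) k * wtMass := this
      _ = C * κ * 2 ^ (1 / 2 : ℝ) * wtMass * wt (1 / 2) k := by ring
      _ ≤ _ := by gcongr
  have a3 : ‖Complex.I * k / 2 * conv u u k‖ ≤ κ ^ 2 * (Z + Z) * wt 1 k := by
    have h1 : ‖conv u u k‖ ≤ κ ^ 2 * (Z + Z) := by
      have := tsum_of_norm_bounded (summable_conv_bound hs1 κ k).hasSum (norm_mul_sub_le hκ hu hu k)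
      have e : ∑' j, wt (-s) (k - j) = Z := (Equiv.subLeft k).tsum_eq _
      have e' : Summable fun j => wt (-s) (k - j) :=
        (Equiv.subLeft k).summable_iff.2 (summable_wt hs1)
      rw [tsum_mul_left, e'.tsum_add (summable_wt hs1), e] at this
      exact this
    have h2 : ‖Complex.I * k / 2‖ ≤ wt 1 k := by
      simp only [norm_div, norm_mul, Complex.norm_I, one_mul, Complex.norm_intCast,
        RCLike.norm_ofNat]
      have := (abs_le_wt k).trans w1
      linarith
    rw [norm_mul, mul_comm]
    gcongr
  refine (norm_sub_le _ _).trans ((add_le_add (norm_sub_le _ _) le_rfl).trans ?_)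
  linarith

lemma hasDerivWithinAt_of_integral {f g : ℝ → ℂ} {z : ℂ} {T : ℝ} (hg : ContinuousOn g (Icc 0 T))
    (h : ∀ t ∈ Icc 0 T, f t = z + ∫ τ in (0 : ℝ)..t, g τ) {t : ℝ} (ht : t ∈ Icc 0 T) :
    HasDerivWithinAt f (g t) (Icc 0 T) t := by
  have hF : Fact (t ∈ Icc 0 T) := ⟨ht⟩
  have h1 : HasDerivWithinAt (fun t => ∫ τ in (0 : ℝ)..t, g τ) (g t) (Icc 0 T) t := by
    refine intervalIntegral.integral_hasDerivWithinAt_right ?_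
      (hg.stronglyMeasurableAtFilter_nhdsWithin measurableSet_Icc t) (hg t ht)
    refine (hg.mono ?_).intervalIntegrable
    rw [uIcc_of_le ht.1]
    exact Icc_subset_Icc_right ht.2
  exact (h1.const_add z).congr h (h t ht)

lemma IsApprox.continuousOn_rhs {A : ℤ → ℂ} (hA : Decay A) {s κ T : ℝ} {N : ℕ}
    (hs1 : 1 / 2 < s) (hκ : 0 ≤ κ) {u : ℝ → ℤ → ℂ} (hu : IsApprox A s κ T N u)
    (hc : ∀ k, ContinuousOn (fun t => u t k) (Icc 0 T)) (k : ℤ) :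
    ContinuousOn (fun t => rhs A (u t) k) (Icc 0 T) := fun t ht =>
  tendsto_rhs hA hs1 hκ (eventually_nhdsWithin_of_forall hu.small) (fun k => hc k t ht) k

lemma IsApprox.eq_integral {A : ℤ → ℂ} (hA : Decay A) {s κ T : ℝ} {N : ℕ}
    (hs1 : 1 / 2 < s) (hκ : 0 ≤ κ) {u : ℝ → ℤ → ℂ} (hu : IsApprox A s κ T N u)
    (hc : ∀ k, ContinuousOn (fun t => u t k) (Icc 0 T)) {k : ℤ} (hk : k ∈ modes N) {t : ℝ}
    (ht : t ∈ Icc 0 T) : u t k = u 0 k + ∫ τ in (0 : ℝ)..t, rhs A (u τ) k := by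
  have hsub : Icc 0 t ⊆ Icc 0 T := Icc_subset_Icc_right ht.2
  rw [intervalIntegral.integral_eq_sub_of_hasDeriv_right_of_le ht.1 ((hc k).mono hsub)
    (fun r hr => (hu.deriv k hk r (hsub (Ioo_subset_Icc_self hr))).mono_of_mem_nhdsWithin
      (Icc_mem_nhdsGT_of_mem ⟨hr.1.le, hr.2.trans_le ht.2⟩))]
  · ring
  · refine ((hu.continuousOn_rhs hA hs1 hκ hc k).mono ?_).intervalIntegrable
    rwa [uIcc_of_le ht.1]

/-! ### Passage to the limit -/

lemma hs_le_of_forall_nf_le {σ : ℝ} {x : ℤ → ℂ} {b : ℝ≥0∞}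
    (h : ∀ S, ENNReal.ofReal (nf σ S x) ≤ b) : hs σ x ≤ b := by
  rw [hs, ENNReal.tsum_eq_iSup_sum]
  exact iSup_le fun S => (ofReal_nf σ S x) ▸ h S

lemma tendsto_nf {ι : Type*} {l : Filter ι} {u : ι → ℤ → ℂ} {v : ℤ → ℂ} (σ : ℝ) (S : Finset ℤ)
    (h : ∀ k, Tendsto (fun n => u n k) l (𝓝 (v k))) :
    Tendsto (fun n => nf σ S (u n)) l (𝓝 (nf σ S v)) :=
  tendsto_finsetSum _ fun k _ => ((h k).norm.pow 2).const_mul _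

lemma hs_le_liminf {u : ℕ → ℤ → ℂ} {v : ℤ → ℂ} (σ : ℝ)
    (h : ∀ k, Tendsto (fun n => u n k) atTop (𝓝 (v k))) :
    hs σ v ≤ liminf (fun n => hs σ (u n)) atTop := by
  refine hs_le_of_forall_nf_le fun S => ?_
  have := (ENNReal.continuous_ofReal.tendsto _).comp (tendsto_nf σ S h)
  rw [← this.liminf_eq]
  exact liminf_le_liminf (Eventually.of_forall fun n => ofReal_nf_le_hs σ S (u n))

lemma tendsto_wt_atTop {s : ℝ} (hs1 : 1 / 2 < s) :
    Tendsto (fun N : ℕ => wt (1 / 2 - s) N) atTop (𝓝 0) := by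
  have h1 : Tendsto (fun N : ℕ => 1 + (N : ℝ) ^ 2) atTop atTop :=
    tendsto_atTop_add_const_left _ _
      ((tendsto_pow_atTop two_ne_zero).comp tendsto_natCast_atTop_atTop)
  have h2 := (tendsto_rpow_neg_atTop (by linarith : 0 < s - 1 / 2)).comp h1
  refine h2.congr fun N => ?_
  simp [wt]

lemma mem_modes_natAbs (k : ℤ) : k ∈ modes k.natAbs := by
  simp only [modes, Finset.mem_Icc]; omega

lemma norm_sq_le_nf_zero {S : Finset ℤ} {k : ℤ} (hk : k ∈ S) (x : ℤ → ℂ) :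
    ‖x k‖ ^ 2 ≤ nf 0 S x := by
  have := Finset.single_le_sum (s := S) (f := fun k => wt 0 k * ‖x k‖ ^ 2)
    (fun k _ => mul_nonneg (wt_nonneg _ _) (by positivity)) hk
  simpa [nf] using this

/-- Local well-posedness at the level of Fourier coefficients. -/
theorem exists_wellposed {A : ℤ → ℂ} (hA : Decay A) (hcj : ∀ k, A (-k) = conj (A k))
    (h0 : A 0 ≠ 0) {s : ℝ} (hs1 : 1 / 2 < s) (hs2 : s ≤ 2) :
    ∃ κ ρ : ℝ, 0 < κ ∧ 0 < ρ ∧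
      (∀ (T : ℝ) (u v : ℝ → ℤ → ℂ), (∀ N, IsApprox A s κ T N u) → (∀ N, IsApprox A s κ T N v) →
        u 0 = v 0 → ∀ t ∈ Icc 0 T, u t = v t) ∧
      ∀ u₀ : ℤ → ℂ, hs s u₀ ≤ ENNReal.ofReal (ρ ^ 2) → ∃ u : ℝ → ℤ → ℂ,
        (∀ N, IsApprox A s (κ / 2) 1 N u) ∧ u 0 = u₀ ∧
          ∫⁻ t in Ioo (0 : ℝ) 1, hs (s + 1 / 2) (u t) < ⊤ := by
  obtain ⟨p, c, C, hp⟩ := exists_isDissipative hA hcj h0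
  obtain ⟨κ₁, C₁, hκ₁, hC₁, hstab⟩ := exists_stability hA hp hs1
  obtain ⟨κ₂, hκ₂, hgal⟩ := exists_galerkin hA hp hs1 hs2
  -- Solutions are built in half the ball where uniqueness holds; the margin is needed to compare
  -- them with solutions of unknown size.
  set η := min (κ₁ / 2) κ₂ with hη
  have hη0 : 0 < η := by positivity
  have hη1 : η ≤ κ₁ := (min_le_left _ _).trans (by linarith)
  have hη2 : η ≤ κ₁ / 2 := min_le_left _ _
  obtain ⟨ρ, B, hρ, hB, hgal⟩ := hgal η hη0 (min_le_right _ _)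
  have enlarge : ∀ {T : ℝ} {N : ℕ} {u : ℝ → ℤ → ℂ} {κ κ' : ℝ}, 0 ≤ κ → κ ≤ κ' →
      IsApprox A s κ T N u → IsApprox A s κ' T N u := fun h0 h1 h =>
    ⟨fun t ht => (h.small t ht).trans (ENNReal.ofReal_le_ofReal (by gcongr)), h.deriv⟩
  refine ⟨κ₁, ρ, hκ₁, hρ, fun T u v hu hv huv t ht => ?_, fun u₀ hu₀ => ?_⟩
  · ext k
    have h1 : ∀ᶠ N : ℕ in atTop, ‖u t k - v t k‖ ^ 2 ≤
        C₁ * wt (1 / 2 - s) N * T * Real.exp (C₁ * T) := by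
      filter_upwards [eventually_ge_atTop k.natAbs] with N hN
      refine (norm_sq_le_nf_zero (modes_mono hN (mem_modes_natAbs k))
        (fun k => u t k - v t k)).trans ?_
      exact hstab T N u v (hu N) (hv N) (fun k _ => congrFun huv k) t ht
    have h2 : Tendsto (fun N : ℕ => C₁ * wt (1 / 2 - s) N * T * Real.exp (C₁ * T)) atTop (𝓝 0) := by
      simpa using (((tendsto_wt_atTop hs1).const_mul C₁).mul_const T).mul_const (Real.exp (C₁ * T))
    have h3 := ge_of_tendsto h2 h1
    have h4 : ‖u t k - v t k‖ = 0 := by nlinarith [norm_nonneg (u t k - v t k)]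
    exact sub_eq_zero.1 (norm_eq_zero.1 h4)
  choose U hU hU0 hUs hUB using hgal u₀ hu₀
  have hUc : ∀ N k, ContinuousOn (fun t => U N t k) (Icc 0 1) := by
    intro N k
    by_cases hk : k ∈ modes N
    · exact fun t ht => ((hU N).deriv k hk t ht).continuousWithinAt
    · simp only [hUs N _ k hk]; exact continuousOn_const
  have hcau : ∀ t ∈ Icc (0 : ℝ) 1, ∀ k, ∃ z, Tendsto (fun N => U N t k) atTop (𝓝 z) := by
    intro t ht k
    -- The index is shifted by `|k|` so that mode `k` is always among those that are solved.
    set b : ℕ → ℝ := fun N => √(C₁ * wt (1 / 2 - s) ((N + k.natAbs : ℕ) : ℤ) * 1 *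
      Real.exp (C₁ * 1)) with hb
    have hb0 : Tendsto b atTop (𝓝 0) := by
      have h1 := (tendsto_add_atTop_iff_nat k.natAbs).2 (tendsto_wt_atTop hs1)
      have h2 := ((h1.const_mul C₁).mul_const 1).mul_const (Real.exp (C₁ * 1))
      have h3 := (Real.continuous_sqrt.tendsto _).comp h2
      have e : √(C₁ * 0 * 1 * Real.exp (C₁ * 1)) = 0 := by simp
      rw [e] at h3
      exact h3
    have hc : CauchySeq fun N => U (N + k.natAbs) t k := by
      refine cauchySeq_of_le_tendsto_0 b (fun n m N hn hm => ?_) hb0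
      rw [dist_eq_norm]
      apply Real.le_sqrt_of_sq_le
      have hk : k ∈ modes (N + k.natAbs) := modes_mono (by omega) (mem_modes_natAbs k)
      have hn' : N + k.natAbs ≤ n + k.natAbs := by omega
      have hm' : N + k.natAbs ≤ m + k.natAbs := by omega
      refine (norm_sq_le_nf_zero hk (fun j => U (n + k.natAbs) t j - U (m + k.natAbs) t j)).trans ?_
      exact hstab 1 _ _ _ (enlarge hη0.le hη1 ((hU _).mono hn'))
        (enlarge hη0.le hη1 ((hU _).mono hm'))
        (fun j hj => by rw [hU0 _ j (modes_mono hn' hj), hU0 _ j (modes_mono hm' hj)]) t ht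
    obtain ⟨z, hz⟩ := cauchySeq_tendsto_of_complete hc
    exact ⟨z, (tendsto_add_atTop_iff_nat k.natAbs).1 hz⟩
  choose! v hv using hcau
  have hsmall : ∀ t ∈ Icc (0 : ℝ) 1, hs s (v t) ≤ ENNReal.ofReal (η ^ 2) := by
    intro t ht
    refine (hs_le_liminf s (hv t ht)).trans ?_
    refine (liminf_le_liminf (v := fun _ => ENNReal.ofReal (η ^ 2))
      (Eventually.of_forall fun N => (hU N).small t ht)).trans ?_
    rw [liminf_const]
  obtain ⟨R, hR, hRb⟩ := exists_norm_rhs_le hA hs1 hη0.le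
  have hvc : ∀ k, ContinuousOn (fun t => v t k) (Icc 0 1) := by
    intro k
    have hL : LipschitzOnWith ⟨R * wt 1 k, mul_nonneg hR (wt_nonneg _ _)⟩ (fun t => v t k)
        (Icc 0 1) := by
      refine LipschitzOnWith.of_dist_le_mul fun t ht r hr => ?_
      have h1 : Tendsto (fun N => dist (U N t k) (U N r k)) atTop (𝓝 (dist (v t k) (v r k))) :=
        (hv t ht k).dist (hv r hr k)
      refine le_of_tendsto h1 ?_
      filter_upwards [eventually_ge_atTop k.natAbs] with N hN
      have hk := modes_mono hN (mem_modes_natAbs k)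
      rw [dist_eq_norm, dist_eq_norm]
      exact (convex_Icc 0 1).norm_image_sub_le_of_norm_hasDerivWithin_le
        (fun x hx => (hU N).deriv k hk x hx) (fun x hx => hRb _ ((hU N).small x hx) k) hr ht
    exact hL.continuousOn
  have hv0 : v 0 = u₀ := by
    ext k
    refine tendsto_nhds_unique (hv 0 ⟨le_rfl, zero_le_one⟩ k) ?_
    refine tendsto_const_nhds.congr' ?_
    filter_upwards [eventually_ge_atTop k.natAbs] with N hN
    exact (hU0 N k (modes_mono hN (mem_modes_natAbs k))).symm
  have hrc : ∀ k, ContinuousOn (fun t => rhs A (v t) k) (Icc 0 1) := fun k t ht =>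
    tendsto_rhs hA hs1 hη0.le (eventually_nhdsWithin_of_forall hsmall) (fun k => hvc k t ht) k
  have hint : ∀ k, ∀ t ∈ Icc (0 : ℝ) 1, v t k = u₀ k + ∫ τ in (0 : ℝ)..t, rhs A (v τ) k := by
    intro k t ht
    have hsub : uIoc 0 t ⊆ Icc (0 : ℝ) 1 := by
      rw [uIoc_of_le ht.1]
      exact fun r hr => ⟨hr.1.le, hr.2.trans ht.2⟩
    have h1 : Tendsto (fun N => ∫ τ in (0 : ℝ)..t, rhs A (U N τ) k) atTop
        (𝓝 (∫ τ in (0 : ℝ)..t, rhs A (v τ) k)) := by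
      refine intervalIntegral.tendsto_integral_filter_of_dominated_convergence
        (fun _ => R * wt 1 k) ?_ ?_ intervalIntegrable_const ?_
      · refine Eventually.of_forall fun N => ?_
        exact (((hU N).continuousOn_rhs hA hs1 hη0.le (hUc N) k).mono hsub).aestronglyMeasurable
          measurableSet_uIoc
      · exact Eventually.of_forall fun N => ae_of_all _ fun τ hτ =>
          hRb _ ((hU N).small τ (hsub hτ)) k
      · exact ae_of_all _ fun τ hτ => tendsto_rhs hA hs1 hη0.le
          (Eventually.of_forall fun N => (hU N).small τ (hsub hτ)) (hv τ (hsub hτ)) k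
    refine tendsto_nhds_unique (hv t ht k) ((h1.const_add (u₀ k)).congr' ?_)
    filter_upwards [eventually_ge_atTop k.natAbs] with N hN
    have hk := modes_mono hN (mem_modes_natAbs k)
    rw [(hU N).eq_integral hA hs1 hη0.le (hUc N) hk ht, hU0 N k hk]
  have happ : ∀ N, IsApprox A s η 1 N v := fun N =>
    ⟨hsmall, fun k _ t ht => hasDerivWithinAt_of_integral (hrc k) (hint k) ht⟩
  refine ⟨v, fun N => enlarge hη0.le hη2 (happ N), hv0, ?_⟩
  have hnfc : ∀ N, ContinuousOn (fun t => nf (s + 1 / 2) (modes N) (U N t)) (Icc 0 1) := fun N =>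
    continuousOn_finsetSum _ fun k _ => continuousOn_const.mul (((hUc N k).norm).pow 2)
  have hhs : ∀ N t, hs (s + 1 / 2) (U N t) =
      ENNReal.ofReal (nf (s + 1 / 2) (modes N) (U N t)) := fun N t => hs_eq_nf _ (hUs N t)
  have hB' : ∀ N, ∫⁻ t in Ioo (0 : ℝ) 1, hs (s + 1 / 2) (U N t) ≤ ENNReal.ofReal B := by
    intro N
    simp_rw [hhs]
    rw [← ofReal_integral_eq_lintegral_ofReal]
    · rw [← integral_Ioc_eq_integral_Ioo, ← intervalIntegral.integral_of_le zero_le_one]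
      exact ENNReal.ofReal_le_ofReal (hUB N)
    · exact (hnfc N).integrableOn_Icc.mono_set Ioo_subset_Icc_self
    · exact ae_of_all _ fun t => nf_nonneg _ _ _
  -- Fatou's lemma, over the modes and then over time.
  calc ∫⁻ t in Ioo (0 : ℝ) 1, hs (s + 1 / 2) (v t)
      ≤ ∫⁻ t in Ioo (0 : ℝ) 1, liminf (fun N => hs (s + 1 / 2) (U N t)) atTop :=
        setLIntegral_mono' measurableSet_Ioo fun t ht =>
          hs_le_liminf _ (hv t (Ioo_subset_Icc_self ht))
    _ ≤ liminf (fun N => ∫⁻ t in Ioo (0 : ℝ) 1, hs (s + 1 / 2) (U N t)) atTop := by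
        refine lintegral_liminf_le' fun N => ?_
        simp_rw [hhs]
        exact (((hnfc N).mono Ioo_subset_Icc_self).aemeasurable measurableSet_Ioo).ennreal_ofReal
    _ ≤ liminf (fun _ : ℕ => ENNReal.ofReal B) atTop :=
        liminf_le_liminf (Eventually.of_forall hB')
    _ = ENNReal.ofReal B := liminf_const _
    _ < ⊤ := ENNReal.ofReal_lt_top

/-! ### Continuity in `H^s` -/

/-- The part of the right-hand side which is not skew-adjoint. -/
def forcing (A : ℤ → ℂ) (u : ℤ → ℂ) (k : ℤ) : ℂ := -(damp A u k + Complex.I * k / 2 * conv u u k)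

lemma rhs_eq_forcing (A : ℤ → ℂ) (u : ℤ → ℂ) (k : ℤ) :
    rhs A u k = -Complex.I * disp k * u k + forcing A u k := by
  rw [rhs, forcing]; ring

lemma exists_hs_forcing_le {A : ℤ → ℂ} (hA : Decay A) {s κ : ℝ} (hs1 : 1 / 2 < s) (hs2 : s ≤ 2) :
    ∃ C : ℝ, ∀ u, hs s u ≤ ENNReal.ofReal (κ ^ 2) →
      hs (s - 1 / 2) (forcing A u) ≤ ENNReal.ofReal C * hs (s + 1 / 2) u := by
  obtain ⟨C₁, hC₁, h₁⟩ := hs_damp_le hA (by linarith : 0 ≤ s) hs2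
  obtain ⟨C₂, hC₂, h₂⟩ := exists_hs_conv_self_le hs1
  refine ⟨2 * (C₁ + C₂ * κ ^ 2), fun u hu => ?_⟩
  have e : hs (s - 1 / 2) (forcing A u) =
      hs (s - 1 / 2) (fun k => damp A u k + Complex.I * k / 2 * conv u u k) := by
    simp [hs, forcing, -neg_add_rev]
  have h3 := hs_deriv_le (s + 1 / 2) (conv u u)
  rw [show s + 1 / 2 - 1 = s - 1 / 2 by ring] at h3
  rw [e]
  calc _ ≤ 2 * (hs (s - 1 / 2) (damp A u) +
        hs (s - 1 / 2) (fun k => Complex.I * k / 2 * conv u u k)) := hs_add_le _ _ _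
    _ ≤ 2 * (ENNReal.ofReal C₁ * hs (s + 1 / 2) u +
          ENNReal.ofReal C₂ * (ENNReal.ofReal (κ ^ 2) * hs (s + 1 / 2) u)) := by
        gcongr
        · exact h₁ u
        · exact h3.trans ((h₂ u).trans (by gcongr))
    _ = _ := by
        rw [ENNReal.ofReal_mul zero_le_two, ENNReal.ofReal_add hC₁ (by positivity),
          ENNReal.ofReal_mul hC₂, ENNReal.ofReal_ofNat]
        ring

lemma continuousOn_of_isApprox {A : ℤ → ℂ} {s κ T : ℝ} {u : ℝ → ℤ → ℂ}
    (hu : ∀ N, IsApprox A s κ T N u) (k : ℤ) : ContinuousOn (fun t => u t k) (Icc 0 T) :=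
  fun t ht => ((hu k.natAbs).deriv k (mem_modes_natAbs k) t ht).continuousWithinAt

lemma continuousOn_forcing {A : ℤ → ℂ} (hA : Decay A) {s κ T : ℝ}
    (hs1 : 1 / 2 < s) (hκ : 0 ≤ κ) {u : ℝ → ℤ → ℂ} (hu : ∀ N, IsApprox A s κ T N u) (k : ℤ) :
    ContinuousOn (fun t => forcing A (u t) k) (Icc 0 T) := by
  have h1 := (hu 0).continuousOn_rhs hA hs1 hκ (continuousOn_of_isApprox hu) k
  refine (h1.sub ((continuousOn_of_isApprox hu k).const_smul (-Complex.I * disp k))).congr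
    fun t _ => ?_
  simp only [Pi.sub_apply, Pi.smul_apply, rhs_eq_forcing, smul_eq_mul]
  ring

/-- Dispersion only rotates each mode, so `|u_k|²` changes through the forcing alone. Extending the
integral to all of `(0, T)` gives a bound independent of `t`. -/
lemma norm_sq_mode_le {A : ℤ → ℂ} (hA : Decay A) {s κ T : ℝ}
    (hs1 : 1 / 2 < s) (hκ : 0 ≤ κ) {u : ℝ → ℤ → ℂ} (hu : ∀ N, IsApprox A s κ T N u)
    (k : ℤ) {t : ℝ} (ht : t ∈ Icc 0 T) :
    ‖u t k‖ₑ ^ 2 ≤ ‖u 0 k‖ₑ ^ 2 + ∫⁻ τ in Ioo 0 T, 2 * (‖u τ k‖ₑ * ‖forcing A (u τ) k‖ₑ) := by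
  have hsub : Icc 0 t ⊆ Icc 0 T := Icc_subset_Icc_right ht.2
  have hc := continuousOn_of_isApprox hu k
  have hF := continuousOn_forcing hA hs1 hκ hu k
  have hφ : ContinuousOn (fun τ => 2 * (‖u τ k‖ * ‖forcing A (u τ) k‖)) (Icc 0 t) :=
    continuousOn_const.mul ((hc.norm.mul hF.norm).mono hsub)
  have h1 := intervalIntegral.sub_le_integral_of_hasDeriv_right_of_le (a := 0) (b := t)
    (g := fun τ => ‖u τ k‖ ^ 2) (g' := fun τ => 2 * inner ℝ (u τ k) (rhs A (u τ) k))
    (φ := fun τ => 2 * (‖u τ k‖ * ‖forcing A (u τ) k‖)) ht.1 ((hc.norm.pow 2).mono hsub)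
    (fun r hr => by
      have := (hu k.natAbs).deriv k (mem_modes_natAbs k) r (hsub (Ioo_subset_Icc_self hr))
      exact this.norm_sq.mono_of_mem_nhdsWithin
        (Icc_mem_nhdsGT_of_mem ⟨hr.1.le, hr.2.trans_le ht.2⟩))
    hφ.integrableOn_Icc
    (fun r _ => by
      have e : inner ℝ (u r k) (rhs A (u r) k) = inner ℝ (u r k) (forcing A (u r) k) := by
        rw [rhs_eq_forcing, inner_add_right]
        have : inner ℝ (u r k) (-Complex.I * disp k * u r k) = 0 := by
          rw [Complex.inner]
          simp only [Complex.mul_re, Complex.mul_im, Complex.neg_re, Complex.neg_im, Complex.I_re,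
            Complex.I_im, Complex.ofReal_re, Complex.ofReal_im, Complex.conj_re, Complex.conj_im]
          ring
        rw [this, zero_add]
      rw [e]
      gcongr
      exact real_inner_le_norm _ _)
  have h2 : ‖u t k‖ ^ 2 ≤ ‖u 0 k‖ ^ 2 + ∫ τ in (0 : ℝ)..t, 2 * (‖u τ k‖ * ‖forcing A (u τ) k‖) := by
    linarith
  have h3 := ENNReal.ofReal_le_ofReal h2
  rw [ENNReal.ofReal_add (by positivity)
    (intervalIntegral.integral_nonneg ht.1 fun r _ => by positivity),
    ENNReal.ofReal_pow (norm_nonneg _), ENNReal.ofReal_pow (norm_nonneg _), ofReal_norm,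
    ofReal_norm] at h3
  refine h3.trans (add_le_add le_rfl ?_)
  rw [intervalIntegral.integral_of_le ht.1, integral_Ioc_eq_integral_Ioo,
    ofReal_integral_eq_lintegral_ofReal (hφ.integrableOn_Icc.mono_set Ioo_subset_Icc_self)
      (ae_of_all _ fun r => by positivity)]
  refine (lintegral_mono_set (Ioo_subset_Ioo_right ht.2)).trans (lintegral_mono fun r => le_of_eq ?_)
  rw [ENNReal.ofReal_mul zero_le_two, ENNReal.ofReal_mul (norm_nonneg _), ofReal_norm, ofReal_norm,
    ENNReal.ofReal_ofNat]

/-- Each mode is continuous, and the weighted squares are dominated uniformly in time by a summable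
sequence, so dominated convergence for the counting measure applies. -/
theorem tendsto_hs_sub {A : ℤ → ℂ} (hA : Decay A) {s κ T : ℝ}
    (hs1 : 1 / 2 < s) (hs2 : s ≤ 2) (hκ : 0 ≤ κ) {u : ℝ → ℤ → ℂ}
    (hu : ∀ N, IsApprox A s κ T N u) (hi : ∫⁻ t in Ioo 0 T, hs (s + 1 / 2) (u t) < ⊤) {t : ℝ}
    (ht : t ∈ Icc 0 T) :
    Tendsto (fun r => hs s (fun k => u r k - u t k)) (𝓝[Icc 0 T] t) (𝓝 0) := by
  obtain ⟨C, hC⟩ := exists_hs_forcing_le (κ := κ) hA hs1 hs2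
  set d : ℤ → ℝ≥0∞ := fun k => ENNReal.ofReal (wt s k) * (‖u 0 k‖ₑ ^ 2 +
    ∫⁻ τ in Ioo 0 T, 2 * (‖u τ k‖ₑ * ‖forcing A (u τ) k‖ₑ)) with hd
  have hdle : ∀ r ∈ Icc 0 T, ∀ k, ENNReal.ofReal (wt s k) * ‖u r k‖ₑ ^ 2 ≤ d k := fun r hr k => by
    simp only [hd]; gcongr; exact norm_sq_mode_le hA hs1 hκ hu k hr
  have hmeas : ∀ k, AEMeasurable (fun τ => 2 * (‖u τ k‖ₑ * ‖forcing A (u τ) k‖ₑ))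
      (volume.restrict (Ioo 0 T)) := fun k =>
    ((((continuousOn_of_isApprox hu k).mono Ioo_subset_Icc_self).aemeasurable
      measurableSet_Ioo).enorm.mul (((continuousOn_forcing hA hs1 hκ hu k).mono
        Ioo_subset_Icc_self).aemeasurable measurableSet_Ioo).enorm).const_mul 2
  have hdsum : ∑' k, d k ≠ ⊤ := by
    have e : ∑' k, d k = hs s (u 0) +
        ∫⁻ τ in Ioo 0 T, ∑' k, ENNReal.ofReal (wt s k) *
          (2 * (‖u τ k‖ₑ * ‖forcing A (u τ) k‖ₑ)) := by
      rw [lintegral_tsum fun k => (hmeas k).const_mul _]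
      simp only [hd, mul_add]
      rw [ENNReal.tsum_add]
      congr 1
      refine tsum_congr fun k => ?_
      rw [lintegral_const_mul'' _ (hmeas k)]
    have h2 : ∫⁻ τ in Ioo 0 T, ∑' k, ENNReal.ofReal (wt s k) *
          (2 * (‖u τ k‖ₑ * ‖forcing A (u τ) k‖ₑ)) ≤
        ∫⁻ τ in Ioo 0 T, (1 + ENNReal.ofReal C) * hs (s + 1 / 2) (u τ) := by
      refine setLIntegral_mono' measurableSet_Ioo fun τ hτ => ?_
      -- The weight is shared as `s = (s + 1/2)/2 + (s - 1/2)/2`: the solution has half a derivative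
      -- to spare and the forcing lacks half.
      calc _ ≤ ∑' k, (ENNReal.ofReal (wt (s + 1 / 2) k) * ‖u τ k‖ₑ ^ 2 +
            ENNReal.ofReal (wt (s - 1 / 2) k) * ‖forcing A (u τ) k‖ₑ ^ 2) := by
            refine ENNReal.tsum_le_tsum fun k => ?_
            rw [hs_term', hs_term']
            refine le_trans (le_of_eq ?_) (two_mul_le_sq_add_sq _ _)
            have e : wt s k = wt ((s + 1 / 2) / 2) k * wt ((s - 1 / 2) / 2) k := by
              rw [wt_mul]; congr 1; ring
            rw [e, ENNReal.ofReal_mul (wt_nonneg _ _)]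
            ring
        _ = hs (s + 1 / 2) (u τ) + hs (s - 1 / 2) (forcing A (u τ)) := ENNReal.tsum_add
        _ ≤ hs (s + 1 / 2) (u τ) + ENNReal.ofReal C * hs (s + 1 / 2) (u τ) := by
            gcongr; exact hC _ ((hu 0).small τ (Ioo_subset_Icc_self hτ))
        _ = _ := by ring
    rw [e]
    refine ENNReal.add_ne_top.2 ⟨?_, ?_⟩
    · exact ne_top_of_le_ne_top ENNReal.ofReal_ne_top
        ((hu 0).small 0 ⟨le_rfl, ht.1.trans ht.2⟩)
    · refine ne_top_of_le_ne_top ?_ h2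
      rw [lintegral_const_mul' _ _ (by simp)]
      exact ENNReal.mul_ne_top (by simp) hi.ne
  have key := tendsto_lintegral_filter_of_dominated_convergence (μ := Measure.count)
    (l := 𝓝[Icc 0 T] t)
    (F := fun r k => ENNReal.ofReal (wt s k) * ‖u r k - u t k‖ₑ ^ 2) (f := fun _ => 0)
    (fun k => 4 * d k) (Eventually.of_forall fun r => measurable_of_countable _)
    (eventually_nhdsWithin_of_forall fun r hr => ae_of_all _ fun k => by
      calc ENNReal.ofReal (wt s k) * ‖u r k - u t k‖ₑ ^ 2
          ≤ ENNReal.ofReal (wt s k) * (2 * (‖u r k‖ₑ ^ 2 + ‖u t k‖ₑ ^ 2)) := by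
            gcongr
            exact (pow_le_pow_left' enorm_sub_le 2).trans (add_sq_le_two _ _)
        _ = 2 * (ENNReal.ofReal (wt s k) * ‖u r k‖ₑ ^ 2 +
              ENNReal.ofReal (wt s k) * ‖u t k‖ₑ ^ 2) := by ring
        _ ≤ 2 * (d k + d k) := by gcongr <;> apply hdle <;> assumption
        _ = 4 * d k := by ring)
    (by rw [lintegral_count, ENNReal.tsum_mul_left]; exact ENNReal.mul_ne_top (by simp) hdsum)
    (ae_of_all _ fun k => by
      have h1 : Tendsto (fun r => u r k - u t k) (𝓝[Icc 0 T] t) (𝓝 0) := by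
        simpa using ((continuousOn_of_isApprox hu k) t ht).sub_const (u t k)
      have h2 := (ENNReal.continuous_pow 2).continuousAt.tendsto.comp h1.enorm
      have h3 := ENNReal.Tendsto.const_mul (a := ENNReal.ofReal (wt s k)) h2
        (Or.inr ENNReal.ofReal_ne_top)
      simpa using h3)
  simp only [lintegral_count, tsum_zero] at key
  exact key

/-! ### Fourier analysis on the torus -/

theorem Smooth.continuous {E : Type*} [NormedAddCommGroup E] [NormedSpace ℝ E] {f : Torus → E}
    (hf : Smooth f) : Continuous f :=
  (QuotientAddGroup.isQuotientMap_mk (N := AddSubgroup.zmultiples (2 * Real.pi))).continuous_iff.2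
    (ContDiff.continuous hf)

theorem dx_coe (φ : Torus → ℂ) (x : ℝ) : dx φ (x : Torus) = deriv (fun y : ℝ => φ (y : Torus)) x := by
  have h := deriv_comp_const_add (f := fun y : ℝ => φ (y : Torus)) x 0
  simp only [add_zero] at h
  rw [← h]
  simp [dx]

theorem Smooth.dx {φ : Torus → ℂ} (hφ : Smooth φ) : Smooth (dx φ) := by
  have : (fun x : ℝ => BenjaminOno.dx φ (x : Torus)) = deriv (fun y : ℝ => φ (y : Torus)) :=
    funext (dx_coe φ)
  rw [Smooth, this]
  exact (contDiff_infty_iff_deriv.1 hφ).2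

theorem Smooth.sub {φ ψ : Torus → ℂ} (hφ : Smooth φ) (hψ : Smooth ψ) :
    Smooth (fun x => φ x - ψ x) := ContDiff.sub hφ hψ

theorem smooth_fourier (k : ℤ) : Smooth (fun x : Torus => fourier k x) := by
  have : (fun x : ℝ => fourier k (x : Torus)) =
      fun x : ℝ => Complex.exp (Complex.I * k * x) := by
    funext x
    rw [fourier_coe_apply]
    congr 1
    have : (Real.pi : ℂ) ≠ 0 := by exact_mod_cast Real.pi_ne_zero
    push_cast
    field_simp
  rw [Smooth, this]
  exact (contDiff_const.mul Complex.ofRealCLM.contDiff).cexp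

theorem fourierCoeff_dx {φ : Torus → ℂ} (hφ : Smooth φ) (k : ℤ) :
    fourierCoeff (dx φ) k = Complex.I * k * fourierCoeff φ k := by
  have h1 : ∀ x : ℝ, HasDerivAt (fun y : ℝ => φ (y : Torus)) (dx φ (x : Torus)) x := fun x => by
    rw [dx_coe]
    exact ((contDiff_infty_iff_deriv.1 hφ).1 x).hasDerivAt
  have h2 : ∀ x : ℝ, HasDerivAt (fun y : ℝ => fourier (-k) (y : Torus))
      (-(Complex.I * k) * fourier (-k) (x : Torus)) x := fun x => by
    convert hasDerivAt_fourier (2 * Real.pi) (-k) x using 1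
    have : (Real.pi : ℂ) ≠ 0 := by exact_mod_cast Real.pi_ne_zero
    push_cast
    field_simp
  have c1 : Continuous fun x : ℝ => φ (x : Torus) := ContDiff.continuous hφ
  have c2 : Continuous fun x : ℝ => dx φ (x : Torus) := ContDiff.continuous hφ.dx
  have c3 : Continuous fun x : ℝ => (fourier (-k) (x : Torus) : ℂ) :=
    continuous_iff_continuousAt.2 fun x => (h2 x).continuousAt
  have h3 := intervalIntegral.integral_mul_deriv_eq_deriv_mul (a := 0) (b := 0 + 2 * Real.pi)
    (fun x _ => h2 x) (fun x _ => h1 x) (by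
      exact (Continuous.intervalIntegrable (by fun_prop) _ _)) (c2.intervalIntegrable _ _)
  rw [fourierCoeff_eq_intervalIntegral _ k 0, fourierCoeff_eq_intervalIntegral _ k 0]
  simp only [smul_eq_mul]
  rw [h3]
  have h4 : ((0 + 2 * Real.pi : ℝ) : Torus) = ((0 : ℝ) : Torus) := by
    simp [AddCircle.coe_period]
  rw [h4]
  simp only [mul_assoc, intervalIntegral.integral_const_mul, neg_mul, sub_self, zero_sub,
    intervalIntegral.integral_neg, neg_neg]
  simp only [Complex.real_smul]
  ring

theorem norm_fourierCoeff_le {φ : Torus → ℂ} {C : ℝ} (h : ∀ x, ‖φ x‖ ≤ C) (k : ℤ) :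
    ‖fourierCoeff φ k‖ ≤ C := by
  rw [fourierCoeff]
  refine (norm_integral_le_of_norm_le_const (C := C) (ae_of_all _ fun x => ?_)).trans ?_
  · rw [norm_smul, fourier_apply, Circle.norm_coe, one_mul]
    exact h x
  · simp

theorem exists_norm_fourierCoeff_le (n : ℕ) : ∀ {φ : Torus → ℂ}, Smooth φ →
    ∃ C, 0 ≤ C ∧ ∀ k, ‖fourierCoeff φ k‖ ≤ C * wt (-(n : ℝ)) k := by
  induction n with
  | zero =>
    intro φ hφ
    obtain ⟨C, hC⟩ := isCompact_univ.exists_bound_of_continuousOn hφ.continuous.continuousOn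
    refine ⟨max C 0, le_max_right _ _, fun k => ?_⟩
    simp only [Nat.cast_zero, neg_zero, wt_zero, mul_one]
    exact norm_fourierCoeff_le (fun x => (hC x trivial).trans (le_max_left _ _)) k
  | succ n ih =>
    intro φ hφ
    -- Each application of `1 - ∂²` multiplies the coefficients by `1 + k²`.
    obtain ⟨C, hC, h⟩ := ih (hφ.sub hφ.dx.dx)
    refine ⟨C, hC, fun k => ?_⟩
    have hI : ∀ {ψ : Torus → ℂ}, Smooth ψ → Integrable ψ AddCircle.haarAddCircle := fun hψ =>
      hψ.continuous.integrable_of_hasCompactSupport (HasCompactSupport.of_compactSpace _)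
    have e : fourierCoeff (fun x => φ x - dx (dx φ) x) k = wt 1 k * fourierCoeff φ k := by
      have := congrFun (fourierCoeff.add (hI hφ) ((hI hφ.dx.dx).const_mul (-1))) k
      rw [Pi.add_apply, fourierCoeff.const_mul, fourierCoeff_dx hφ.dx, fourierCoeff_dx hφ] at this
      convert this using 1
      · congr 1
        funext x
        simp [sub_eq_add_neg]
      · rw [wt_one]
        push_cast
        linear_combination ((k : ℂ) ^ 2 * fourierCoeff φ k) * Complex.I_sq
    have h1 := h k
    rw [e, norm_mul, Complex.norm_real, Real.norm_of_nonneg (wt_nonneg _ _)] at h1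
    have h2 : wt (-((n + 1 : ℕ) : ℝ)) k = wt (-1) k * wt (-(n : ℝ)) k := by
      rw [wt_mul]
      congr 1
      push_cast
      ring
    have h3 : wt (-1) k * wt 1 k = 1 := by rw [wt_mul]; simp
    rw [h2]
    have h4 := mul_le_mul_of_nonneg_left h1 (wt_nonneg (-1) k)
    rw [← mul_assoc, h3, one_mul] at h4
    linarith

/-- The Fourier coefficients of a smooth function decay at least like `|k|^{-8}`. -/
theorem Smooth.decay {φ : Torus → ℂ} (hφ : Smooth φ) : Decay (fourierCoeff φ) := by
  obtain ⟨C, hC, h⟩ := exists_norm_fourierCoeff_le 4 hφ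
  exact ⟨C, hC, by exact_mod_cast h⟩

theorem Decay.summable {c : ℤ → ℂ} (hc : Decay c) : Summable c := by
  obtain ⟨C, -, h⟩ := hc
  exact Summable.of_norm_bounded ((summable_wt (σ := 4) (by norm_num)).mul_left C) h

/-- Bilinear form of **Parseval's identity**. -/
theorem hasSum_fourierCoeff_mul {f g : Torus → ℂ} (hf : MemLp f 2 AddCircle.haarAddCircle)
    (hg : MemLp g 2 AddCircle.haarAddCircle) :
    HasSum (fun k : ℤ => fourierCoeff f (-k) * fourierCoeff g k)
      (∫ x, f x * g x ∂AddCircle.haarAddCircle) := by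
  have hs := (hf.star)
  have h := HilbertBasis.hasSum_inner_mul_inner fourierBasis hs.toLp hg.toLp
  have e1 : ∀ k, inner ℂ (fourierBasis k) hg.toLp = fourierCoeff g k := fun k => by
    rw [← HilbertBasis.repr_apply_apply, fourierBasis_repr, fourierCoeff_congr_ae hg.coeFn_toLp]
  have e2 : ∀ k, inner ℂ hs.toLp (fourierBasis k) = fourierCoeff f (-k) := fun k => by
    rw [← inner_conj_symm, ← HilbertBasis.repr_apply_apply, fourierBasis_repr,
      fourierCoeff_congr_ae hs.coeFn_toLp, fourierCoeff, fourierCoeff, ← integral_conj]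
    congr 1
    funext x
    simp only [smul_eq_mul, map_mul, ← fourier_neg, neg_neg]
    simp
  simp only [e1, e2] at h
  refine (congrArg (HasSum _) ?_).mp h
  rw [L2.inner_def]
  refine integral_congr_ae ?_
  filter_upwards [hs.coeFn_toLp, hg.coeFn_toLp] with x hx hy
  rw [hx, hy]
  simp [RCLike.inner_apply, mul_comm]

/-- Parseval's identity with `f` replaced by `e^{-ikx} f`, whose coefficients are shifted by `k`. -/
theorem hasSum_fourierCoeff_mul_apply {f g : Torus → ℂ}
    (hf : MemLp f 2 AddCircle.haarAddCircle) (hg : MemLp g 2 AddCircle.haarAddCircle) (k : ℤ) :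
    HasSum (fun j : ℤ => fourierCoeff f (k - j) * fourierCoeff g j)
      (fourierCoeff (fun x => f x * g x) k) := by
  have hf' : MemLp (fun x => fourier (-k) x * f x) 2 AddCircle.haarAddCircle := by
    refine MemLp.of_le hf (((map_continuous (fourier (-k))).aestronglyMeasurable).mul hf.1)
      (ae_of_all _ fun x => ?_)
    rw [norm_mul, fourier_apply, Circle.norm_coe, one_mul]
  convert hasSum_fourierCoeff_mul hf' hg using 1
  · funext j
    congr 1
    simp only [fourierCoeff, smul_eq_mul, ← mul_assoc, ← fourier_add]
    congr 2
    funext x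
    congr 3
    ring
  · simp only [fourierCoeff, smul_eq_mul, mul_assoc]

theorem fourierCoeff_mul {f g : Torus → ℂ}
    (hf : MemLp f 2 AddCircle.haarAddCircle) (hg : MemLp g 2 AddCircle.haarAddCircle) (k : ℤ) :
    fourierCoeff (fun x => f x * g x) k = conv (fourierCoeff f) (fourierCoeff g) k :=
  (hasSum_fourierCoeff_mul_apply hf hg k).tsum_eq.symm

lemma hasSum_of_eq {f g : ℤ → ℂ} {x y : ℂ} (h : HasSum f x) (hf : ∀ k, g k = f k) (hx : y = x) :
    HasSum g y := by
  rw [hx, funext hf]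
  exact h

lemma norm_fourier_apply (k : ℤ) (x : Torus) : ‖(fourier k x : ℂ)‖ = 1 := by
  rw [fourier_apply, Circle.norm_coe]

lemma memLp_haar_of_continuous {f : Torus → ℂ} (hf : Continuous f) :
    MemLp f 2 AddCircle.haarAddCircle := by
  obtain ⟨C, hC⟩ := isCompact_univ.exists_bound_of_continuousOn hf.continuousOn
  exact MemLp.of_bound hf.aestronglyMeasurable C (ae_of_all _ fun x => hC x trivial)

/-- The sum of an absolutely convergent trigonometric series. -/
def trigSeries (c : ℤ → ℂ) (x : Torus) : ℂ := ∑' k : ℤ, c k * fourier k x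

lemma continuous_trigSeries {c : ℤ → ℂ} (hc : Summable c) : Continuous (trigSeries c) := by
  refine continuous_tsum (fun k => continuous_const.mul (map_continuous (fourier k)))
    hc.norm fun k x => ?_
  rw [norm_mul, norm_fourier_apply, mul_one]

lemma hasSum_integral_mul_trigSeries {f : Torus → ℂ} (hf : Integrable f AddCircle.haarAddCircle)
    {c : ℤ → ℂ} (hc : Summable c) :
    HasSum (fun k => c k * fourierCoeff f (-k))
      (∫ x, f x * trigSeries c x ∂AddCircle.haarAddCircle) := by
  have hb : ∀ k x, ‖f x * (c k * fourier k x)‖ = ‖f x‖ * ‖c k‖ := fun k x => by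
    rw [norm_mul, norm_mul, norm_fourier_apply, mul_one]
  have h := hasSum_integral_of_dominated_convergence (μ := AddCircle.haarAddCircle)
    (F := fun (k : ℤ) (x : Torus) => f x * (c k * fourier k x))
    (f := fun x => f x * trigSeries c x) (fun k x => ‖f x‖ * ‖c k‖)
    (fun k => hf.1.mul (by
      exact (continuous_const.mul (map_continuous (fourier k))).aestronglyMeasurable))
    (fun k => ae_of_all _ fun x => (hb k x).le)
    (ae_of_all _ fun x => hc.norm.mul_left _)
    (by simp only [tsum_mul_left]; exact hf.norm.mul_const _)
    (ae_of_all _ fun x => by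
      refine HasSum.mul_left _ (Summable.hasSum (Summable.of_norm ?_))
      refine hc.norm.congr fun k => ?_
      rw [norm_mul, norm_fourier_apply, mul_one])
  refine hasSum_of_eq h (fun k => ?_) rfl
  simp only [fourierCoeff, neg_neg, smul_eq_mul]
  rw [← integral_const_mul]
  congr 1
  funext x
  ring

lemma fourierCoeff_trigSeries {c : ℤ → ℂ} (hc : Summable c) (m : ℤ) :
    fourierCoeff (trigSeries c) m = c m := by
  have hi : Integrable (fun x : Torus => (fourier (-m) x : ℂ)) AddCircle.haarAddCircle :=
    (memLp_haar_of_continuous (map_continuous (fourier (-m)))).integrable (by norm_num)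
  have h := hasSum_integral_mul_trigSeries hi hc
  have e : ∀ k, c k * fourierCoeff (fun x : Torus => (fourier (-m) x : ℂ)) (-k) =
      if k = m then c m else 0 := fun k => by
    have : fourierCoeff (fun x : Torus => (fourier (-m) x : ℂ)) = Pi.single (-m) 1 :=
      fourierCoeff_fourier (-m)
    rw [this, Pi.single_apply]
    by_cases hk : k = m <;> simp [hk]
  simp only [e] at h
  have h2 := hasSum_ite_eq m (c m)
  exact h.unique h2

lemma Smooth.eq_trigSeries {φ : Torus → ℂ} (hφ : Smooth φ) :
    φ = trigSeries (fourierCoeff φ) := by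
  funext x
  have h := has_pointwise_sum_fourier_series_of_summable
    (f := (⟨φ, hφ.continuous⟩ : C(Torus, ℂ))) hφ.decay.summable x
  exact h.tsum_eq.symm

lemma pairing_eq (f : Torus → ℝ) (φ : Torus → ℂ) :
    pairing f φ = 2 * Real.pi * ∫ x, (f x : ℂ) * φ x ∂AddCircle.haarAddCircle := by
  rw [pairing, AddCircle.integral_haarAddCircle, Complex.real_smul]
  push_cast
  have : (Real.pi : ℂ) ≠ 0 := by exact_mod_cast Real.pi_ne_zero
  field_simp

lemma memLp_L2 (U : L2) : MemLp (fun x => ((U x : ℝ) : ℂ)) 2 AddCircle.haarAddCircle :=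
  memLp_haarAddCircle_iff.2 (Lp.memLp U).ofReal

lemma integrable_sq_L2 (U : L2) :
    Integrable (fun x => (((U x) ^ 2 / 2 : ℝ) : ℂ)) AddCircle.haarAddCircle := by
  have h := (memLp_L2 U).integrable_mul (memLp_L2 U)
  refine (h.mul_const (1 / 2)).congr (ae_of_all _ fun x => ?_)
  simp only [Pi.mul_apply]
  push_cast
  ring

lemma coeff_sq (U : L2) (k : ℤ) :
    fourierCoeff (fun x => (((U x) ^ 2 / 2 : ℝ) : ℂ)) k =
      conv (coeff U) (coeff U) k / 2 := by
  have h := fourierCoeff_mul (memLp_L2 U) (memLp_L2 U) k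
  have e : (fun x => (((U x) ^ 2 / 2 : ℝ) : ℂ)) =
      fun x => (1 / 2 : ℂ) * (((U x : ℝ) : ℂ) * ((U x : ℝ) : ℂ)) := by
    funext x
    push_cast
    ring
  rw [e, fourierCoeff.const_mul, h]
  change 1 / 2 * conv (coeff U) (coeff U) k = _
  ring

lemma hasSum_fourierCoeff_G {a : Torus → ℝ} (ha : Continuous a) {ψ : Torus → ℂ}
    (hψ : Continuous ψ) (k : ℤ) :
    HasSum (fun j => gmat (fourierCoeff fun x => (a x : ℂ)) k j * fourierCoeff ψ j)
      (fourierCoeff (G a ψ) k) := by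
  have ha' : Continuous fun x => (a x : ℂ) := Complex.continuous_ofReal.comp ha
  have h1 := hasSum_fourierCoeff_mul_apply (memLp_haar_of_continuous ha')
    (memLp_haar_of_continuous hψ) k
  have h2 := hasSum_fourierCoeff_mul (memLp_haar_of_continuous ha') (memLp_haar_of_continuous hψ)
  set A := fourierCoeff fun x => (a x : ℂ) with hA
  have h3 := h1.sub (h2.mul_left (2 * Real.pi * A k))
  refine hasSum_of_eq h3 (fun j => ?_) ?_
  · simp only [gmat]
    ring
  · have e : G a ψ = (fun x => (a x : ℂ) * ψ x) +
        fun x => (-∫ y : Torus, (a y : ℂ) * ψ y) * (a x : ℂ) := by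
      funext x
      simp only [G, Pi.add_apply]
      ring
    have hp := pairing_eq a ψ
    rw [pairing] at hp
    rw [e, fourierCoeff.add, Pi.add_apply, fourierCoeff.const_mul, hp, ← hA]
    · ring
    · exact (memLp_haar_of_continuous (ha'.mul hψ)).integrable (by norm_num)
    · exact (memLp_haar_of_continuous (continuous_const.mul ha')).integrable (by norm_num)

lemma G_continuous {a : Torus → ℝ} (ha : Continuous a) {ψ : Torus → ℂ}
    (hψ : Continuous ψ) : Continuous (G a ψ) :=
  (Complex.continuous_ofReal.comp ha).mul (hψ.sub continuous_const)

lemma hasSum_tsum_comm {F : ℤ → ℤ → ℂ} {C : ℝ}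
    (hF : ∀ k l, ‖F k l‖ ≤ C * (wt (-1) k * wt (-1) l)) :
    HasSum (fun l => ∑' k, F k l) (∑' k, ∑' l, F k l) := by
  have hs : Summable (Function.uncurry F) := by
    refine Summable.of_norm_bounded ((summable_wt_neg_one.mul_of_nonneg summable_wt_neg_one
      (wt_nonneg _) (wt_nonneg _)).mul_left C) fun p => hF p.1 p.2
  have h := hs.tsum_comm
  rw [← h]
  exact hs.prod_symm.prod.hasSum

lemma Decay.exists_norm_gmat_mul_le {A c : ℤ → ℂ} (hA : Decay A) (hc : Decay c) :
    ∃ C, 0 ≤ C ∧ ∀ k, ‖∑' j, gmat A k j * c j‖ ≤ C * wt (-3) k := by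
  obtain ⟨C, hC, h⟩ := gmat_bound hA
  obtain ⟨C', hC', h'⟩ := hc
  have hM := wtMass_nonneg
  refine ⟨C * C' * 2 ^ (3 : ℝ) * wtMass, by positivity, fun k => ?_⟩
  have hb : ∀ j, ‖gmat A k j * c j‖ ≤ (C * C' * 2 ^ (3 : ℝ) * wt (-3) k) * wt (-1) j := fun j => by
    have h1 := wt_neg_mul_le (r := 3) (by norm_num) k j 0
    simp only [sub_zero] at h1
    have h2 := wt_mul (-3) (-1) j
    norm_num at h2
    have h3 := wt_mono (show (-4 : ℝ) ≤ -3 by norm_num) (k - j)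
    have p1 := wt_nonneg (-3) j
    have p2 := wt_nonneg (-1) j
    have p3 := wt_nonneg (-4) j
    have p4 := wt_nonneg (-4) (k - j)
    rw [norm_mul]
    calc ‖gmat A k j‖ * ‖c j‖ ≤ (C * wt (-4) (k - j)) * (C' * wt (-4) j) :=
          mul_le_mul (h k j) (h' j) (norm_nonneg _) (by positivity)
      _ = (C * C' * wt (-1) j) * (wt (-4) (k - j) * wt (-3) j) := by rw [← h2]; ring
      _ ≤ (C * C' * wt (-1) j) * (2 ^ (3 : ℝ) * wt (-3) k) := by
          refine mul_le_mul_of_nonneg_left (le_trans ?_ h1) (by positivity)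
          exact mul_le_mul_of_nonneg_right h3 p1
      _ = _ := by ring
  refine (tsum_of_norm_bounded (summable_wt_neg_one.mul_left _).hasSum hb).trans (le_of_eq ?_)
  rw [tsum_mul_left, wtMass]
  ring

lemma gmat_neg (A : ℤ → ℂ) (k j : ℤ) : gmat A (-k) (-j) = gmat A j k := by
  simp only [gmat, neg_neg]
  rw [show -k - -j = j - k by ring]
  ring

/-- The symmetry of `G D G` for the bilinear pairing `∫ f g`, which couples mode `k` with mode `-k`.
-/
lemma dampMat_neg (A : ℤ → ℂ) (k j : ℤ) : dampMat A (-k) (-j) = dampMat A j k := by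
  rw [dampMat, ← (Equiv.neg ℤ).tsum_eq, dampMat]
  congr 1
  funext l
  simp only [Equiv.neg_apply, gmat_neg]
  push_cast
  rw [abs_neg]
  ring

/-- The Fourier coefficients of `G D G φ`. -/
lemma fourierCoeff_G_absD_G {a : Torus → ℝ} (ha : Smooth a)
    (hA : Decay (fourierCoeff fun x => (a x : ℂ))) {φ : Torus → ℂ} (hφ : Smooth φ) :
    Continuous (G a (absD (G a φ))) ∧ ∀ k, fourierCoeff (G a (absD (G a φ))) k =
      ∑' l, dampMat (fourierCoeff fun x => (a x : ℂ)) k l * fourierCoeff φ l := by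
  set A := fourierCoeff fun x => (a x : ℂ) with hAdef
  obtain ⟨C, hC, hc⟩ := hA.exists_norm_gmat_mul_le hφ.decay
  have e1 : ∀ k, fourierCoeff (G a φ) k = ∑' j, gmat A k j * fourierCoeff φ j := fun k =>
    (hasSum_fourierCoeff_G ha.continuous hφ.continuous k).tsum_eq.symm
  have hs : Summable fun k : ℤ => ((|k| : ℤ) : ℂ) * fourierCoeff (G a φ) k := by
    refine Summable.of_norm_bounded (summable_wt_neg_one.mul_left C) fun k => ?_
    have h1 : ‖((|k| : ℤ) : ℂ)‖ = |(k : ℝ)| := by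
      rw [Complex.norm_intCast]
      push_cast
      rw [abs_abs]
    rw [norm_mul, h1, e1]
    have p := wt_nonneg (-3) k
    calc |(k : ℝ)| * ‖∑' j, gmat A k j * fourierCoeff φ j‖
        ≤ wt (1 / 2) k * (C * wt (-3) k) :=
          mul_le_mul (abs_le_wt k) (hc k) (norm_nonneg _) (wt_nonneg _ _)
      _ = C * wt (1 / 2 + -3) k := by rw [← wt_mul]; ring
      _ ≤ C * wt (-1) k := mul_le_mul_of_nonneg_left (wt_mono (by norm_num) k) hC
  have hcont : Continuous (absD (G a φ)) := continuous_trigSeries hs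
  have e2 : ∀ j : ℤ, fourierCoeff (absD (G a φ)) j = ((|j| : ℤ) : ℂ) * fourierCoeff (G a φ) j :=
    fun j => fourierCoeff_trigSeries hs j
  refine ⟨G_continuous ha.continuous hcont, fun k => ?_⟩
  rw [← (hasSum_fourierCoeff_G ha.continuous hcont k).tsum_eq]
  obtain ⟨C₁, hC₁, hg⟩ := gmat_bound hA
  obtain ⟨C₂, hC₂, hφd⟩ := hφ.decay
  have key := hasSum_tsum_comm (F := fun j l => gmat A k j * (((|j| : ℤ) : ℂ) *
    (gmat A j l * fourierCoeff φ l))) (C := C₁ * C₁ * C₂ * 2 ^ (3 : ℝ)) (fun j l => by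
      have h1 : ‖((|j| : ℤ) : ℂ)‖ = |(j : ℝ)| := by
        rw [Complex.norm_intCast]
        push_cast
        rw [abs_abs]
      have h2 : ‖gmat A k j‖ ≤ C₁ := by
        refine (hg k j).trans ?_
        have : wt (-4) (k - j) ≤ 1 := by
          simpa using wt_mono (show (-4 : ℝ) ≤ 0 by norm_num) (k - j)
        nlinarith
      have h3 := wt_neg_mul_le (r := 3) (by norm_num) j l 0
      simp only [sub_zero] at h3
      have h4 := wt_mul (-3) (-1) l
      norm_num at h4
      have h5 := wt_mono (show (-4 : ℝ) ≤ -3 by norm_num) (j - l)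
      have p0 := wt_nonneg (-3) (j - l)
      have p1 := wt_nonneg (-3) l
      have p2 := wt_nonneg (-1) l
      have p3 := wt_nonneg (-4) l
      have p4 := wt_nonneg (-4) (j - l)
      have p5 := wt_nonneg (1 / 2) j
      have h6 : wt (1 / 2) j * wt (-3) j ≤ wt (-1) j := by
        rw [wt_mul]; exact wt_mono (by norm_num) j
      rw [norm_mul, norm_mul, norm_mul, h1]
      calc ‖gmat A k j‖ * (|(j : ℝ)| * (‖gmat A j l‖ * ‖fourierCoeff φ l‖))
          ≤ C₁ * (wt (1 / 2) j * ((C₁ * wt (-4) (j - l)) * (C₂ * wt (-4) l))) := by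
            have := abs_le_wt j
            have := hg j l
            have := hφd l
            gcongr
        _ = (C₁ * C₁ * C₂ * wt (-1) l * wt (1 / 2) j) * (wt (-4) (j - l) * wt (-3) l) := by
            rw [← h4]; ring
        _ ≤ (C₁ * C₁ * C₂ * wt (-1) l * wt (1 / 2) j) * (2 ^ (3 : ℝ) * wt (-3) j) := by
            refine mul_le_mul_of_nonneg_left (le_trans ?_ h3) (by positivity)
            exact mul_le_mul_of_nonneg_right h5 p1
        _ = (C₁ * C₁ * C₂ * 2 ^ (3 : ℝ) * wt (-1) l) * (wt (1 / 2) j * wt (-3) j) := by ring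
        _ ≤ (C₁ * C₁ * C₂ * 2 ^ (3 : ℝ) * wt (-1) l) * wt (-1) j :=
            mul_le_mul_of_nonneg_left h6 (by positivity)
        _ = _ := by ring)
  have e3 : ∀ j, gmat A k j * fourierCoeff (absD (G a φ)) j =
      ∑' l, gmat A k j * (((|j| : ℤ) : ℂ) * (gmat A j l * fourierCoeff φ l)) := fun j => by
    rw [e2, e1, tsum_mul_left, tsum_mul_left]
  rw [tsum_congr e3, ← key.tsum_eq]
  congr 1
  funext l
  rw [dampMat, ← tsum_mul_right]
  congr 1
  funext j
  rw [show ((|j| : ℤ) : ℂ) = ((|(j : ℝ)| : ℝ) : ℂ) by rw [← Int.cast_abs, Complex.ofReal_intCast]]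
  ring

/-- The damping operator, moved onto the Fourier side. -/
lemma hasSum_pairing_damping {a : Torus → ℝ} (ha : Smooth a)
    (hA : Decay (fourierCoeff fun x => (a x : ℂ))) {s η : ℝ} (hs0 : 0 ≤ s) (hη : 0 ≤ η) {U : L2}
    (hU : hs s (coeff U) ≤ ENNReal.ofReal (η ^ 2)) {φ : Torus → ℂ} (hφ : Smooth φ) :
    HasSum (fun k => fourierCoeff φ k * damp (fourierCoeff fun x => (a x : ℂ)) (coeff U) (-k))
      (∫ x, (U x : ℂ) * G a (absD (G a φ)) x ∂AddCircle.haarAddCircle) := by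
  obtain ⟨hcont, hcoef⟩ := fourierCoeff_G_absD_G ha hA hφ
  set A := fourierCoeff fun x => (a x : ℂ) with hAdef
  have h1 := hasSum_fourierCoeff_mul (memLp_L2 U) (memLp_haar_of_continuous hcont)
  rw [← h1.tsum_eq]
  obtain ⟨C₁, hC₁, hg⟩ := dampMat_bound hA
  obtain ⟨C₂, hC₂, hφd⟩ := hφ.decay
  -- The decay of the coefficients of `φ` and of the damping matrix makes the double series
  -- absolutely convergent, so the damping can be transferred from `φ` to `U`.
  have key := hasSum_tsum_comm (F := fun k l => coeff U (-k) * (dampMat A k l * fourierCoeff φ l))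
    (C := η * C₁ * C₂ * 2 ^ (1 : ℝ)) (fun k l => by
      have h2 : ‖coeff U (-k)‖ ≤ η := by
        refine (norm_le_of_hs_le hη hU (-k)).trans ?_
        have : wt (-(s / 2)) (-k) ≤ 1 := by
          simpa using wt_mono (show -(s / 2) ≤ 0 by linarith) (-k)
        nlinarith
      have h3 := wt_neg_mul_le (r := 1) (by norm_num) k l 0
      simp only [sub_zero] at h3
      have h5 := wt_mono (show (-3 : ℝ) ≤ -1 by norm_num) (k - l)
      have h6 : wt (1 / 2) l * wt (-4) l ≤ wt (-1) l * wt (-1) l := by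
        rw [wt_mul, wt_mul]; exact wt_mono (by norm_num) l
      have p0 := wt_nonneg (-3) (k - l)
      have p1 := wt_nonneg (-1) l
      have p2 := wt_nonneg (1 / 2) l
      have p3 := wt_nonneg (-4) l
      have p4 := wt_nonneg (-1) (k - l)
      rw [norm_mul, norm_mul]
      calc ‖coeff U (-k)‖ * (‖dampMat A k l‖ * ‖fourierCoeff φ l‖)
          ≤ η * ((C₁ * wt (-3) (k - l) * wt (1 / 2) l) * (C₂ * wt (-4) l)) := by
            have := hg k l
            have := hφd l
            gcongr
        _ = (η * C₁ * C₂) * (wt (-3) (k - l) * (wt (1 / 2) l * wt (-4) l)) := by ring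
        _ ≤ (η * C₁ * C₂) * (wt (-1) (k - l) * (wt (-1) l * wt (-1) l)) := by gcongr
        _ = (η * C₁ * C₂ * wt (-1) l) * (wt (-1) (k - l) * wt (-1) l) := by ring
        _ ≤ (η * C₁ * C₂ * wt (-1) l) * (2 ^ (1 : ℝ) * wt (-1) k) :=
            mul_le_mul_of_nonneg_left h3 (by positivity)
        _ = _ := by ring)
  refine hasSum_of_eq key (fun l => ?_) ?_
  · rw [damp, ← (Equiv.neg ℤ).tsum_eq, ← tsum_mul_left]
    congr 1
    funext k
    simp only [Equiv.neg_apply, dampMat_neg]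
    ring
  · congr 1
    funext k
    rw [hcoef, tsum_mul_left]
    rfl

lemma hasSum_pairing {U : L2} {φ : Torus → ℂ} (hφ : Smooth φ) :
    HasSum (fun k => 2 * Real.pi * (fourierCoeff φ k * coeff U (-k))) (pairing U φ) := by
  have h := hasSum_integral_mul_trigSeries ((memLp_L2 U).integrable (by norm_num))
    hφ.decay.summable
  rw [← hφ.eq_trigSeries] at h
  rw [pairing_eq]
  exact h.mul_left _

lemma disp_neg (k : ℤ) : disp (-k) = -disp k := by
  simp [disp]

lemma sign_mul_sq (k : ℤ) : ((Int.sign k : ℤ) : ℂ) * (k : ℂ) ^ 2 = ((disp k : ℝ) : ℂ) := by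
  have h : Int.sign k * k ^ 2 = k * |k| := by
    rw [sq, ← mul_assoc, Int.sign_mul_self_eq_abs, mul_comm]
  rw [disp]
  exact_mod_cast congrArg (fun n : ℤ => (n : ℂ)) h

/-- The weak form of the equation on the Fourier side. -/
lemma hasSum_weak_rhs {a : Torus → ℝ} (ha : Smooth a)
    (hA : Decay (fourierCoeff fun x => (a x : ℂ))) {s η : ℝ} (hs0 : 0 ≤ s) (hη : 0 ≤ η) {U : L2}
    (hU : hs s (coeff U) ≤ ENNReal.ofReal (η ^ 2)) {φ : Torus → ℂ} (hφ : Smooth φ) :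
    HasSum (fun k => 2 * Real.pi *
        (fourierCoeff φ k * rhs (fourierCoeff fun x => (a x : ℂ)) (coeff U) (-k)))
      (pairing U (hilbert (dx (dx φ))) + pairing (fun x => (U x) ^ 2 / 2) (dx φ) -
        pairing U (G a (absD (G a φ)))) := by
  have e1 : ∀ k : ℤ, -Complex.I * ((Int.sign k : ℤ) : ℂ) * fourierCoeff (dx (dx φ)) k =
      Complex.I * disp k * fourierCoeff φ k := fun k => by
    rw [fourierCoeff_dx hφ.dx, fourierCoeff_dx hφ, ← sign_mul_sq]
    linear_combination (-Complex.I * ((Int.sign k : ℤ) : ℂ) * k ^ 2 * fourierCoeff φ k) *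
      Complex.I_sq
  have s1 : Summable fun k : ℤ =>
      -Complex.I * ((Int.sign k : ℤ) : ℂ) * fourierCoeff (dx (dx φ)) k := by
    refine Summable.of_norm_bounded hφ.dx.dx.decay.summable.norm fun k => ?_
    rw [norm_mul, norm_mul, norm_neg, Complex.norm_I, one_mul, Complex.norm_intCast]
    refine mul_le_of_le_one_left (norm_nonneg _) ?_
    rcases lt_trichotomy k 0 with h | h | h
    · simp [Int.sign_eq_neg_one_of_neg h]
    · simp [h]
    · simp [Int.sign_eq_one_of_pos h]
  have h1 := hasSum_integral_mul_trigSeries ((memLp_L2 U).integrable (by norm_num)) s1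
  have h2 := hasSum_integral_mul_trigSeries (integrable_sq_L2 U) hφ.dx.decay.summable
  have h3 := hasSum_pairing_damping ha hA hs0 hη hU hφ
  rw [← hφ.dx.eq_trigSeries] at h2
  refine hasSum_of_eq (((h1.add h2).sub h3).mul_left (2 * (Real.pi : ℂ))) (fun k => ?_) ?_
  · rw [e1, fourierCoeff_dx hφ, coeff_sq, rhs, disp_neg]
    change _ = 2 * (Real.pi : ℂ) * (Complex.I * disp k * fourierCoeff φ k * coeff U (-k) + _ - _)
    push_cast
    ring
  · rw [pairing_eq, pairing_eq, pairing_eq]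
    rw [show hilbert (dx (dx φ)) = trigSeries _ from rfl]
    ring

/-! ### Fourier coefficients of real functions -/

lemma Smooth.ofReal {a : Torus → ℝ} (ha : Smooth a) : Smooth fun x => (a x : ℂ) :=
  Complex.ofRealCLM.contDiff.comp ha

lemma fourierCoeff_conj (f : Torus → ℂ) (k : ℤ) :
    fourierCoeff (fun x => conj (f x)) k = conj (fourierCoeff f (-k)) := by
  rw [fourierCoeff, fourierCoeff, ← integral_conj]
  congr 1
  funext x
  simp only [smul_eq_mul, map_mul, ← fourier_neg, neg_neg]

lemma fourierCoeff_ofReal_neg (f : Torus → ℝ) (k : ℤ) :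
    fourierCoeff (fun x => (f x : ℂ)) (-k) = conj (fourierCoeff (fun x => (f x : ℂ)) k) := by
  have h := fourierCoeff_conj (fun x => (f x : ℂ)) (-k)
  simpa using h

lemma fourierCoeff_ofReal_zero {a : Torus → ℝ} (h : ∫ x : Torus, a x = 1) :
    2 * Real.pi * fourierCoeff (fun x => (a x : ℂ)) 0 = 1 := by
  have e : fourierCoeff (fun x => (a x : ℂ)) 0 = ∫ x, (a x : ℂ) ∂AddCircle.haarAddCircle := by
    simp [fourierCoeff]
  rw [e, AddCircle.integral_haarAddCircle, integral_complex_ofReal, h]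
  have : (Real.pi : ℂ) ≠ 0 := by exact_mod_cast Real.pi_ne_zero
  simp
  field_simp

lemma coeff_neg (U : L2) (k : ℤ) : coeff U (-k) = conj (coeff U k) :=
  fourierCoeff_ofReal_neg _ k

lemma ae_haar_iff {p : Torus → Prop} :
    (∀ᵐ x ∂(AddCircle.haarAddCircle : Measure Torus), p x) ↔ ∀ᵐ x : Torus, p x := by
  rw [AddCircle.volume_eq_smul_haarAddCircle, Measure.ae_ennreal_smul_measure_iff]
  simpa using Real.pi_pos

lemma coeff_sub (U V : L2) (k : ℤ) : coeff (U - V) k = coeff U k - coeff V k := by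
  have h : (fun x => ((((U - V : L2) x : ℝ)) : ℂ)) =ᵐ[AddCircle.haarAddCircle]
      (fun x => ((U x : ℝ) : ℂ)) + fun x => (-1 : ℂ) * ((V x : ℝ) : ℂ) := by
    refine ae_haar_iff.2 ?_
    filter_upwards [Lp.coeFn_sub U V] with x hx
    rw [hx]
    simp [sub_eq_add_neg]
  rw [coeff, fourierCoeff_congr_ae h, fourierCoeff.add ((memLp_L2 U).integrable (by norm_num))
    (((memLp_L2 V).integrable (by norm_num)).const_mul _), Pi.add_apply, fourierCoeff.const_mul]
  rw [coeff, coeff]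
  ring

lemma coeff_injective {U V : L2} (h : coeff U = coeff V) : U = V := by
  have h1 : (memLp_L2 U).toLp = (memLp_L2 V).toLp := by
    apply fourierBasis.repr.injective
    ext k
    rw [fourierBasis_repr, fourierBasis_repr, fourierCoeff_congr_ae (memLp_L2 U).coeFn_toLp,
      fourierCoeff_congr_ae (memLp_L2 V).coeFn_toLp]
    exact congrFun h k
  have h2 := (MemLp.toLp_eq_toLp_iff _ _).1 h1
  refine Lp.ext ?_
  filter_upwards [ae_haar_iff.1 h2] with x hx
  exact_mod_cast hx

/-- **Riesz–Fischer** for real-valued functions. -/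
lemma exists_coeff_eq {c : ℤ → ℂ} (hc : ∀ k, c (-k) = conj (c k))
    (hs : Summable fun k => ‖c k‖ ^ 2) : ∃ U : L2, coeff U = c := by
  have hm : Memℓp c 2 := by
    refine memℓp_gen ?_
    simpa using hs
  set F : Lp ℂ 2 (AddCircle.haarAddCircle : Measure Torus) := fourierBasis.repr.symm (⟨c, hm⟩ : lp (fun _ : ℤ => ℂ) 2) with hF
  have hFc : ∀ k, fourierCoeff F k = c k := fun k => by
    rw [← fourierBasis_repr, hF, LinearIsometryEquiv.apply_symm_apply]
  have hFm : MemLp F 2 AddCircle.haarAddCircle := Lp.memLp F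
  -- The Hermitian symmetry of `c` ensures that taking the real part does not change the
  -- coefficients.
  have hre : MemLp (fun x => (F x).re) 2 (volume : Measure Torus) :=
    (memLp_haarAddCircle_iff.1 hFm).re
  refine ⟨hre.toLp, ?_⟩
  funext k
  have h : (fun x => (((MemLp.toLp _ hre : L2) x : ℝ) : ℂ)) =ᵐ[AddCircle.haarAddCircle]
      (fun x => (1 / 2 : ℂ) * F x) + fun x => (1 / 2 : ℂ) * conj (F x) := by
    refine ae_haar_iff.2 ?_
    filter_upwards [hre.coeFn_toLp] with x hx
    rw [hx, Complex.re_eq_add_conj, Pi.add_apply]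
    ring
  rw [coeff, fourierCoeff_congr_ae h, fourierCoeff.add, Pi.add_apply, fourierCoeff.const_mul,
    fourierCoeff.const_mul, fourierCoeff_conj, hFc, hFc, hc, Complex.conj_conj]
  · ring
  · exact (hFm.integrable (by norm_num)).const_mul _
  · exact (hFm.star.integrable (by norm_num)).const_mul _

/-! ### Sobolev norms -/

lemma sobolevNorm_eq (s : ℝ) (U : L2) :
    sobolevNorm s U = (ENNReal.ofReal (2 * Real.pi) * hs s (coeff U)) ^ (1 / 2 : ℝ) := rfl

lemma sobolevNorm_sq (s : ℝ) (U : L2) :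
    sobolevNorm s U ^ 2 = ENNReal.ofReal (2 * Real.pi) * hs s (coeff U) := by
  rw [sobolevNorm_eq, ← ENNReal.rpow_natCast, ← ENNReal.rpow_mul]
  norm_num

lemma hs_le_sobolevNorm_sq (s : ℝ) (U : L2) : hs s (coeff U) ≤ sobolevNorm s U ^ 2 := by
  rw [sobolevNorm_sq]
  refine le_mul_of_one_le_left (zero_le) ?_
  rw [ENNReal.one_le_ofReal]
  linarith [Real.pi_gt_three]

lemma sobolevNorm_lt_top {s : ℝ} {U : L2} (h : hs s (coeff U) < ⊤) : sobolevNorm s U < ⊤ :=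
  ENNReal.rpow_lt_top_of_nonneg (by norm_num)
    (ENNReal.mul_lt_top ENNReal.ofReal_lt_top h).ne

lemma exists_hs_le {s : ℝ} {u : ℤ → ℂ} (h : hs s u < ⊤) :
    ∃ η : ℝ, 0 ≤ η ∧ hs s u ≤ ENNReal.ofReal (η ^ 2) :=
  ⟨√(hs s u).toReal, Real.sqrt_nonneg _, by
    rw [Real.sq_sqrt ENNReal.toReal_nonneg, ENNReal.ofReal_toReal h.ne]⟩

lemma hs_lt_top_of_mem_H0 {s : ℝ} {U : L2} (h : U ∈ H0 s) : hs s (coeff U) < ⊤ :=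
  (hs_le_sobolevNorm_sq s U).trans_lt (ENNReal.pow_lt_top h.1)

lemma enorm_sq_le_hs {s : ℝ} (h0 : 0 ≤ s) (u : ℤ → ℂ) (k : ℤ) : ‖u k‖ₑ ^ 2 ≤ hs s u := by
  refine le_trans ?_ (ENNReal.le_tsum k)
  refine le_mul_of_one_le_left (zero_le) ?_
  rw [ENNReal.one_le_ofReal]
  exact one_le_wt h0 k

/-! ### Symmetries of the Fourier-side equation -/

/-- The sequence of Fourier coefficients of the complex conjugate function. -/
def reflect (u : ℤ → ℂ) (k : ℤ) : ℂ := conj (u (-k))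

lemma hs_reflect (s : ℝ) (u : ℤ → ℂ) : hs s (reflect u) = hs s u := by
  rw [hs, hs, ← (Equiv.neg ℤ).tsum_eq]
  congr 1
  funext k
  simp only [Equiv.neg_apply, reflect, wt_neg_arg, neg_neg]
  rw [← ofReal_norm, ← ofReal_norm, RCLike.norm_conj]

lemma damp_reflect {A : ℤ → ℂ} (hcj : ∀ k, A (-k) = conj (A k)) (u : ℤ → ℂ) (k : ℤ) :
    damp A (reflect u) k = conj (damp A u (-k)) := by
  have hd : ∀ k j, conj (dampMat A k j) = dampMat A j k := fun k j => by
    rw [dampMat, dampMat, Complex.conj_tsum]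
    congr 1
    funext l
    simp only [map_mul, gmat_conj hcj, Complex.conj_ofReal]
    ring
  rw [damp, damp, Complex.conj_tsum, ← (Equiv.neg ℤ).tsum_eq]
  congr 1
  funext j
  simp only [Equiv.neg_apply, reflect, map_mul, hd, neg_neg]
  rw [← dampMat_neg, neg_neg]

lemma conv_reflect (u : ℤ → ℂ) (k : ℤ) :
    conv (reflect u) (reflect u) k = conj (conv u u (-k)) := by
  rw [conv, conv, Complex.conj_tsum, ← (Equiv.neg ℤ).tsum_eq]
  congr 1
  funext j
  simp only [Equiv.neg_apply, reflect, map_mul, neg_neg]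
  congr 3
  ring

lemma rhs_reflect {A : ℤ → ℂ} (hcj : ∀ k, A (-k) = conj (A k)) (u : ℤ → ℂ) (k : ℤ) :
    rhs A (reflect u) k = conj (rhs A u (-k)) := by
  rw [rhs, rhs, damp_reflect hcj, conv_reflect, disp_neg]
  have h2 : conj (2 : ℂ) = 2 := Complex.conj_ofNat 2
  simp [reflect, h2]

lemma IsApprox.reflect {A : ℤ → ℂ} (hcj : ∀ k, A (-k) = conj (A k)) {s κ T : ℝ} {N : ℕ}
    {u : ℝ → ℤ → ℂ} (h : IsApprox A s κ T N u) :
    IsApprox A s κ T N fun t => BenjaminOno.reflect (u t) where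
  small t ht := by rw [hs_reflect]; exact h.small t ht
  deriv k hk t ht := by
    have hk' : -k ∈ modes N := by
      simp only [modes, Finset.mem_Icc] at hk ⊢
      omega
    have h1 := (h.deriv (-k) hk' t ht).star
    rw [rhs_reflect hcj]
    exact h1

lemma IsApprox.restrict {A : ℤ → ℂ} {s κ κ' T T' : ℝ} {N : ℕ} {u : ℝ → ℤ → ℂ}
    (h : IsApprox A s κ T N u) (hκ : 0 ≤ κ) (hκ' : κ ≤ κ') (hT : T' ≤ T) :
    IsApprox A s κ' T' N u where
  small t ht := (h.small t ⟨ht.1, ht.2.trans hT⟩).trans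
    (ENNReal.ofReal_le_ofReal (pow_le_pow_left₀ hκ hκ' 2))
  deriv k hk t ht := (h.deriv k hk t ⟨ht.1, ht.2.trans hT⟩).mono (Icc_subset_Icc_right hT)

/-- With `∫ a = 1` every `G f` has mean zero, and the remaining terms are derivatives; the mean is
therefore conserved. -/
lemma rhs_zero {A : ℤ → ℂ} (h0 : 2 * Real.pi * A 0 = 1) (u : ℤ → ℂ) : rhs A u 0 = 0 := by
  have hg : ∀ l, gmat A 0 l = 0 := fun l => by simp [gmat, h0]
  simp [rhs, damp, dampMat, hg, disp]

/-! ### Solutions and their Fourier modes -/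

/-- Testing against `e^{-ikx}` isolates mode `k`. -/
lemma IsSolution.coeff_eq {a : Torus → ℝ} (ha : Smooth a)
    {s T : ℝ} (hs0 : 0 ≤ s) {u₀ : L2} {v : ℝ → L2} (hfin : ∀ t ∈ Icc 0 T, hs s (coeff (v t)) < ⊤)
    (hv : IsSolution a T u₀ v) (k : ℤ) {t : ℝ} (ht : t ∈ Icc 0 T) :
    coeff (v t) k = coeff u₀ k +
      ∫ τ in (0 : ℝ)..t, rhs (fourierCoeff fun x => (a x : ℂ)) (coeff (v τ)) k := by
  have hA := ha.ofReal.decay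
  have hφ := smooth_fourier (-k)
  have hc : fourierCoeff (fun x : Torus => (fourier (-k) x : ℂ)) = Pi.single (-k) 1 :=
    fourierCoeff_fourier (-k)
  have hpi : (2 * Real.pi : ℂ) ≠ 0 := by exact_mod_cast Real.two_pi_pos.ne'
  have single : ∀ (g : ℤ → ℂ) (x : ℂ), HasSum (fun j => 2 * Real.pi *
      (fourierCoeff (fun x : Torus => (fourier (-k) x : ℂ)) j * g (-j))) x →
      x = 2 * Real.pi * g k := fun g x h => by
    rw [hc] at h
    have e := hasSum_single (f := fun j => 2 * (Real.pi : ℂ) *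
      ((Pi.single (-k) 1 : ℤ → ℂ) j * g (-j))) (-k) (fun j hj => by simp [hj])
    have := h.unique e
    simpa using this
  have h1 : ∀ U : L2, pairing U (fun x => fourier (-k) x) = 2 * Real.pi * coeff U k :=
    fun U => single _ _ (hasSum_pairing hφ)
  have h2 := hv.2 _ hφ t ht
  rw [h1, h1] at h2
  have h3 : ∫ τ in (0 : ℝ)..t, (pairing (v τ) (hilbert (dx (dx fun x => fourier (-k) x)))
      + pairing (fun x => (v τ x) ^ 2 / 2) (dx fun x => fourier (-k) x)
      - pairing (v τ) (G a (absD (G a fun x => fourier (-k) x)))) =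
      ∫ τ in (0 : ℝ)..t, 2 * Real.pi * rhs (fourierCoeff fun x => (a x : ℂ)) (coeff (v τ)) k := by
    refine intervalIntegral.integral_congr fun τ hτ => ?_
    rw [uIcc_of_le ht.1] at hτ
    obtain ⟨η, hη, h⟩ := exists_hs_le (hfin τ ⟨hτ.1, hτ.2.trans ht.2⟩)
    exact single _ _ (hasSum_weak_rhs ha hA hs0 hη h hφ)
  rw [h3, intervalIntegral.integral_const_mul, ← mul_add] at h2
  exact mul_left_cancel₀ hpi h2

/-- Sum the integral equations of the modes against the coefficients of `φ`. These decay faster than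
the right-hand side grows, so sum and time integral may be exchanged. -/
lemma isSolution_of_isApprox {a : Torus → ℝ} (ha : Smooth a) {s κ T : ℝ} (hs1 : 1 / 2 < s)
    (hκ : 0 ≤ κ) {u : ℝ → ℤ → ℂ}
    (hu : ∀ N, IsApprox (fourierCoeff fun x => (a x : ℂ)) s κ T N u) {u₀ : L2}
    (h0 : u 0 = coeff u₀) {V : ℝ → L2} (hT : 0 ≤ T) (hV : ∀ t ∈ Icc 0 T, coeff (V t) = u t) :
    IsSolution a T u₀ V := by
  set A := fourierCoeff fun x => (a x : ℂ) with hAdef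
  have hA : Decay A := ha.ofReal.decay
  refine ⟨coeff_injective ((hV 0 (left_mem_Icc.2 hT)).trans h0), fun φ hφ t ht => ?_⟩
  obtain ⟨R, hR, hRb⟩ := exists_norm_rhs_le hA hs1 hκ
  have hc := continuousOn_of_isApprox hu
  have hcr : ∀ k, ContinuousOn (fun τ => rhs A (u τ) k) (Icc 0 T) := fun k =>
    (hu 0).continuousOn_rhs hA hs1 hκ hc k
  have hsub : Icc 0 t ⊆ Icc 0 T := Icc_subset_Icc_right ht.2
  have hbound : Summable fun k : ℤ => 2 * Real.pi * (‖fourierCoeff φ k‖ * (R * wt 1 k)) := by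
    obtain ⟨C, hC, hφd⟩ := hφ.decay
    refine Summable.mul_left _ (Summable.of_nonneg_of_le (fun k => ?_) (fun k => ?_)
      (summable_wt_neg_one.mul_left (C * R)))
    · exact mul_nonneg (norm_nonneg _) (mul_nonneg hR (wt_nonneg _ _))
    · have p := wt_nonneg 1 k
      calc ‖fourierCoeff φ k‖ * (R * wt 1 k) ≤ C * wt (-4) k * (R * wt 1 k) :=
            mul_le_mul_of_nonneg_right (hφd k) (by positivity)
        _ = C * R * wt (-4 + 1) k := by rw [← wt_mul]; ring
        _ ≤ C * R * wt (-1) k :=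
            mul_le_mul_of_nonneg_left (wt_mono (by norm_num) k) (by positivity)
  have h1 := intervalIntegral.hasSum_integral_of_dominated_convergence (μ := volume)
    (a := 0) (b := t)
    (F := fun (k : ℤ) τ => 2 * (Real.pi : ℂ) * (fourierCoeff φ k * rhs A (u τ) (-k)))
    (f := fun τ => pairing (V τ) (hilbert (dx (dx φ)))
          + pairing (fun x => (V τ x) ^ 2 / 2) (dx φ) - pairing (V τ) (G a (absD (G a φ))))
    (fun k _ => 2 * Real.pi * (‖fourierCoeff φ k‖ * (R * wt 1 k)))
    (fun k => by
      rw [uIoc_of_le ht.1]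
      exact ((continuousOn_const.mul (continuousOn_const.mul ((hcr (-k)).mono
        (Ioc_subset_Icc_self.trans hsub)))).aestronglyMeasurable measurableSet_Ioc))
    (fun k => ae_of_all _ fun τ hτ => by
      rw [uIoc_of_le ht.1] at hτ
      have := hRb (u τ) ((hu 0).small τ (hsub (Ioc_subset_Icc_self hτ))) (-k)
      rw [wt_neg_arg] at this
      rw [norm_mul, norm_mul, norm_mul, Complex.norm_real, Complex.norm_ofNat,
        Real.norm_of_nonneg Real.pi_pos.le]
      gcongr)
    (ae_of_all _ fun τ _ => hbound)
    (by simp)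
    (ae_of_all _ fun τ hτ => by
      rw [uIoc_of_le ht.1] at hτ
      have hτ' := hsub (Ioc_subset_Icc_self hτ)
      have hsm := (hu 0).small τ hτ'
      rw [← hV τ hτ'] at hsm ⊢
      exact hasSum_weak_rhs ha hA (by linarith) hκ hsm hφ)
  have h2 := (hasSum_pairing (U := u₀) hφ).add h1
  refine (hasSum_pairing hφ).unique (hasSum_of_eq h2 (fun k => ?_) rfl)
  rw [intervalIntegral.integral_const_mul, intervalIntegral.integral_const_mul, hV t ht,
    (hu (-k).natAbs).eq_integral hA hs1 hκ hc (mem_modes_natAbs _) ht, h0]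
  ring

lemma ContinuousInH0.tendsto_hs {s T : ℝ} {v : ℝ → L2} (hv : ContinuousInH0 s T v) {t : ℝ}
    (ht : t ∈ Icc 0 T) :
    Tendsto (fun r => hs s fun k => coeff (v r) k - coeff (v t) k) (𝓝[Icc 0 T] t) (𝓝 0) := by
  have h := (ENNReal.continuous_pow 2).continuousAt.tendsto.comp (hv.2 t ht)
  simp only [ne_eq, OfNat.ofNat_ne_zero, not_false_eq_true, zero_pow] at h
  refine tendsto_of_tendsto_of_tendsto_of_le_of_le tendsto_const_nhds h (fun _ => zero_le)
    fun r => ?_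
  have := hs_le_sobolevNorm_sq s (v r - v t)
  rwa [funext (coeff_sub (v r) (v t))] at this

lemma ContinuousInH0.continuousOn_coeff {s T : ℝ} (h0 : 0 ≤ s) {v : ℝ → L2}
    (hv : ContinuousInH0 s T v) (k : ℤ) : ContinuousOn (fun t => coeff (v t) k) (Icc 0 T) := by
  intro t ht
  have h := hv.tendsto_hs ht
  have h1 : Tendsto (fun r => ‖coeff (v r) k - coeff (v t) k‖ₑ ^ 2) (𝓝[Icc 0 T] t) (𝓝 0) :=
    tendsto_of_tendsto_of_tendsto_of_le_of_le tendsto_const_nhds h (fun _ => zero_le)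
      fun r => enorm_sq_le_hs h0 (fun k => coeff (v r) k - coeff (v t) k) k
  have h2 := (ENNReal.continuous_rpow_const (y := (1 / 2 : ℝ))).continuousAt.tendsto.comp h1
  rw [ENNReal.zero_rpow_of_pos (by norm_num)] at h2
  have h3 : Tendsto (fun r => ‖coeff (v r) k - coeff (v t) k‖ₑ) (𝓝[Icc 0 T] t) (𝓝 0) := by
    refine h2.congr fun r => ?_
    simp only [Function.comp_apply]
    rw [← ENNReal.rpow_natCast, ← ENNReal.rpow_mul]
    norm_num
  rw [ContinuousWithinAt, tendsto_iff_edist_tendsto_0]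
  simpa only [edist_eq_enorm_sub] using h3

/-- Every solution that is continuous in `H^s` and starts from small data agrees with the
sequence-level solution, since its norm cannot leave the range where uniqueness holds. -/
lemma eq_of_isSolution {a : Torus → ℝ} (ha : Smooth a) {s κ T : ℝ} (hs1 : 1 / 2 < s) (hκ : 0 < κ)
    (huniq : ∀ (T : ℝ) (u v : ℝ → ℤ → ℂ),
      (∀ N, IsApprox (fourierCoeff fun x => (a x : ℂ)) s κ T N u) →
      (∀ N, IsApprox (fourierCoeff fun x => (a x : ℂ)) s κ T N v) →
        u 0 = v 0 → ∀ t ∈ Icc 0 T, u t = v t)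
    {u : ℝ → ℤ → ℂ} (hu : ∀ N, IsApprox (fourierCoeff fun x => (a x : ℂ)) s (κ / 2) T N u)
    {u₀ : L2} (h0 : u 0 = coeff u₀) {v : ℝ → L2} (hv : ContinuousInH0 s T v)
    (hsol : IsSolution a T u₀ v) : ∀ t ∈ Icc 0 T, coeff (v t) = u t := by
  set A := fourierCoeff fun x => (a x : ℂ) with hAdef
  have hA : Decay A := ha.ofReal.decay
  have hs0 : 0 ≤ s := by linarith
  have hcv := hv.continuousOn_coeff hs0
  have hcu := continuousOn_of_isApprox hu
  have hfin : ∀ t ∈ Icc 0 T, hs s (coeff (v t)) < ⊤ := fun t ht => hs_lt_top_of_mem_H0 (hv.1 t ht)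
  -- Agreement on all of `[0, t]`. The parameter `θ` presents this set, within `[0, T]`, as an
  -- intersection of zero sets of continuous functions, hence closed.
  set S : Set ℝ := {t | ∀ θ ∈ Icc (0 : ℝ) 1, coeff (v (θ * t)) = u (θ * t)} with hS
  have hclosed : IsClosed (S ∩ Icc 0 T) := by
    have e : S ∩ Icc 0 T = Icc 0 T ∩ ⋂ θ ∈ Icc (0 : ℝ) 1, ⋂ k : ℤ, (Icc 0 T ∩
        (fun t => coeff (v (θ * t)) k - u (θ * t) k) ⁻¹' {0}) := by
      ext t
      simp only [hS, mem_inter_iff, mem_ofPred_eq, mem_iInter, mem_preimage, mem_singleton_iff,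
        sub_eq_zero]
      constructor
      · rintro ⟨h, ht⟩
        exact ⟨ht, fun θ hθ k => ⟨ht, congrFun (h θ hθ) k⟩⟩
      · rintro ⟨ht, h⟩
        exact ⟨fun θ hθ => funext fun k => (h θ hθ k).2, ht⟩
    rw [e]
    refine isClosed_Icc.inter (isClosed_biInter fun θ hθ => isClosed_iInter fun k => ?_)
    refine ContinuousOn.preimage_isClosed_of_isClosed ?_ isClosed_Icc isClosed_singleton
    have hm : MapsTo (fun t => θ * t) (Icc 0 T) (Icc 0 T) := fun t ht =>
      ⟨mul_nonneg hθ.1 ht.1, (mul_le_of_le_one_left ht.1 hθ.2).trans ht.2⟩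
    exact (((hcv k).sub (hcu k)).comp (continuous_const.mul continuous_id).continuousOn hm)
  have hv0 : coeff (v 0) = u 0 := by rw [hsol.1, h0]
  have hzero : (0 : ℝ) ∈ S := fun θ _ => by simpa using hv0
  have key : Icc 0 T ⊆ S := by
    refine hclosed.Icc_subset_of_forall_exists_gt hzero ?_
    rintro x ⟨hxS, hx0, hxT⟩ y hy
    have hxI : x ∈ Icc 0 T := ⟨hx0, hxT.le⟩
    have hev : ∀ᶠ r in 𝓝[Icc 0 T] x, hs s (fun k => coeff (v r) k - coeff (v x) k) <
        ENNReal.ofReal ((κ / 2) ^ 2) :=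
      (hv.tendsto_hs hxI).eventually_lt_const (by
        rw [ENNReal.ofReal_pos]
        positivity)
    obtain ⟨δ, hδ, hball⟩ := Metric.mem_nhdsWithin_iff.1 hev
    -- Continuity in `H^s` keeps `v` inside the uniqueness ball up to this time.
    set z := min (min y T) (x + δ / 2) with hz
    have hxz : x < z := lt_min (lt_min hy hxT) (by linarith)
    have hzy : z ≤ y := (min_le_left _ _).trans (min_le_left _ _)
    have hzT : z ≤ T := (min_le_left _ _).trans (min_le_right _ _)
    have hzδ : z ≤ x + δ / 2 := min_le_right _ _
    have hle : ∀ r ∈ Icc 0 x, coeff (v r) = u r := fun r hr => by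
      rcases hx0.eq_or_lt with h | h
      · have : r = 0 := le_antisymm (hr.2.trans h.ge) hr.1
        rw [this, hv0]
      · have := hxS (r / x) ⟨div_nonneg hr.1 h.le, (div_le_one h).2 hr.2⟩
        rwa [div_mul_cancel₀ _ h.ne'] at this
    have hsub : Icc 0 z ⊆ Icc 0 T := Icc_subset_Icc_right hzT
    have hsmall : ∀ r ∈ Icc 0 z, hs s (coeff (v r)) ≤ ENNReal.ofReal (κ ^ 2) := fun r hr => by
      rcases le_or_gt r x with h | h
      · rw [hle r ⟨hr.1, h⟩]
        exact ((hu 0).small r (hsub hr)).trans (ENNReal.ofReal_le_ofReal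
          (pow_le_pow_left₀ (by positivity) (by linarith) 2))
      · have h1 : hs s (fun k => coeff (v r) k - coeff (v x) k) <
            ENNReal.ofReal ((κ / 2) ^ 2) := hball ⟨by
          rw [Metric.mem_ball, Real.dist_eq, abs_of_pos (by linarith)]
          linarith [hr.2], hsub hr⟩
        have h2 : hs s (coeff (v x)) ≤ ENNReal.ofReal ((κ / 2) ^ 2) := by
          rw [hle x ⟨hx0, le_rfl⟩]
          exact (hu 0).small x hxI
        have h3 := hs_add_le s (coeff (v x)) (fun k => coeff (v r) k - coeff (v x) k)
        simp only [add_sub_cancel] at h3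
        -- `2 ((κ/2)² + (κ/2)²) = κ²`: the halved radius of `u` leaves just the room required.
        refine h3.trans ((mul_le_mul_right (add_le_add h2 h1.le) 2).trans (le_of_eq ?_))
        rw [← ENNReal.ofReal_add (by positivity) (by positivity), ← ENNReal.ofReal_ofNat,
          ← ENNReal.ofReal_mul (by norm_num)]
        congr 1
        ring
    have hvA : ∀ N, IsApprox A s κ z N fun t => coeff (v t) := fun N =>
      ⟨hsmall, fun k _ t ht => hasDerivWithinAt_of_integral (g := fun τ => rhs A (coeff (v τ)) k)
        (fun τ hτ => tendsto_rhs hA hs1 hκ.le (eventually_nhdsWithin_of_forall hsmall)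
          (fun j => ((hcv j).mono hsub) τ hτ) k)
        (fun τ hτ => hsol.coeff_eq ha hs0 hfin k (hsub hτ)) ht⟩
    have heq := huniq z (fun t => coeff (v t)) u hvA
      (fun N => (hu N).restrict (by positivity) (by linarith) hzT) hv0
    refine ⟨z, fun θ hθ => heq (θ * z) ?_, hxz, hzy⟩
    have hz0 : 0 ≤ z := hx0.trans hxz.le
    exact ⟨mul_nonneg hθ.1 hz0, mul_le_of_le_one_left hz0 hθ.2⟩
  intro t ht
  simpa using key ht 1 ⟨zero_le_one, le_rfl⟩

end BenjaminOno

end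

/-! ### Return from Fourier coefficients to real functions on the torus -/

theorem theorem2p13 (a : BenjaminOno.Torus → ℝ) (ha_smooth : BenjaminOno.Smooth a)
    (ha_nonneg : ∀ x, 0 ≤ a x) (ha_int : ∫ x : BenjaminOno.Torus, a x = 1)
    (s : ℝ) (hs : s ∈ Set.Ioc (1 / 2 : ℝ) 2) :
    ∃ ρ : ℝ, 0 < ρ ∧
      ∀ u₀ ∈ BenjaminOno.H0 s, BenjaminOno.sobolevNorm s u₀ < ENNReal.ofReal ρ →
        ∃ T : ℝ, 0 < T ∧
          ∃ u ∈ BenjaminOno.Z s T, BenjaminOno.IsSolution a T u₀ u ∧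
            ∀ v ∈ BenjaminOno.Z s T, BenjaminOno.IsSolution a T u₀ v →
              ∀ t ∈ Set.Icc 0 T, v t = u t := by
  open BenjaminOno in
  set A := fourierCoeff fun x => (a x : ℂ) with hAdef
  have hA : Decay A := ha_smooth.ofReal.decay
  have hcj : ∀ k, A (-k) = (starRingEnd ℂ) (A k) := fourierCoeff_ofReal_neg a
  have hA0 : 2 * Real.pi * A 0 = 1 := fourierCoeff_ofReal_zero ha_int
  have hs0 : 0 ≤ s := by linarith [hs.1]
  obtain ⟨κ, ρ, hκ, hρ, huniq, hex⟩ := exists_wellposed hA hcj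
    (fun h => by simp [h] at hA0) hs.1 hs.2
  -- For data this small the time of existence can be taken to be `1`, whatever `u₀` is.
  refine ⟨ρ, hρ, fun u₀ hu₀ hsmall => ⟨1, one_pos, ?_⟩⟩
  obtain ⟨u, hu, hu0, hint⟩ := hex (coeff u₀) (by
    rw [ENNReal.ofReal_pow hρ.le]
    exact (hs_le_sobolevNorm_sq s u₀).trans (pow_le_pow_left' hsmall.le 2))
  -- The conjugate function solves the same equation from the same real data, so uniqueness makes
  -- the solution real-valued.
  have hreal : ∀ t ∈ Icc (0 : ℝ) 1, reflect (u t) = u t := by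
    have huκ : ∀ N, IsApprox A s κ 1 N u := fun N =>
      (hu N).restrict (by positivity) (by linarith) le_rfl
    refine huniq 1 _ u (fun N => (huκ N).reflect hcj) huκ ?_
    funext k
    rw [hu0, reflect, coeff_neg, Complex.conj_conj]
  have hfin : ∀ t ∈ Icc (0 : ℝ) 1, BenjaminOno.hs s (u t) < ⊤ := fun t ht =>
    ((hu 0).small t ht).trans_lt ENNReal.ofReal_lt_top
  have hV : ∀ t, ∃ U : L2, t ∈ Icc (0 : ℝ) 1 → coeff U = u t := fun t => by
    by_cases ht : t ∈ Icc (0 : ℝ) 1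
    · obtain ⟨U, hU⟩ := exists_coeff_eq (c := u t) (fun k => by
        rw [← congrFun (hreal t ht) (-k), reflect, neg_neg]) (by
        have := summable_of_hs_le (sq_nonneg (κ / 2))
          ((hs_mono hs0 (u t)).trans ((hu 0).small t ht))
        simpa using this)
      exact ⟨U, fun _ => hU⟩
    · exact ⟨0, fun h => absurd h ht⟩
  choose V hV using hV
  have hc := continuousOn_of_isApprox hu
  have hκ2 : 0 ≤ κ / 2 := by positivity
  have hVZ : V ∈ Z s 1 := by
    refine ⟨⟨fun t ht => ⟨?_, ?_⟩, fun t ht => ?_⟩, ?_⟩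
    · refine sobolevNorm_lt_top ?_
      rw [hV t ht]
      exact hfin t ht
    · rw [hV t ht, (hu 0).eq_integral hA hs.1 hκ2 hc (by simp [modes]) ht]
      simp only [rhs_zero hA0, intervalIntegral.integral_zero, add_zero, hu0]
      exact hu₀.2
    · have h1 := tendsto_hs_sub hA hs.1 hs.2 hκ2 hu hint ht
      have h2 := (ENNReal.continuous_rpow_const (y := (1 / 2 : ℝ))).continuousAt.tendsto.comp
        (ENNReal.Tendsto.const_mul (a := ENNReal.ofReal (2 * Real.pi)) h1
          (Or.inr ENNReal.ofReal_ne_top))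
      rw [mul_zero, ENNReal.zero_rpow_of_pos (by norm_num)] at h2
      refine h2.congr' (eventually_nhdsWithin_of_forall fun r hr => ?_)
      change _ = sobolevNorm s (V r - V t)
      rw [sobolevNorm_eq, funext (coeff_sub (V r) (V t)), hV t ht, hV r hr]
      rfl
    · have e : ∫⁻ t in Ioo (0 : ℝ) 1, sobolevNorm (s + 1 / 2) (V t) ^ 2 =
          ∫⁻ t in Ioo (0 : ℝ) 1, ENNReal.ofReal (2 * Real.pi) * BenjaminOno.hs (s + 1 / 2) (u t) :=
        setLIntegral_congr_fun measurableSet_Ioo fun t ht => by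
          rw [sobolevNorm_sq, hV t (Ioo_subset_Icc_self ht)]
      rw [e, lintegral_const_mul' _ _ ENNReal.ofReal_ne_top]
      exact ENNReal.mul_lt_top ENNReal.ofReal_lt_top hint
  refine ⟨V, hVZ, isSolution_of_isApprox ha_smooth hs.1 hκ2 hu hu0 zero_le_one hV,
    fun v hv hsol t ht => coeff_injective ?_⟩
  rw [hV t ht]
  exact eq_of_isSolution ha_smooth hs.1 hκ huniq hu hu0 hv.1 hsol t ht
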